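/- **Theorem (representation theory of the Hecke group algebra).** Let $k$ be a field and $(W,(s_i)_{i\in S})$ a finite Coxeter group with length function $\ell$, parabolic subgroups $W_J=\langle s_j : j\in J\rangle$ and left descent sets $D_L(w)=\{i : \ell(s_iw)<\ell(w)\}$. On the space $kW$ let $s_i$ and $\pi_i$ be the operators acting on the right by $w\cdot s_i = ws_i$, and $w\cdot\pi_i = ws_i$ if $\ell(ws_i)>\ell(w)$, $w\cdot\pi_i=w$ otherwise. The operators $s_i$ generate a copy of the group algebra $k[W]$, the operators $\pi_i$ generate the $0$-Hecke algebra $H(W)(0)$, and all of them together generate the Hecke group algebra $\mathcal H W\subset \operatorname{End}(kW)$. Modules are right modules. For $I\subseteq S$ let $P_I=\{v\in kW : s_iv=-v\ \text{for all } i\in I\}$ (left multiplication), which is an $\mathcal HW$-submodule of $kW$. For $w\in W$ let $v_w=\sum_{u\in W_{S\setminus D_L(w)}}(-1)^{\ell(u)}uw$. Then $(v_w)_{w\in W}$ is a basis of $kW$; let $e_{w,w}$ be the diagonal matrix units of $\operatorname{End}(kW)$ for this basis. 1. The $e_{w,w}$ lie in $\mathcal HW$ and form a maximal decomposition of the identity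 of $\mathcal HW$ into orthogonal idempotents, i.e. they are pairwise orthogonal primitive idempotents with sum $1$. 2. $\mathcal HW$ is Morita equivalent (over $k$) to the incidence algebra over $k$ of the Boolean lattice of subsets of $S$. 3. The $P_I$, $I\subseteq S$, are the indecomposable projective $\mathcal HW$-modules: each $P_I$ is one, they are pairwise non-isomorphic, and every indecomposable projective module is isomorphic to some $P_I$. 4. The $S_I=P_I/\sum_{J\supsetneq I}P_J$, $I\subseteq S$, are the simple $\mathcal HW$-modules (each is simple, they are pairwise non-isomorphic, and every simple module is isomorphic to some $S_I$). The elements of $S_I$ are left antisymmetric for $i\in I$ and left symmetric for $i\notin I$, in the following sense: they are classes of elements of $P_I$, and $S_I$ embeds, by sending the class of $v\in P_I$ to the class of $v$, into the quotient of $kW$ by the relations $s_iv=v$ ($i\notin I$, $v\in kW$). Moreover: * for every $I$, the restriction of $S_I$ to $k[W]$ is isomorphic to the ribbon Young representation of $W$ attached to $I$, i.e. the right ideal of $k[W]$ generated by the Young symmetrizer $\bigl(\sum_{u\in W_{S\setminus I}}u\bigr)\bigl(\sum_{u\in W_I}(-1)^{\ell(u)}u\bigr)$; * the restrictions of the $S_I$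 to the $0$-Hecke algebra $H(W)(0)$ are the indecomposable projective $H(W)(0)$-modules: each is one, they are pairwise non-isomorphic, and every indecomposable projective $H(W)(0)$-module is isomorphic to one of them. -/

import Mathlib

universe v

/-!
Conventions. The Hecke group algebra is realised inside `End(kW)` and acts on `kW` from the right,
operators being composed from left to right. A right module over an algebra of operators composed
from left to right is the same as a left module over the same operators with the usual composition
of `Module.End`. Hence all "right modules" are Mathlib (left) modules over subalgebras of
`Module.End k (MonoidAlgebra k W)`; multiplication of group elements on the left of `kW` commutes
with right multiplications and is used to define the (anti)symmetric vectors.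
-/

namespace HeckeGroup

/-! ### The exchange property used to see that the spaces `P_I` are stable -/

section Exchange
variable {B W : Type*} [Group W] {M : CoxeterMatrix B} (cs : CoxeterSystem M W)

open Classical in
/-- The involution `(t, z) ↦ (s t s, z + [t = s])` of `W × ℤ/2`. -/
noncomputable def reflStep (s : W) : Function.End (W × ZMod 2) :=
  fun p => (s * p.1 * s, p.2 + if p.1 = s then 1 else 0)

open Classical in
lemma reflStep_pow (s s' : W) (hs : s * s = 1) (hs' : s' * s' = 1) (n : ℕ) (t : W) (z : ZMod 2) :
    ((reflStep s * reflStep s') ^ n) (t, z) =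
      ((s * s') ^ n * t * (s' * s) ^ n,
        z + ∑ k ∈ Finset.range (2 * n), if t = (s' * s) ^ k * s' then 1 else 0) := by
  have hinv : s⁻¹ = s := inv_eq_of_mul_eq_one_right hs
  have hinv' : s'⁻¹ = s' := inv_eq_of_mul_eq_one_right hs'
  have hr : (s * s') = (s' * s)⁻¹ := by rw [mul_inv_rev, hinv, hinv']
  have hconj : ∀ n : ℕ, (s' * s) ^ n * s' = s' * (s * s') ^ n := by
    intro n
    induction n with
    | zero => simp
    | succ n ih => rw [pow_succ', mul_assoc, ih, pow_succ']; simp only [mul_assoc]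
  induction n generalizing t z with
  | zero => simp; rfl
  | succ n ih =>
    rw [pow_succ']
    change (reflStep s * reflStep s') (((reflStep s * reflStep s') ^ n) (t, z)) = _
    rw [ih]
    change reflStep s (reflStep s' _) = _
    simp only [reflStep]
    refine Prod.ext ?_ ?_
    · simp only [pow_succ' (s * s'), pow_succ (s' * s), mul_assoc]
    · have h1 : ((s * s') ^ n * t * (s' * s) ^ n = s') ↔ t = (s' * s) ^ (2 * n) * s' := by
        rw [hr, inv_pow, mul_assoc, inv_mul_eq_iff_eq_mul, ← eq_mul_inv_iff_mul_eq, ← inv_pow, ← hr,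
          mul_assoc, ← hconj, two_mul, pow_add, mul_assoc]
      have h2 : (s' * ((s * s') ^ n * t * (s' * s) ^ n) * s' = s) ↔
          t = (s' * s) ^ (2 * n + 1) * s' := by
        have : (s' * ((s * s') ^ n * t * (s' * s) ^ n) * s' = s) ↔
            ((s * s') ^ n * t * (s' * s) ^ n = s' * s * s') := by
          generalize (s * s') ^ n * t * (s' * s) ^ n = x
          rw [← eq_mul_inv_iff_mul_eq, ← eq_inv_mul_iff_mul_eq, hinv', mul_assoc]
        rw [this, hr, inv_pow, mul_assoc, inv_mul_eq_iff_eq_mul, ← eq_mul_inv_iff_mul_eq,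
          ← inv_pow, ← hr, mul_assoc, mul_assoc (s' * s), ← hconj, ← mul_assoc, ← mul_assoc,
          ← pow_succ, ← pow_add]
        rw [show n + 1 + n = 2 * n + 1 by ring]
      rw [show 2 * (n + 1) = 2 * n + 1 + 1 by ring, Finset.sum_range_succ, Finset.sum_range_succ]
      simp only [h1, h2, add_assoc]

lemma reflStep_pow_eq_one {s s' : W} (hs : s * s = 1) (hs' : s' * s' = 1) {m : ℕ}
    (hr : (s * s') ^ m = 1) (hr' : (s' * s) ^ m = 1) :
    (reflStep s * reflStep s') ^ m = 1 := by
  classical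
  funext p
  obtain ⟨t, z⟩ := p
  rw [reflStep_pow s s' hs hs', hr, hr', two_mul, Finset.sum_range_add]
  simp only [pow_add, hr', one_mul, mul_one]
  rw [← two_mul, show (2 : ZMod 2) = 0 from rfl, zero_mul, add_zero]
  rfl

/-- The action of `W` on `W × ℤ/2` that records the parity of inversions. -/
noncomputable def reflHom : W →* Function.End (W × ZMod 2) :=
  cs.lift ⟨fun i => reflStep (cs.simple i), by
    intro i j
    have hr : (cs.simple i * cs.simple j) ^ M i j = 1 := cs.simple_mul_simple_pow i j
    have hr' : (cs.simple j * cs.simple i) ^ M i j = 1 := cs.simple_mul_simple_pow' i j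
    exact reflStep_pow_eq_one (cs.simple_mul_simple_self i) (cs.simple_mul_simple_self j) hr hr'⟩

open Classical in
lemma reflHom_wordProd (ω : List B) (t : W) (z : ZMod 2) :
    reflHom cs (cs.wordProd ω) (t, z) =
      (cs.wordProd ω * t * (cs.wordProd ω)⁻¹, z + ((cs.rightInvSeq ω).count t : ℕ)) := by
  induction ω with
  | nil => simp; rfl
  | cons i ω ih =>
    rw [cs.wordProd_cons, map_mul]
    change reflHom cs (cs.simple i) (reflHom cs (cs.wordProd ω) (t, z)) = _
    rw [ih]
    have : reflHom cs (cs.simple i) = reflStep (cs.simple i) := cs.lift_apply_simple _ i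
    rw [this]
    simp only [reflStep, CoxeterSystem.rightInvSeq, List.count_cons]
    refine Prod.ext ?_ ?_
    · simp [mul_assoc]
    · have : (cs.wordProd ω * t * (cs.wordProd ω)⁻¹ = cs.simple i) ↔
          ((cs.wordProd ω)⁻¹ * cs.simple i * cs.wordProd ω = t) := by
        constructor
        · intro h; rw [← h]; group
        · intro h; rw [← h]; group
      simp only [this, beq_iff_eq]
      push_cast
      rw [add_assoc]

/-- If `s_i` is a right descent of `s_j w` but not of `w`, then `s_j w = w s_i`. -/
lemma simple_mul_eq_mul_simple {w : W} {i j : B} (h : ¬ cs.IsRightDescent w i)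
    (h' : cs.IsRightDescent (cs.simple j * w) i) : cs.simple j * w = w * cs.simple i := by
  classical
  obtain ⟨ω, hω, rfl⟩ := cs.exists_isReduced w
  obtain ⟨ω', hω', hw'⟩ := cs.exists_isReduced (cs.simple j * cs.wordProd ω * cs.simple i)
  have hprod : cs.wordProd (ω' ++ [i]) = cs.wordProd (j :: ω) := by
    rw [cs.wordProd_append, ← hw', cs.wordProd_singleton, cs.wordProd_cons]; simp
  have hred : cs.IsReduced (ω' ++ [i]) := by
    have := cs.isRightDescent_iff.1 h'
    rw [CoxeterSystem.IsReduced, hprod, cs.wordProd_cons, ← this, hw', hω'.eq]; simp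
  have hc : (cs.rightInvSeq (ω' ++ [i])).count (cs.simple i) = 1 := by
    refine List.count_eq_one_of_mem hred.nodup_rightInvSeq ?_
    rw [← List.concat_eq_append, cs.rightInvSeq_concat]; simp
  have key : ((cs.rightInvSeq (j :: ω)).count (cs.simple i) : ZMod 2) = 1 := by
    have h1 := reflHom_wordProd cs (ω' ++ [i]) (cs.simple i) 0
    rw [hprod, reflHom_wordProd, hc] at h1
    simpa using (Prod.ext_iff.1 h1).2
  have hmem : cs.simple i ∈ cs.rightInvSeq (j :: ω) := by
    by_contra hn
    rw [List.count_eq_zero_of_not_mem hn] at key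
    simp at key
  rw [CoxeterSystem.rightInvSeq, List.mem_cons] at hmem
  rcases hmem with hm | hm
  · rw [hm]; group
  · exact absurd ((cs.isRightInversion_simple_iff_isRightDescent _ _).1
      (cs.isRightInversion_of_mem_rightInvSeq hω hm)) h

end Exchange

/-! ### Operators on the group algebra and the Hecke group algebra -/

section Operators
variable (k : Type*) [CommRing k] {B W : Type*} [Group W] {M : CoxeterMatrix B}
  (cs : CoxeterSystem M W)

/-- The operator `w ↦ w s_i` on `kW`. -/
noncomputable def sOp (i : B) : Module.End k (MonoidAlgebra k W) :=
  LinearMap.mulRight k (MonoidAlgebra.single (cs.simple i) 1)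

open Classical in
/-- The operator `π_i` on `kW`: `w ↦ w s_i` if `i` is not a right descent of `w`, and `w ↦ w`
otherwise. -/
noncomputable def piOp (i : B) : Module.End k (MonoidAlgebra k W) :=
  (MonoidAlgebra.basis W k).constr k fun w =>
    MonoidAlgebra.single (if cs.IsRightDescent w i then w else w * cs.simple i) 1

/-- The Hecke group algebra: the algebra of operators on `kW` generated by the `s_i` and `π_i`. -/
noncomputable def heckeGroupAlgebra : Subalgebra k (Module.End k (MonoidAlgebra k W)) :=
  Algebra.adjoin k (Set.range (sOp k cs) ∪ Set.range (piOp k cs))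

/-- The group algebra of `W`, realised as the algebra of operators on `kW` generated by the `s_i`
(the right regular representation). -/
noncomputable def groupOperators : Subalgebra k (Module.End k (MonoidAlgebra k W)) :=
  Algebra.adjoin k (Set.range (sOp k cs))

/-- The `0`-Hecke algebra of `W`, realised as the algebra of operators on `kW` generated by the
`π_i`. -/
noncomputable def zeroHeckeAlgebra : Subalgebra k (Module.End k (MonoidAlgebra k W)) :=
  Algebra.adjoin k (Set.range (piOp k cs))

variable {k} in
/-- The algebra of operators `A`, as a type carrying its ring structure and its action on `kW`. -/
def OpAlg (A : Subalgebra k (Module.End k (MonoidAlgebra k W))) : Type _ := A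

namespace OpAlg
variable {k} (A : Subalgebra k (Module.End k (MonoidAlgebra k W)))

noncomputable instance : Ring (OpAlg A) := inferInstanceAs (Ring A)

noncomputable instance : Algebra k (OpAlg A) := inferInstanceAs (Algebra k A)

/-- The operators of `A` act on `kW`. -/
noncomputable instance : Module (OpAlg A) (MonoidAlgebra k W) :=
  inferInstanceAs (Module A (MonoidAlgebra k W))

instance : IsScalarTower k (OpAlg A) (MonoidAlgebra k W) :=
  inferInstanceAs (IsScalarTower k A (MonoidAlgebra k W))

variable {A} in
/-- An element of `A`, as an operator on `kW`. -/
def toEnd (f : OpAlg A) : Module.End k (MonoidAlgebra k W) := f.1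

/-- The inclusion of a smaller algebra of operators into a larger one. -/
noncomputable def inclusion {A A' : Subalgebra k (Module.End k (MonoidAlgebra k W))}
    (h : A ≤ A') : OpAlg A →+* OpAlg A' := (Subalgebra.inclusion h).toRingHom

end OpAlg

lemma groupOperators_le : groupOperators k cs ≤ heckeGroupAlgebra k cs :=
  Algebra.adjoin_mono Set.subset_union_left

lemma zeroHeckeAlgebra_le : zeroHeckeAlgebra k cs ≤ heckeGroupAlgebra k cs :=
  Algebra.adjoin_mono Set.subset_union_right

/-- `v` satisfies `s_i v = -v` (left multiplication) for all `i ∈ I`. -/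
def IsLeftAntisymmetric (I : Set B) (v : MonoidAlgebra k W) : Prop :=
  ∀ i ∈ I, MonoidAlgebra.single (cs.simple i) 1 * v = -v

variable {k}

open Classical in
lemma piOp_single (i : B) (w : W) : piOp k cs i (MonoidAlgebra.single w 1) =
    MonoidAlgebra.single (if cs.IsRightDescent w i then w else w * cs.simple i) 1 := by
  classical
  rw [← MonoidAlgebra.basis_apply, piOp, Module.Basis.constr_basis]

lemma piOp_antisymm (i j : B) (v : MonoidAlgebra k W)
    (hv : MonoidAlgebra.single (cs.simple j) 1 * v = -v) :
    MonoidAlgebra.single (cs.simple j) 1 * piOp k cs i v = -piOp k cs i v := by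
  classical
  let L : Module.End k (MonoidAlgebra k W) :=
    LinearMap.mulLeft k (MonoidAlgebra.single (cs.simple j) 1)
  let D : Module.End k (MonoidAlgebra k W) := L * piOp k cs i - piOp k cs i * L
  have hL : ∀ w : W, L (MonoidAlgebra.single w 1) = MonoidAlgebra.single (cs.simple j * w) 1 := by
    intro w; simp [L, MonoidAlgebra.single_mul_single]
  have hD : ∀ w : W, D (MonoidAlgebra.single (cs.simple j * w) 1) =
      D (MonoidAlgebra.single w 1) := by
    intro w
    simp only [D, LinearMap.sub_apply, Module.End.mul_apply, hL, piOp_single]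
    by_cases h1 : cs.IsRightDescent w i <;>
      by_cases h2 : cs.IsRightDescent (cs.simple j * w) i
    · simp only [if_pos h1, if_pos h2, sub_self, CoxeterSystem.simple_mul_simple_cancel_left]
    · have h3 : cs.IsRightDescent (cs.simple j * (cs.simple j * w)) i := by simpa using h1
      have h := simple_mul_eq_mul_simple cs h2 h3
      simp only [CoxeterSystem.simple_mul_simple_cancel_left] at h
      simp [h1, h2, ← h]
    · have h := simple_mul_eq_mul_simple cs h1 h2
      simp only [CoxeterSystem.simple_mul_simple_cancel_left, if_neg h1, if_pos h2]
      rw [← h, CoxeterSystem.simple_mul_simple_cancel_left]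
    · simp [h1, h2, mul_assoc]
  have hcoeff : ∀ w, v.coeff (cs.simple j * w) = -v.coeff w := by
    intro w
    have := congrArg (fun x => x.coeff (cs.simple j * w)) hv
    simp at this
    rw [this]; simp
  have hDv : D v = 0 := by
    have hv' : v = ∑ w ∈ v.coeff.support, v.coeff w • MonoidAlgebra.single w (1 : k) := by
      have := (MonoidAlgebra.basis W k).linearCombination_repr v
      rw [Finsupp.linearCombination_apply, Finsupp.sum] at this
      simp only [MonoidAlgebra.basis_apply] at this
      exact this.symm
    rw [hv', map_sum]
    simp only [map_smul]
    refine Finset.sum_involution (fun w _ => cs.simple j * w) ?_ ?_ ?_ ?_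
    · intro w _
      rw [hcoeff, hD, neg_smul, add_neg_cancel]
    · intro w _ _ h
      exact cs.length_simple_mul_ne w j (congrArg cs.length h)
    · intro w hw
      rw [Finsupp.mem_support_iff] at hw ⊢
      rw [hcoeff]; exact neg_ne_zero.2 hw
    · intro w _
      simp
  have h : L (piOp k cs i v) - piOp k cs i (L v) = 0 := hDv
  have h' : L v = -v := hv
  rw [h', map_neg, sub_eq_zero] at h
  exact h

lemma IsLeftAntisymmetric.apply {I : Set B} {f : Module.End k (MonoidAlgebra k W)}
    (hf : f ∈ heckeGroupAlgebra k cs) {v : MonoidAlgebra k W} (hv : IsLeftAntisymmetric k cs I v) :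
    IsLeftAntisymmetric k cs I (f v) := by
  have key : ∀ v : MonoidAlgebra k W, IsLeftAntisymmetric k cs I v →
      IsLeftAntisymmetric k cs I (f v) := by
    unfold heckeGroupAlgebra at hf
    induction hf using Algebra.adjoin_induction with
    | mem f hf =>
      intro v hv j hj
      rcases hf with ⟨i, rfl⟩ | ⟨i, rfl⟩
      · simp only [sOp, LinearMap.mulRight_apply]
        rw [← mul_assoc, hv j hj, neg_mul]
      · exact piOp_antisymm cs i j v (hv j hj)
    | algebraMap r =>
      intro v hv j hj
      rw [Module.algebraMap_end_apply, mul_smul_comm, hv j hj, smul_neg]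
    | add f g _ _ hf hg =>
      intro v hv j hj
      rw [LinearMap.add_apply, mul_add, hf v hv j hj, hg v hv j hj, neg_add]
    | mul f g _ _ hf hg =>
      intro v hv
      exact hf _ (hg v hv)
  exact key v hv

variable (k)

/-- `P_I = {v ∈ kW | s_i v = -v for all i ∈ I}`, as a module over the Hecke group algebra. -/
def antisymModule (I : Set B) : Submodule (OpAlg (heckeGroupAlgebra k cs)) (MonoidAlgebra k W) where
  carrier := {v | IsLeftAntisymmetric k cs I v}
  zero_mem' := fun i _ => by simp
  add_mem' := fun {a b} ha hb i hi => by rw [mul_add, ha i hi, hb i hi, neg_add]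
  smul_mem' := fun f _ hv => IsLeftAntisymmetric.apply cs f.2 hv

/-- `S_I = P_I / ∑_{J ⊋ I} P_J`, as a module over the Hecke group algebra. -/
abbrev simpleQuotient (I : Set B) : Type _ :=
  antisymModule k cs I ⧸ (⨆ J ∈ {J : Set B | I ⊂ J}, antisymModule k cs J).submoduleOf
    (antisymModule k cs I)

/-- The span of all `v - s_i v`, `v ∈ kW`, `i ∉ I`. The quotient of `kW` by this subspace is the
largest one on which left multiplication by each `s_i`, `i ∉ I`, is the identity. -/
noncomputable def leftSymRelations (I : Set B) : Submodule k (MonoidAlgebra k W) :=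
  Submodule.span k
    {x | ∃ i ∉ I, ∃ v : MonoidAlgebra k W, x = v - MonoidAlgebra.single (cs.simple i) 1 * v}

variable {k}

/-- The parabolic subgroup `W_J`, generated by the `s_j`, `j ∈ J`. -/
def parabolic (J : Set B) : Subgroup W := Subgroup.closure (cs.simple '' J)

variable (k)

open Classical in
/-- The sum of the elements of `W_J`. -/
noncomputable def symSum [Fintype W] (J : Set B) : MonoidAlgebra k W :=
  ∑ u : W with u ∈ parabolic cs J, MonoidAlgebra.single u 1

open Classical in
/-- The signed sum of the elements of `W_J`. -/
noncomputable def altSum [Fintype W] (J : Set B) : MonoidAlgebra k W :=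
  ∑ u : W with u ∈ parabolic cs J, MonoidAlgebra.single u ((-1) ^ cs.length u)

/-- `v_w = ∑ (-1)^{ℓ(w')} w' w`, the sum over `w'` in the parabolic subgroup generated by the
`s_i` such that `i` is not a left descent of `w`. -/
noncomputable def antisymVector [Fintype W] (w : W) : MonoidAlgebra k W :=
  altSum k cs {i | ¬ cs.IsLeftDescent w i} * MonoidAlgebra.single w 1

/-- The ribbon Young representation of `W` attached to `I`: the right ideal of the group algebra
generated by the Young symmetrizer `(∑_{u ∈ W_{S∖I}} u) (∑_{u ∈ W_I} (-1)^{ℓ(u)} u)`.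
For `W` a symmetric group, `W_{S∖I}` and `W_I` are the row and column stabilizers of the standard
filling of the ribbon with descent set `I`, and this is the usual (skew) Young representation. -/
noncomputable def ribbon [Fintype W] (I : Set B) :
    Submodule (OpAlg (groupOperators k cs)) (MonoidAlgebra k W) :=
  Submodule.span _ {symSum k cs Iᶜ * altSum k cs I}

/-- The restriction of `S_I` to the group algebra of `W`. -/
noncomputable abbrev resGroup (I : Set B) : ModuleCat (OpAlg (groupOperators k cs)) :=
  (ModuleCat.restrictScalars (OpAlg.inclusion (groupOperators_le k cs))).obj
    (ModuleCat.of (OpAlg (heckeGroupAlgebra k cs)) (simpleQuotient k cs I))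

/-- The restriction of `S_I` to the `0`-Hecke algebra of `W`. -/
noncomputable abbrev resZeroHecke (I : Set B) : ModuleCat (OpAlg (zeroHeckeAlgebra k cs)) :=
  (ModuleCat.restrictScalars (OpAlg.inclusion (zeroHeckeAlgebra_le k cs))).obj
    (ModuleCat.of (OpAlg (heckeGroupAlgebra k cs)) (simpleQuotient k cs I))

end Operators

/-! ### General notions of representation theory -/

/-- An idempotent is primitive if it is nonzero and is not the sum of two nonzero orthogonal
idempotents. -/
def IsPrimitiveIdempotent {R : Type*} [Ring R] (e : R) : Prop :=
  IsIdempotentElem e ∧ e ≠ 0 ∧ ∀ f g : R, IsIdempotentElem f → IsIdempotentElem g →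
    f * g = 0 → g * f = 0 → e = f + g → f = 0 ∨ g = 0

/-- A nonzero module is indecomposable if it is not the direct sum of two nonzero submodules. -/
def IsIndecomposable (R X : Type*) [Ring R] [AddCommGroup X] [Module R X] : Prop :=
  Nontrivial X ∧ ∀ N N' : Submodule R X, IsCompl N N' → N = ⊥ ∨ N' = ⊥

/-- The family `P` consists of the indecomposable projective modules of `R`: each member is one,
each is isomorphic to a member, and distinct members are not isomorphic. -/
def AreTheIndecomposableProjectives (R : Type*) [Ring R] {ι : Type*} (P : ι → Type*)
    [∀ i, AddCommGroup (P i)] [∀ i, Module R (P i)] : Prop :=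
  (∀ i, Module.Projective R (P i) ∧ IsIndecomposable R (P i)) ∧
  (∀ i j, Nonempty (P i ≃ₗ[R] P j) → i = j) ∧
  ∀ (X : Type v) [AddCommGroup X] [Module R X],
    Module.Projective R X → IsIndecomposable R X → ∃ i, Nonempty (X ≃ₗ[R] P i)

/-- The family `P` consists of the simple modules of `R`: each member is one, each is isomorphic
to a member, and distinct members are not isomorphic. -/
def AreTheSimpleModules (R : Type*) [Ring R] {ι : Type*} (P : ι → Type*)
    [∀ i, AddCommGroup (P i)] [∀ i, Module R (P i)] : Prop :=
  (∀ i, IsSimpleModule R (P i)) ∧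
  (∀ i j, Nonempty (P i ≃ₗ[R] P j) → i = j) ∧
  ∀ (X : Type v) [AddCommGroup X] [Module R X],
    IsSimpleModule R X → ∃ i, Nonempty (X ≃ₗ[R] P i)

end HeckeGroup

open HeckeGroup

/-! Call the complement of the left descent set of `w` its ascent set, `asc(w)`. The vector `v_w` is
`w` plus a combination of strictly longer elements of `W_{asc(w)} w`. By this unitriangularity the
`v_w` form a basis, and `P_I` is spanned by the `v_w` with `I ⊆ asc(w)`
(`isLeftAntisymmetric_iff_repr`).

The operators of `HW` preserve every `P_I`, so they lie in the span of the matrix units `v_w ↦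
v_{w'}` with `asc(w) ⊆ asc(w')`. A dimension count gives equality (`matrixUnit_mem`): the operators
`x ↦ (x w) · π_{w'}`, where no right descent of `w` is a left descent of `w'`, are independent and
at least as numerous as these matrix units.

So `HW` is the algebra of a preorder on `W`. Its classes are indexed by all subsets `I`, because `I`
is the ascent set of the longest element of `W_{S∖I}`; this needs the simple reflections to be
distinct. Choosing one `w` per class gives a full corner, the incidence algebra of the Boolean
lattice. The `e_{w,w}` have scalar corners, and `P_I` is projective with largest proper submodule
`∑_{J ⊋ I} P_J`.

For the restrictions, two symmetrisations over `W_{S∖I}` are compared: left multiplication by the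
sum of `W_{S∖I}`, and the map `topOp` sending `x` to the longest element of `W_{S∖I} x`. Both have
as kernel the span of the relations `s_i v = v`, `i ∉ I`, and this kernel meets `P_I` in `∑_{J ⊋ I}
P_J`. The first commutes with right multiplications and yields the ribbon module. The second
commutes with the `π_i`, because left and right Demazure operators commute (`upL_upR_comm`). It
makes `S_I` a direct summand of `kW`, which is the regular module of the `0`-Hecke algebra. The
simple modules of that algebra are characters, and exactly one of them is a quotient of `S_I`. -/

namespace HeckeGroup

/-! ### Simple reflections are distinct -/

section Geometric

open Real Polynomial.Chebyshev

variable {B : Type*} (M : CoxeterMatrix B)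

/-- The linear form `v ↦ 2 B(α_i, v)` of the geometric representation. -/
noncomputable def rootForm (i : B) : Module.Dual ℝ (B →₀ ℝ) :=
  Finsupp.lift ℝ ℝ B fun j => -2 * cos (π / M i j)

lemma rootForm_single (i j : B) :
    rootForm M i (Finsupp.single j 1) = -2 * cos (π / M i j) := by
  simp [rootForm]

lemma rootForm_self (i : B) : rootForm M i (Finsupp.single i 1) = 2 := by
  simp [rootForm_single]

/-- The reflection attached to `i` in the geometric representation. -/
noncomputable def rootReflection (i : B) : (B →₀ ℝ) ≃ₗ[ℝ] (B →₀ ℝ) :=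
  Module.reflection (rootForm_self M i)

/-- On the plane of two simple roots the product of the reflections is a rotation by `θ = 2π / m`.
The formula for its powers involves Chebyshev polynomials at `2 cos θ`, and `S_n(2 cos θ) sin θ =
sin((n + 1) θ)` makes the relevant values vanish. -/
lemma rootReflection_isLiftable : M.IsLiftable (rootReflection M) := by
  intro i j
  ext1 z
  rcases eq_or_ne i j with rfl | hij
  · rw [M.diagonal, pow_one]
    exact Module.involutive_reflection (rootForm_self M i) z
  have h1 : M i j ≠ 1 := M.off_diagonal i j hij
  -- The entry `0` encodes infinite order, where nothing is required.
  rcases Nat.eq_zero_or_pos (M i j) with h0 | h0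
  · rw [h0, pow_zero]
  have ht : rootForm M i (Finsupp.single j 1) * rootForm M j (Finsupp.single i 1) - 2 =
      2 * cos (2 * π / M i j) := by
    rw [rootForm_single, rootForm_single, M.symmetric j i, mul_div_assoc, cos_two_mul]
    ring
  unfold rootReflection
  rw [Module.reflection_mul_reflection_pow_apply (rootForm_self M i) (rootForm_self M j)
    (M i j) z _ ht.symm]
  -- For `m = 2` one has `sin θ = 0`, which cannot be cancelled; but then each form vanishes on the
  -- other root.
  rcases eq_or_ne (M i j) 2 with h2 | h2
  · have hc : rootForm M i (Finsupp.single j 1) = 0 := by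
      rw [rootForm_single, h2]; simp
    have hc' : rootForm M j (Finsupp.single i 1) = 0 := by
      rw [rootForm_single, M.symmetric j i, h2]; simp
    rw [hc, hc', h2]
    have e1 : (((2 : ℕ) : ℤ) - 2) / 2 = 0 := by norm_num
    have e2 : (((2 : ℕ) : ℤ) - 1) / 2 = 0 := by norm_num
    have e3 : (((2 : ℕ) : ℤ) - 3) / 2 = -1 := by norm_num
    have e4 : (((2 : ℕ) : ℤ)) / 2 = 1 := by norm_num
    rw [e1, e2, e3, e4]
    simp
    ext b
    simp
    ring
  have h3 : 3 ≤ M i j := by omega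
  have hm : (3 : ℝ) ≤ M i j := by exact_mod_cast h3
  have hm0 : (M i j : ℝ) ≠ 0 := by positivity
  have hsin : sin (2 * π / M i j) ≠ 0 := by
    refine (sin_pos_of_pos_of_lt_pi (by positivity) ?_).ne'
    rw [div_lt_iff₀ (by positivity)]
    nlinarith [pi_pos]
  rcases Nat.even_or_odd' (M i j) with ⟨p, hp | hp⟩
  -- Here `m = 2p` and `p θ = π`.
  · have hS : (S ℝ ((p : ℤ) - 1)).eval (2 * cos (2 * π / M i j)) = 0 := by
      have := S_two_mul_real_cos (2 * π / M i j) ((p : ℤ) - 1)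
      rw [show (((p : ℤ) - 1 : ℤ) + 1 : ℝ) * (2 * π / M i j) = π by
        have : (M i j : ℝ) = 2 * p := by exact_mod_cast hp
        push_cast
        rw [sub_add_cancel, ← mul_div_assoc, div_eq_iff hm0, this]; ring, sin_pi] at this
      exact (mul_eq_zero.1 this).resolve_right hsin
    have e1 : ((M i j : ℤ) - 2) / 2 = (p : ℤ) - 1 := by omega
    have e2 : ((M i j : ℤ) - 1) / 2 = (p : ℤ) - 1 := by omega
    rw [e1, e2, hS]
    simp
  -- Here `m = 2p + 1` and `(p + 1) θ = 2π - p θ`, so the two sines are opposite.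
  · have hS : (S ℝ (p : ℤ)).eval (2 * cos (2 * π / M i j)) +
        (S ℝ ((p : ℤ) - 1)).eval (2 * cos (2 * π / M i j)) = 0 := by
      have h1 := S_two_mul_real_cos (2 * π / M i j) (p : ℤ)
      have h2 := S_two_mul_real_cos (2 * π / M i j) ((p : ℤ) - 1)
      have h3 : (((p : ℤ) : ℝ) + 1) * (2 * π / M i j) =
          2 * π - ((((p : ℤ) - 1 : ℤ) : ℝ) + 1) * (2 * π / M i j) := by
        have : (M i j : ℝ) = 2 * p + 1 := by exact_mod_cast hp
        rw [eq_sub_iff_add_eq, ← add_mul, ← mul_div_assoc, div_eq_iff hm0, this]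
        push_cast; ring
      rw [h3, sin_two_pi_sub] at h1
      have : ((S ℝ (p : ℤ)).eval (2 * cos (2 * π / M i j)) +
        (S ℝ ((p : ℤ) - 1)).eval (2 * cos (2 * π / M i j))) * sin (2 * π / M i j) = 0 := by
        rw [add_mul, h1, h2, neg_add_cancel]
      exact (mul_eq_zero.1 this).resolve_right hsin
    have e1 : ((M i j : ℤ) - 2) / 2 = (p : ℤ) - 1 := by omega
    have e2 : ((M i j : ℤ) - 1) / 2 = (p : ℤ) := by omega
    have e3 : ((M i j : ℤ) - 3) / 2 = (p : ℤ) - 1 := by omega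
    have e4 : (M i j : ℤ) / 2 = (p : ℤ) := by omega
    rw [e1, e2, e3, e4, hS]
    simp

/-- The reflection of `i` negates the root `α_i`, while the reflection of `j ≠ i` changes only
coordinate `j` and leaves the coordinate of `α_i` at `i` equal to `1`. -/
lemma simple_injective {M} {W : Type*} [Group W] (cs : CoxeterSystem M W) :
    Function.Injective (cs.simple : B → W) := by
  classical
  intro i j hij
  by_contra hne
  have h := congrArg (cs.lift ⟨_, rootReflection_isLiftable M⟩) hij
  rw [cs.lift_apply_simple, cs.lift_apply_simple] at h
  have h' := congrArg (fun f : (B →₀ ℝ) ≃ₗ[ℝ] (B →₀ ℝ) => f (Finsupp.single i 1) i) h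
  simp only [rootReflection, Module.reflection_apply, rootForm_self, Finsupp.sub_apply,
    Finsupp.smul_apply, Finsupp.single_eq_same, smul_eq_mul] at h'
  rw [Finsupp.single_eq_of_ne hne] at h'
  norm_num at h'

end Geometric

/-! ### Demazure operators on a Coxeter group -/

section Demazure

variable {B W : Type*} [Group W] {M : CoxeterMatrix B} (cs : CoxeterSystem M W)

open Classical in
/-- Left Demazure operator: `x ↦ s_i x` if this increases the length. -/
noncomputable def upL (i : B) (x : W) : W := if cs.IsLeftDescent x i then x else cs.simple i * x

open Classical in
/-- Right Demazure operator: `x ↦ x s_i` if this increases the length. -/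
noncomputable def upR (i : B) (x : W) : W := if cs.IsRightDescent x i then x else x * cs.simple i

lemma upL_of_descent {i : B} {x : W} (h : cs.IsLeftDescent x i) : upL cs i x = x := if_pos h

lemma upL_of_not_descent {i : B} {x : W} (h : ¬ cs.IsLeftDescent x i) :
    upL cs i x = cs.simple i * x := if_neg h

lemma upR_of_descent {i : B} {x : W} (h : cs.IsRightDescent x i) : upR cs i x = x := if_pos h

lemma upR_of_not_descent {i : B} {x : W} (h : ¬ cs.IsRightDescent x i) :
    upR cs i x = x * cs.simple i := if_neg h

lemma upL_eq_self_iff {i : B} {x : W} : upL cs i x = x ↔ cs.IsLeftDescent x i := by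
  refine ⟨fun h => ?_, upL_of_descent cs⟩
  by_contra h'
  rw [upL_of_not_descent cs h'] at h
  exact cs.length_simple_mul_ne x i (congrArg cs.length h)

lemma upL_one (i : B) : upL cs i 1 = cs.simple i := by
  rw [upL_of_not_descent cs (cs.not_isLeftDescent_one i), mul_one]

lemma upR_one (i : B) : upR cs i 1 = cs.simple i := by
  rw [upR_of_not_descent cs (cs.not_isRightDescent_one i), one_mul]

lemma length_le_length_upL (i : B) (x : W) : cs.length x ≤ cs.length (upL cs i x) := by
  by_cases h : cs.IsLeftDescent x i
  · rw [upL_of_descent cs h]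
  · rw [upL_of_not_descent cs h, cs.not_isLeftDescent_iff.1 h]; omega

/-- Lengths settle every case but one: `s_i` and `s_j` both lengthen `x`, yet `s_i x s_j` is shorter
than `s_i x`. There exchange gives `s_i x = x s_j`, and both sides equal this element. -/
lemma upL_upR_comm (i j : B) (x : W) : upL cs i (upR cs j x) = upR cs j (upL cs i x) := by
  have a1 := cs.length_simple_mul x i
  have a2 := cs.length_mul_simple x j
  have a3 := cs.length_simple_mul (x * cs.simple j) i
  have a4 := cs.length_mul_simple (cs.simple i * x) j
  rw [← mul_assoc] at a3
  by_cases h1 : cs.IsLeftDescent x i <;> by_cases h2 : cs.IsRightDescent x j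
  · rw [upR_of_descent cs h2, upL_of_descent cs h1, upR_of_descent cs h2]
  · rw [upR_of_not_descent cs h2, upL_of_descent cs h1, upR_of_not_descent cs h2,
      upL_of_descent cs]
    rw [CoxeterSystem.IsLeftDescent] at h1 ⊢
    rw [CoxeterSystem.IsRightDescent] at h2
    rw [← mul_assoc]; omega
  · rw [upR_of_descent cs h2, upL_of_not_descent cs h1, upR_of_descent cs]
    rw [CoxeterSystem.IsLeftDescent] at h1
    rw [CoxeterSystem.IsRightDescent] at h2 ⊢
    omega
  · rw [upR_of_not_descent cs h2, upL_of_not_descent cs h1]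
    by_cases h3 : cs.IsRightDescent (cs.simple i * x) j
    · have h := simple_mul_eq_mul_simple cs h2 h3
      rw [upR_of_descent cs h3, upL_of_descent cs, h]
      rw [CoxeterSystem.IsLeftDescent, ← mul_assoc, h, cs.simple_mul_simple_cancel_right]
      exact (cs.not_isRightDescent_iff.1 h2).symm ▸ Nat.lt_succ_self _
    · rw [upR_of_not_descent cs h3, upL_of_not_descent cs, mul_assoc]
      rw [CoxeterSystem.IsLeftDescent] at h1 ⊢
      rw [CoxeterSystem.IsRightDescent] at h2 h3
      rw [← mul_assoc]; omega

/-- The composite of the left Demazure operators along a word. -/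
noncomputable def upLs (ω : List B) (x : W) : W := ω.foldr (upL cs) x

/-- The composite of the right Demazure operators along a word. -/
noncomputable def upRs (ω : List B) (x : W) : W := ω.foldl (fun y i => upR cs i y) x

@[simp] lemma upLs_nil (x : W) : upLs cs [] x = x := rfl

@[simp] lemma upLs_cons (i : B) (ω : List B) (x : W) :
    upLs cs (i :: ω) x = upL cs i (upLs cs ω x) := rfl

lemma upLs_append (ω η : List B) (x : W) : upLs cs (ω ++ η) x = upLs cs ω (upLs cs η x) :=
  List.foldr_append

@[simp] lemma upRs_nil (x : W) : upRs cs [] x = x := rfl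

@[simp] lemma upRs_cons (i : B) (ω : List B) (x : W) :
    upRs cs (i :: ω) x = upRs cs ω (upR cs i x) := rfl

lemma upRs_append (ω η : List B) (x : W) : upRs cs (ω ++ η) x = upRs cs η (upRs cs ω x) :=
  List.foldl_append

lemma upLs_upR_comm (ω : List B) (j : B) (x : W) :
    upLs cs ω (upR cs j x) = upR cs j (upLs cs ω x) := by
  induction ω with
  | nil => rfl
  | cons i ω ih => rw [upLs_cons, ih, upL_upR_comm, upLs_cons]

lemma upLs_upRs_comm (ω η : List B) (x : W) :
    upLs cs ω (upRs cs η x) = upRs cs η (upLs cs ω x) := by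
  induction η generalizing x with
  | nil => rfl
  | cons i η ih => rw [upRs_cons, ih, upLs_upR_comm, upRs_cons]

lemma length_le_length_upLs (ω : List B) (x : W) : cs.length x ≤ cs.length (upLs cs ω x) := by
  induction ω with
  | nil => rfl
  | cons i ω ih => exact ih.trans (length_le_length_upL cs i _)

lemma upLs_eq_self_of_length_le {ω : List B} {x : W}
    (h : cs.length (upLs cs ω x) ≤ cs.length x) :
    upLs cs ω x = x ∧ ∀ i ∈ ω, cs.IsLeftDescent x i := by
  induction ω with
  | nil => simp
  | cons i ω ih =>
    have h1 := length_le_length_upL cs i (upLs cs ω x)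
    obtain ⟨h2, h3⟩ := ih (h1.trans h)
    rw [upLs_cons, h2] at h ⊢
    have : cs.IsLeftDescent x i := by
      by_contra h'
      rw [upL_of_not_descent cs h', cs.not_isLeftDescent_iff.1 h'] at h
      omega
    exact ⟨upL_of_descent cs this, by simpa [this] using h3⟩

lemma upLs_one_of_isReduced {ω : List B} (h : cs.IsReduced ω) : upLs cs ω 1 = cs.wordProd ω := by
  induction ω with
  | nil => simp
  | cons i ω ih =>
    have h' : cs.IsReduced ω := h.drop 1
    rw [upLs_cons, ih h', cs.wordProd_cons, upL_of_not_descent]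
    rw [cs.not_isLeftDescent_iff, ← cs.wordProd_cons, h.eq, h'.eq]; rfl

lemma upRs_one_of_isReduced {ω : List B} (h : cs.IsReduced ω) : upRs cs ω 1 = cs.wordProd ω := by
  induction ω using List.reverseRecOn with
  | nil => simp
  | append_singleton ω i ih =>
    have h' : cs.IsReduced ω := by simpa using h.take ω.length
    rw [upRs_append, ih h', cs.wordProd_append, cs.wordProd_singleton, upRs_cons, upRs_nil,
      upR_of_not_descent]
    rw [cs.not_isRightDescent_iff, ← cs.wordProd_singleton, ← cs.wordProd_append, h.eq, h'.eq]
    simp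

/-- A reduced word of `w`. -/
noncomputable def redWord (w : W) : List B := (cs.exists_isReduced w).choose

lemma redWord_isReduced (w : W) : cs.IsReduced (redWord cs w) :=
  (cs.exists_isReduced w).choose_spec.1

lemma wordProd_redWord (w : W) : cs.wordProd (redWord cs w) = w :=
  (cs.exists_isReduced w).choose_spec.2.symm

lemma upLs_redWord_one (w : W) : upLs cs (redWord cs w) 1 = w := by
  rw [upLs_one_of_isReduced cs (redWord_isReduced cs w), wordProd_redWord]

lemma upRs_redWord_one (w : W) : upRs cs (redWord cs w) 1 = w := by
  rw [upRs_one_of_isReduced cs (redWord_isReduced cs w), wordProd_redWord]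

/-- Every `x` is reached from `1` by right Demazure operators, which commute with the left ones.
This is associativity of the Demazure product. -/
lemma upLs_congr {ω η : List B} (h : upLs cs ω 1 = upLs cs η 1) (x : W) :
    upLs cs ω x = upLs cs η x := by
  rw [← upRs_redWord_one cs x, upLs_upRs_comm, upLs_upRs_comm, h]

lemma simple_mem_parabolic {I : Set B} {i : B} (hi : i ∈ I) : cs.simple i ∈ parabolic cs I :=
  Subgroup.subset_closure ⟨i, hi, rfl⟩

lemma wordProd_mem_parabolic {I : Set B} {ω : List B} (h : ∀ i ∈ ω, i ∈ I) :
    cs.wordProd ω ∈ parabolic cs I := by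
  induction ω with
  | nil => simp
  | cons i ω ih =>
    rw [cs.wordProd_cons]
    exact mul_mem (simple_mem_parabolic cs (h i (by simp))) (ih fun j hj => h j (by simp [hj]))

/-- An additive-length form of climbing with the left Demazure operators. -/
lemma exists_upLs_eq_wordProd_mul (ω : List B) (x : W) :
    ∃ η : List B, (∀ i ∈ η, i ∈ ω) ∧ upLs cs ω x = cs.wordProd η * x ∧
      cs.length (upLs cs ω x) = η.length + cs.length x := by
  induction ω with
  | nil => exact ⟨[], by simp⟩
  | cons i ω ih =>
    obtain ⟨η, h1, h2, h3⟩ := ih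
    by_cases h : cs.IsLeftDescent (upLs cs ω x) i
    · refine ⟨η, fun j hj => by simp [h1 j hj], ?_⟩
      rw [upLs_cons, upL_of_descent cs h]
      exact ⟨h2, h3⟩
    · refine ⟨i :: η, ?_, ?_, ?_⟩
      · intro j hj
        rcases List.mem_cons.1 hj with rfl | hj
        · simp
        · simp [h1 j hj]
      · rw [upLs_cons, upL_of_not_descent cs h, h2, cs.wordProd_cons, mul_assoc]
      · rw [upLs_cons, upL_of_not_descent cs h, cs.not_isLeftDescent_iff.1 h, h3,
          List.length_cons]; omega

/-- If `y` followed by the right Demazure operators of a reduced word of `w` is no longer than `w`,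
then it is `w`, and `y` is generated by left descents of `w`. -/
lemma upRs_redWord_eq_of_length_le {y w : W}
    (h : cs.length (upRs cs (redWord cs w) y) ≤ cs.length w) :
    upRs cs (redWord cs w) y = w ∧ y ∈ parabolic cs {i | cs.IsLeftDescent w i} := by
  -- Both sides are the Demazure product of `y` and `w`: build `y` from `1` by left steps and
  -- commute them past the right steps building `w`.
  have e : upRs cs (redWord cs w) y = upLs cs (redWord cs y) w := by
    conv_lhs => rw [← upLs_redWord_one cs y]
    rw [← upLs_upRs_comm, upRs_redWord_one]
  rw [e] at h ⊢
  obtain ⟨h1, h2⟩ := upLs_eq_self_of_length_le cs h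
  refine ⟨h1, ?_⟩
  rw [← wordProd_redWord cs y]
  exact wordProd_mem_parabolic cs h2

lemma parabolic_univ : parabolic cs Set.univ = ⊤ := by
  rw [parabolic, Set.image_univ, cs.subgroup_closure_range_simple]

lemma isLeftDescent_upR {x : W} {i j : B} (h : cs.IsLeftDescent x i) :
    cs.IsLeftDescent (upR cs j x) i := by
  rw [← upL_eq_self_iff] at h ⊢
  rw [upL_upR_comm, h]

end Demazure

/-! ### Longest elements of parabolic cosets -/

section Longest

variable {B W : Type*} [Group W] [Finite W] {M : CoxeterMatrix B} (cs : CoxeterSystem M W)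

/-- Take a longest value at `1`. Prepending a letter is a left Demazure step on the value and
appending one is a right step, so by maximality neither can lengthen it. -/
lemma exists_longest_word (I : Set B) : ∃ ω : List B, (∀ i ∈ ω, i ∈ I) ∧
    ∀ i ∈ I, cs.IsLeftDescent (upLs cs ω 1) i ∧ cs.IsRightDescent (upLs cs ω 1) i := by
  let D : Set W := {x | ∃ ω : List B, (∀ i ∈ ω, i ∈ I) ∧ upLs cs ω 1 = x}
  obtain ⟨m, ⟨ω, hω, rfl⟩, hmax⟩ := Set.exists_max_image D cs.length (Set.toFinite D)
    ⟨1, [], by simp⟩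
  refine ⟨ω, hω, fun i hi => ⟨?_, ?_⟩⟩
  · by_contra h
    have := hmax (upLs cs (i :: ω) 1) ⟨i :: ω, by simpa [hi] using hω, rfl⟩
    rw [upLs_cons, upL_of_not_descent cs h, cs.not_isLeftDescent_iff.1 h] at this
    omega
  · by_contra h
    have := hmax (upLs cs (ω ++ [i]) 1)
      ⟨ω ++ [i], by simpa [or_imp, forall_and, hi] using hω, rfl⟩
    rw [upLs_append, upLs_cons, upLs_nil, upL_one, ← upR_one, upLs_upR_comm,
      upR_of_not_descent cs h, cs.not_isRightDescent_iff.1 h] at this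
    omega

/-- The longest element of the coset `W_I x`. -/
noncomputable def top (I : Set B) (x : W) : W := upLs cs (exists_longest_word cs I).choose x

lemma top_upL {I : Set B} {i : B} (hi : i ∈ I) (x : W) : top cs I (upL cs i x) = top cs I x := by
  have h := (exists_longest_word cs I).choose_spec.2 i hi
  have := upLs_congr cs (ω := (exists_longest_word cs I).choose ++ [i])
    (η := (exists_longest_word cs I).choose) ?_ x
  · rwa [upLs_append] at this
  · rw [upLs_append, upLs_cons, upLs_nil, upL_one, ← upR_one, upLs_upR_comm]
    exact upR_of_descent cs h.2

lemma upL_top {I : Set B} {i : B} (hi : i ∈ I) (x : W) : upL cs i (top cs I x) = top cs I x := by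
  have h := (exists_longest_word cs I).choose_spec.2 i hi
  exact upLs_congr cs (ω := i :: (exists_longest_word cs I).choose)
    (η := (exists_longest_word cs I).choose) (upL_of_descent cs h.1) x

lemma isLeftDescent_top {I : Set B} {i : B} (hi : i ∈ I) (x : W) :
    cs.IsLeftDescent (top cs I x) i := (upL_eq_self_iff cs).1 (upL_top cs hi x)

lemma top_upR (I : Set B) (j : B) (x : W) : top cs I (upR cs j x) = upR cs j (top cs I x) :=
  upLs_upR_comm cs _ j x

lemma top_simple_mul {I : Set B} {i : B} (hi : i ∈ I) (x : W) :
    top cs I (cs.simple i * x) = top cs I x := by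
  by_cases h : cs.IsLeftDescent x i
  · rw [← top_upL cs hi (cs.simple i * x), upL_of_not_descent cs,
      cs.simple_mul_simple_cancel_left]
    exact cs.isLeftDescent_iff_not_isLeftDescent_mul.1 h
  · rw [← upL_of_not_descent cs h, top_upL cs hi]

lemma top_mul_of_mem {I : Set B} {u : W} (hu : u ∈ parabolic cs I) (x : W) :
    top cs I (u * x) = top cs I x := by
  induction hu using Subgroup.closure_induction generalizing x with
  | mem u hu =>
    obtain ⟨i, hi, rfl⟩ := hu
    exact top_simple_mul cs hi x
  | one => rw [one_mul]
  | mul u v _ _ hu hv => rw [mul_assoc, hu, hv]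
  | inv u _ hu => rw [← hu, mul_inv_cancel_left]

lemma top_eq_self {I : Set B} {x : W} (h : ∀ i ∈ I, cs.IsLeftDescent x i) : top cs I x = x := by
  have : ∀ ω : List B, (∀ i ∈ ω, i ∈ I) → upLs cs ω x = x := by
    intro ω hω
    induction ω with
    | nil => rfl
    | cons i ω ih =>
      rw [upLs_cons, ih fun j hj => hω j (by simp [hj]), upL_of_descent cs (h i (hω i (by simp)))]
  exact this _ (exists_longest_word cs I).choose_spec.1

lemma top_top (I : Set B) (x : W) : top cs I (top cs I x) = top cs I x :=
  top_eq_self cs fun _ hi => isLeftDescent_top cs hi x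

lemma exists_top_eq_mul (I : Set B) (x : W) : ∃ η : List B, (∀ i ∈ η, i ∈ I) ∧
    top cs I x = cs.wordProd η * x ∧ cs.length (top cs I x) = η.length + cs.length x := by
  obtain ⟨η, h1, h2⟩ := exists_upLs_eq_wordProd_mul cs (exists_longest_word cs I).choose x
  exact ⟨η, fun i hi => (exists_longest_word cs I).choose_spec.1 i (h1 i hi), h2⟩

lemma exists_mem_top_eq_mul (I : Set B) (x : W) :
    ∃ u ∈ parabolic cs I, top cs I x = u * x := by
  obtain ⟨η, h1, h2, _⟩ := exists_top_eq_mul cs I x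
  exact ⟨_, wordProd_mem_parabolic cs h1, h2⟩

lemma length_le_length_top (I : Set B) (x : W) : cs.length x ≤ cs.length (top cs I x) :=
  length_le_length_upLs cs _ x

lemma top_eq_self_of_length_le {I : Set B} {x : W} (h : cs.length (top cs I x) ≤ cs.length x) :
    top cs I x = x := (upLs_eq_self_of_length_le cs h).1

lemma top_eq_top_iff {I : Set B} {x y : W} :
    top cs I x = top cs I y ↔ x * y⁻¹ ∈ parabolic cs I := by
  constructor
  · intro h
    obtain ⟨u, hu, hux⟩ := exists_mem_top_eq_mul cs I x
    obtain ⟨v, hv, hvy⟩ := exists_mem_top_eq_mul cs I y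
    have : x * y⁻¹ = u⁻¹ * v := by
      rw [mul_inv_eq_iff_eq_mul, mul_assoc, ← hvy, ← h, hux, inv_mul_cancel_left]
    rw [this]
    exact mul_mem (inv_mem hu) hv
  · intro h
    rw [← top_mul_of_mem cs h y, inv_mul_cancel_right]

/-- The longest element of `W`. -/
noncomputable def longest : W := top cs Set.univ 1

lemma top_univ (x : W) : top cs Set.univ x = longest cs :=
  (top_eq_top_iff cs).2 (by simp [parabolic_univ])

lemma isRightDescent_top_one {I : Set B} {i : B} (hi : i ∈ I) :
    cs.IsRightDescent (top cs I 1) i := ((exists_longest_word cs I).choose_spec.2 i hi).2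

lemma top_one_mem (I : Set B) : top cs I 1 ∈ parabolic cs I := by
  obtain ⟨u, hu, h⟩ := exists_mem_top_eq_mul cs I 1
  rwa [h, mul_one]

lemma top_one_inv (I : Set B) : (top cs I 1)⁻¹ = top cs I 1 := by
  have h : top cs I (top cs I 1)⁻¹ = (top cs I 1)⁻¹ :=
    top_eq_self cs fun i hi => by
      rw [cs.isLeftDescent_inv_iff]; exact isRightDescent_top_one cs hi
  rw [← h, top_eq_top_iff]
  simpa using top_one_mem cs I

lemma longest_inv : (longest cs)⁻¹ = longest cs := top_one_inv cs _

/-- The climb from `x⁻¹` to the longest element `w₀` has `ℓ(w₀) - ℓ(x)` steps, which bounds `ℓ(w₀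
x)` from above; subadditivity of length bounds it from below. -/
lemma length_longest_mul (x : W) :
    cs.length (longest cs * x) + cs.length x = cs.length (longest cs) := by
  obtain ⟨η, -, h1, h2⟩ := exists_top_eq_mul cs Set.univ x⁻¹
  rw [top_univ] at h1 h2
  rw [cs.length_inv] at h2
  have h3 : longest cs * x = cs.wordProd η := by rw [h1, inv_mul_cancel_right]
  have h4 := cs.length_wordProd_le η
  have h5 := cs.length_le_length_mul_add_right (longest cs) x
  rw [h3] at h5 ⊢
  omega

lemma length_mul_longest (x : W) :
    cs.length (x * longest cs) + cs.length x = cs.length (longest cs) := by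
  have := length_longest_mul cs x⁻¹
  rwa [← cs.length_inv, mul_inv_rev, inv_inv, longest_inv, cs.length_inv] at this

lemma isLeftDescent_mul_longest {x : W} {i : B} :
    cs.IsLeftDescent (x * longest cs) i ↔ ¬ cs.IsLeftDescent x i := by
  have h1 := length_mul_longest cs x
  have h2 := length_mul_longest cs (cs.simple i * x)
  have h3 := cs.length_simple_mul_ne x i
  rw [CoxeterSystem.IsLeftDescent, CoxeterSystem.IsLeftDescent, ← mul_assoc]
  omega

/-- Every coset `W_I x` has at most one element without left descents in `I`. -/
lemma eq_of_not_isLeftDescent {I : Set B} {x y : W} (hx : ∀ i ∈ I, ¬ cs.IsLeftDescent x i)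
    (hy : ∀ i ∈ I, ¬ cs.IsLeftDescent y i) (h : x * y⁻¹ ∈ parabolic cs I) : x = y := by
  -- Right multiplication by the longest element exchanges left descents and ascents, so both
  -- products are the longest element of one coset.
  have h' : top cs I (x * longest cs) = top cs I (y * longest cs) :=
    (top_eq_top_iff cs).2 (by simpa [mul_assoc] using h)
  rw [top_eq_self cs fun i hi => (isLeftDescent_mul_longest cs).2 (hx i hi),
    top_eq_self cs fun i hi => (isLeftDescent_mul_longest cs).2 (hy i hi)] at h'
  exact mul_right_cancel h'

/-- After right multiplication by the longest element, which reverses lengths, this is the fact that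
`top` strictly lengthens whatever it moves. -/
lemma eq_one_of_length_mul_le {I : Set B} {z u : W}
    (hz : ∀ i ∈ I, ¬ cs.IsLeftDescent z i) (hu : u ∈ parabolic cs I)
    (h : cs.length (u * z) ≤ cs.length z) : u = 1 := by
  have h1 := length_mul_longest cs z
  have h2 := length_mul_longest cs (u * z)
  have h3 : top cs I (u * z * longest cs) = z * longest cs := by
    rw [mul_assoc, top_mul_of_mem cs hu,
      top_eq_self cs fun i hi => (isLeftDescent_mul_longest cs).2 (hz i hi)]
  rw [top_eq_self_of_length_le cs (by rw [h3]; omega)] at h3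
  simpa using h3

/-- An element of `W_I` without left descent in `I` is `1`, by uniqueness of such an element in its
coset. Any other element is shortened by a letter of `I`, staying in `W_I`. -/
lemma exists_word_of_mem_parabolic {I : Set B} {x : W} (hx : x ∈ parabolic cs I) :
    ∃ ω : List B, (∀ i ∈ ω, i ∈ I) ∧ cs.IsReduced ω ∧ cs.wordProd ω = x := by
  induction hn : cs.length x generalizing x with
  | zero =>
    exact ⟨[], by simp, by simp [CoxeterSystem.IsReduced], by
      rw [cs.length_eq_zero_iff] at hn; simp [hn]⟩
  | succ n ih =>
    have : ∃ i ∈ I, cs.IsLeftDescent x i := by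
      by_contra! h
      have := eq_of_not_isLeftDescent cs h (fun i _ => cs.not_isLeftDescent_one i)
        (by simpa using hx)
      rw [this, cs.length_one] at hn
      omega
    obtain ⟨i, hi, hd⟩ := this
    rw [cs.isLeftDescent_iff] at hd
    obtain ⟨ω, h1, h2, h3⟩ := ih (mul_mem (simple_mem_parabolic cs hi) hx) (by omega)
    refine ⟨i :: ω, by simpa [hi] using h1, ?_, ?_⟩
    · rw [CoxeterSystem.IsReduced, cs.wordProd_cons, h3, cs.simple_mul_simple_cancel_left,
        List.length_cons, ← h2.eq, h3]; omega
    · rw [cs.wordProd_cons, h3, cs.simple_mul_simple_cancel_left]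

lemma simple_mem_parabolic_iff {I : Set B} {i : B} : cs.simple i ∈ parabolic cs I ↔ i ∈ I := by
  refine ⟨fun h => ?_, simple_mem_parabolic cs⟩
  obtain ⟨ω, h1, h2, h3⟩ := exists_word_of_mem_parabolic cs h
  have h4 := h2.eq
  rw [h3, cs.length_simple] at h4
  obtain ⟨j, rfl⟩ := List.length_eq_one_iff.1 h4.symm
  rw [cs.wordProd_singleton] at h3
  exact simple_injective cs h3 ▸ h1 j (by simp)

/-- A right descent `i` of the longest element of `W_I` is a Demazure step fixing it, so `s_i` has
the same `top` as `1` and lies in `W_I`; distinctness of the simple reflections then gives `i ∈ I`.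
-/
lemma isRightDescent_top_one_iff {I : Set B} {i : B} :
    cs.IsRightDescent (top cs I 1) i ↔ i ∈ I := by
  refine ⟨fun h => ?_, isRightDescent_top_one cs⟩
  have : top cs I (cs.simple i) = top cs I 1 := by
    rw [← upR_one, top_upR, upR_of_descent cs h]
  rw [top_eq_top_iff] at this
  simpa [simple_mem_parabolic_iff] using this

lemma isLeftDescent_top_one_iff {I : Set B} {i : B} :
    cs.IsLeftDescent (top cs I 1) i ↔ i ∈ I := by
  rw [← cs.isRightDescent_inv_iff, top_one_inv, isRightDescent_top_one_iff]

end Longest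

/-! ### The basis `v_w` and the spaces of antisymmetric vectors -/

section Vectors

open MonoidAlgebra (single)

/-! ### Linear extensions of self-maps of `W`. -/

section MapOp

variable (k : Type*) [CommRing k] {W : Type*}

/-- The linear extension to `kW` of a map `W → W`. -/
noncomputable def mapOp (f : W → W) : Module.End k (MonoidAlgebra k W) :=
  (MonoidAlgebra.basis W k).constr k fun w => single (f w) 1

@[simp] lemma mapOp_single (f : W → W) (w : W) :
    mapOp k f (single w 1) = single (f w) 1 := by
  rw [← MonoidAlgebra.basis_apply, mapOp, Module.Basis.constr_basis]

variable {k}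

lemma linearMap_ext_single {N : Type*} [AddCommGroup N] [Module k N]
    {f g : MonoidAlgebra k W →ₗ[k] N} (h : ∀ w, f (single w 1) = g (single w 1)) : f = g :=
  (MonoidAlgebra.basis W k).ext fun w => by simpa using h w

lemma eq_sum_single [Fintype W] (v : MonoidAlgebra k W) :
    v = ∑ w, v.coeff w • single w (1 : k) := by
  classical
  ext x
  simp

lemma mapOp_apply [Fintype W] (f : W → W) (v : MonoidAlgebra k W) :
    mapOp k f v = ∑ w, v.coeff w • single (f w) (1 : k) := by
  conv_lhs => rw [eq_sum_single v, map_sum]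
  simp only [map_smul, mapOp_single]

open Classical in
lemma coeff_mapOp [Fintype W] (f : W → W) (v : MonoidAlgebra k W) (y : W) :
    (mapOp k f v).coeff y = ∑ w, if f w = y then v.coeff w else 0 := by
  rw [mapOp_apply]
  simp [Finsupp.single_apply]

end MapOp

/-! ### Unitriangularity of the vectors `v_w`. -/

section Ring

variable {k : Type*} [CommRing k] {B W : Type*} [Group W] {M : CoxeterMatrix B}
  (cs : CoxeterSystem M W)

lemma piOp_eq_mapOp (i : B) : piOp k cs i = mapOp k (upR cs i) :=
  linearMap_ext_single fun w => by rw [piOp_single, mapOp_single]; rfl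

lemma isLeftAntisymmetric_iff {I : Set B} {v : MonoidAlgebra k W} :
    IsLeftAntisymmetric k cs I v ↔ ∀ i ∈ I, ∀ w, v.coeff (cs.simple i * w) = -v.coeff w := by
  refine forall₂_congr fun i _ => ⟨fun h w => ?_, fun h => ?_⟩
  · have := congrArg (fun x => x.coeff (cs.simple i * w)) h
    simp at this
    rw [this, neg_neg]
  · ext w
    simp [h]

lemma neg_one_pow_length_simple_mul (i : B) (w : W) :
    (-1 : k) ^ cs.length (cs.simple i * w) = -(-1) ^ cs.length w := by
  rcases cs.length_simple_mul w i with h | h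
  · rw [h, pow_succ]; ring
  · rw [← h, pow_succ]; ring

variable [Fintype W]

open Classical in
lemma coeff_altSum (I : Set B) (y : W) : (altSum k cs I).coeff y =
    if y ∈ parabolic cs I then (-1) ^ cs.length y else 0 := by
  simp [altSum, Finsupp.single_apply]

open Classical in
lemma coeff_symSum (I : Set B) (y : W) : (symSum k cs I).coeff y =
    if y ∈ parabolic cs I then 1 else 0 := by
  simp [symSum, Finsupp.single_apply]

open Classical in
lemma coeff_altSum_mul_single (I : Set B) (x y : W) :
    (altSum k cs I * single x 1).coeff y =
      if y * x⁻¹ ∈ parabolic cs I then (-1) ^ cs.length (y * x⁻¹) else 0 := by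
  rw [MonoidAlgebra.coeff_mul_single_apply, coeff_altSum, mul_one]

lemma isLeftAntisymmetric_altSum (I : Set B) : IsLeftAntisymmetric k cs I (altSum k cs I) := by
  classical
  rw [isLeftAntisymmetric_iff]
  intro i hi w
  rw [coeff_altSum, coeff_altSum, Subgroup.mul_mem_cancel_left _ (simple_mem_parabolic cs hi),
    neg_one_pow_length_simple_mul]
  split_ifs <;> simp

omit [Fintype W] in
lemma IsLeftAntisymmetric.mul {I : Set B} {v : MonoidAlgebra k W}
    (h : IsLeftAntisymmetric k cs I v) (x : MonoidAlgebra k W) :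
    IsLeftAntisymmetric k cs I (v * x) := fun i hi => by
  rw [← mul_assoc, h i hi, neg_mul]

omit [Fintype W] in
lemma IsLeftAntisymmetric.mono {I J : Set B} (hIJ : I ⊆ J) {v : MonoidAlgebra k W}
    (h : IsLeftAntisymmetric k cs J v) : IsLeftAntisymmetric k cs I v :=
  fun i hi => h i (hIJ hi)

lemma isLeftAntisymmetric_antisymVector (w : W) :
    IsLeftAntisymmetric k cs {i | ¬ cs.IsLeftDescent w i} (antisymVector k cs w) :=
  (isLeftAntisymmetric_altSum cs _).mul cs _

lemma coeff_antisymVector_self (w : W) : (antisymVector k cs w).coeff w = 1 := by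
  classical
  rw [antisymVector, coeff_altSum_mul_single]
  simp

/-- No generator of the parabolic subgroup defining `v_w` is a left descent of `w`, so `w` is the
unique shortest element of the coset supporting `v_w`. -/
lemma coeff_antisymVector_of_ne_zero {w y : W} (h : (antisymVector k cs w).coeff y ≠ 0) :
    y * w⁻¹ ∈ parabolic cs {i | ¬ cs.IsLeftDescent w i} ∧
      (y = w ∨ cs.length w < cs.length y) := by
  classical
  rw [antisymVector, coeff_altSum_mul_single] at h
  have hmem : y * w⁻¹ ∈ parabolic cs {i | ¬ cs.IsLeftDescent w i} := by
    by_contra h'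
    exact h (if_neg h')
  refine ⟨hmem, ?_⟩
  by_contra! hne
  refine hne.1 (mul_inv_eq_one.1 (eq_one_of_length_mul_le cs (fun i hi => hi) hmem ?_))
  rw [inv_mul_cancel_right]
  exact hne.2

/-- Each `v_{w'}` involves only `w'` and longer elements, so no other term reaches `w`. The case `c
w = 0` is allowed and is used below at an element shorter than the whole support of `c`. -/
lemma coeff_sum_antisymVector {c : W → k} {w : W}
    (h : ∀ w', c w' ≠ 0 → cs.length w ≤ cs.length w') :
    (∑ w', c w' • antisymVector k cs w').coeff w = c w := by
  simp only [MonoidAlgebra.coeff_sum, MonoidAlgebra.coeff_smul, Finsupp.coe_finsetSum,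
    Finset.sum_apply, Finsupp.smul_apply, smul_eq_mul]
  rw [Finset.sum_eq_single w, coeff_antisymVector_self, mul_one]
  · intro w' _ hne
    by_contra h0
    obtain ⟨h1, h2⟩ := ne_zero_and_ne_zero_of_mul h0
    rcases (coeff_antisymVector_of_ne_zero cs h2).2 with h3 | h3
    · exact hne h3.symm
    · exact absurd (h w' h1) (by omega)
  · simp

omit [Fintype W] in
lemma exists_minimal_length [Finite W] {p : W → Prop} (h : ∃ w, p w) :
    ∃ w, p w ∧ ∀ w', p w' → cs.length w ≤ cs.length w' :=
  Set.exists_min_image {w | p w} cs.length (Set.toFinite _) h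

end Ring

/-! ### The basis `v_w`, and antisymmetry in its coordinates. -/

section Field

variable {k : Type*} [Field k] {B W : Type*} [Group W] {M : CoxeterMatrix B}
  (cs : CoxeterSystem M W) [Fintype W]

lemma linearIndependent_antisymVector : LinearIndependent k (antisymVector k cs) := by
  rw [Fintype.linearIndependent_iff]
  intro c hc
  by_contra! h
  obtain ⟨w, hw, hmin⟩ := exists_minimal_length cs h
  have := coeff_sum_antisymVector cs hmin
  rw [hc] at this
  exact hw this.symm

variable (k)

/-- The basis `v_w` of `kW`. -/
noncomputable def antisymBasis : Module.Basis W k (MonoidAlgebra k W) :=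
  basisOfLinearIndependentOfCardEqFinrank (linearIndependent_antisymVector cs)
    (Module.finrank_eq_card_basis (MonoidAlgebra.basis W k)).symm

lemma antisymBasis_apply (w : W) : antisymBasis k cs w = antisymVector k cs w := by
  rw [antisymBasis, coe_basisOfLinearIndependentOfCardEqFinrank]

variable {k}

lemma sum_repr_antisymBasis (v : MonoidAlgebra k W) :
    ∑ w, (antisymBasis k cs).repr v w • antisymVector k cs w = v := by
  simp_rw [← antisymBasis_apply]
  exact (antisymBasis k cs).sum_repr v

omit [Fintype W] in
lemma isLeftAntisymmetric_sum {I : Set B} {ι : Type*} {s : Finset ι} {f : ι → MonoidAlgebra k W}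
    (h : ∀ j ∈ s, IsLeftAntisymmetric k cs I (f j)) :
    IsLeftAntisymmetric k cs I (∑ j ∈ s, f j) := by
  intro i hi
  rw [Finset.mul_sum, ← Finset.sum_neg_distrib]
  exact Finset.sum_congr rfl fun j hj => h j hj i hi

/-- Subtract from `v` the terms that are visibly antisymmetric. If `w` is shortest among the
remaining indices, it has a left descent `i ∈ I`, and antisymmetry puts a nonzero coefficient at the
shorter element `s_i w`. -/
lemma isLeftAntisymmetric_iff_repr {I : Set B} {v : MonoidAlgebra k W} :
    IsLeftAntisymmetric k cs I v ↔
      ∀ w, (antisymBasis k cs).repr v w ≠ 0 → ∀ i ∈ I, ¬ cs.IsLeftDescent w i := by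
  classical
  constructor
  · intro hv
    let p : W → Prop := fun w => ∀ i ∈ I, ¬ cs.IsLeftDescent w i
    let c : W → k := fun w => if p w then 0 else (antisymBasis k cs).repr v w
    have hgood : IsLeftAntisymmetric k cs I (∑ w, c w • antisymVector k cs w) := by
      have e : ∑ w, c w • antisymVector k cs w = v -
          ∑ w, (if p w then (antisymBasis k cs).repr v w else 0) • antisymVector k cs w := by
        conv_rhs => rw [← sum_repr_antisymBasis cs v]
        rw [← Finset.sum_sub_distrib]
        refine Finset.sum_congr rfl fun w _ => ?_
        simp only [c, sum_repr_antisymBasis]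
        split_ifs <;> simp
      have h2 : IsLeftAntisymmetric k cs I
          (∑ w, (if p w then (antisymBasis k cs).repr v w else 0) • antisymVector k cs w) := by
        refine isLeftAntisymmetric_sum cs fun w _ i hi => ?_
        by_cases hp : p w
        · rw [if_pos hp, mul_smul_comm,
            isLeftAntisymmetric_antisymVector cs w i (hp i hi), smul_neg]
        · rw [if_neg hp, zero_smul, mul_zero, neg_zero]
      intro i hi
      rw [e, mul_sub, hv i hi, h2 i hi, neg_sub_neg, neg_sub]
    have hc : ∀ w, c w = 0 := by
      by_contra! h
      obtain ⟨w, hw, hmin⟩ := exists_minimal_length cs h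
      have hp : ¬ p w := fun hp => hw (if_pos hp)
      simp only [p, not_forall, not_not] at hp
      obtain ⟨i, hi, hd⟩ := hp
      have h1 := coeff_sum_antisymVector cs hmin
      have h2 := coeff_sum_antisymVector cs (w := cs.simple i * w)
        (c := c) fun w' hw' => (le_of_lt hd).trans (hmin w' hw')
      rw [(isLeftAntisymmetric_iff cs).1 hgood i hi, h1] at h2
      have h3 : c (cs.simple i * w) ≠ 0 := by rw [← h2]; exact neg_ne_zero.2 hw
      exact absurd (hmin _ h3) (not_le.2 hd)
    intro w hw
    by_contra hp
    exact hw (by simpa [c, p, hp] using hc w)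
  · intro h
    rw [← sum_repr_antisymBasis cs v]
    refine isLeftAntisymmetric_sum cs fun w _ i hi => ?_
    by_cases hc : (antisymBasis k cs).repr v w = 0
    · rw [hc, zero_smul, mul_zero, neg_zero]
    · rw [mul_smul_comm, isLeftAntisymmetric_antisymVector cs w i (h w hc i hi), smul_neg]

/-- The multiplier collects the coefficients of `v` at the shortest coset representatives. The
difference vanishes there and is antisymmetric; a shortest element of its support would have a left
descent in `I`, leading to a shorter one. -/
lemma exists_altSum_mul_eq {I : Set B} {v : MonoidAlgebra k W}
    (hv : IsLeftAntisymmetric k cs I v) : ∃ x, v = altSum k cs I * x := by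
  classical
  let p : W → Prop := fun w => ∀ i ∈ I, ¬ cs.IsLeftDescent w i
  let x : MonoidAlgebra k W := ∑ w, (if p w then v.coeff w else 0) • single w 1
  refine ⟨x, ?_⟩
  have hx : IsLeftAntisymmetric k cs I (v - altSum k cs I * x) := fun i hi => by
    rw [mul_sub, hv i hi, (isLeftAntisymmetric_altSum cs I).mul cs x i hi, neg_sub_neg, neg_sub]
  rw [isLeftAntisymmetric_iff] at hx
  rw [← sub_eq_zero]
  have hmin : ∀ w, p w → (v - altSum k cs I * x).coeff w = 0 := by
    intro w hw
    have : (altSum k cs I * x).coeff w = v.coeff w := by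
      simp only [x, Finset.mul_sum, mul_smul_comm, MonoidAlgebra.coeff_sum,
        MonoidAlgebra.coeff_smul, Finsupp.coe_finsetSum, Finset.sum_apply, Finsupp.smul_apply,
        smul_eq_mul, coeff_altSum_mul_single]
      rw [Finset.sum_eq_single w]
      · simp [hw]
      · intro w' _ hne
        by_cases hp : p w'
        · rw [if_neg fun h => hne (eq_of_not_isLeftDescent cs hw hp h).symm, mul_zero]
        · rw [if_neg hp, zero_mul]
      · simp
    simp [this]
  ext w
  by_contra h
  obtain ⟨w, hw, hw'⟩ := exists_minimal_length cs
    (p := fun w => (v - altSum k cs I * x).coeff w ≠ 0) ⟨w, h⟩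
  have hp : ¬ p w := fun hp => hw (by simpa using hmin w hp)
  simp only [p, not_forall, not_not] at hp
  obtain ⟨i, hi, hd⟩ := hp
  refine absurd (hw' (cs.simple i * w) ?_) (not_le.2 hd)
  rw [hx i hi]
  exact neg_ne_zero.2 hw

/-! ### Symmetrisation -/

variable (k)

/-- The operator sending `x` to the longest element of `W_K x`. -/
noncomputable def topOp (K : Set B) : Module.End k (MonoidAlgebra k W) := mapOp k (top cs K)

variable {k}

lemma topOp_single (K : Set B) (w : W) :
    topOp k cs K (single w 1) = single (top cs K w) 1 := mapOp_single k _ w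

lemma topOp_simple_mul {K : Set B} {i : B} (hi : i ∈ K) (v : MonoidAlgebra k W) :
    topOp k cs K (single (cs.simple i) 1 * v) = topOp k cs K v := by
  have : topOp k cs K ∘ₗ LinearMap.mulLeft k (single (cs.simple i) 1) = topOp k cs K :=
    linearMap_ext_single fun w => by
      simp [MonoidAlgebra.single_mul_single, topOp_single, top_simple_mul cs hi]
  exact congrArg (fun f : Module.End k (MonoidAlgebra k W) => f v) this

omit [Fintype W] in
lemma sub_single_mul_mem {I : Set B} {u : W} (hu : u ∈ parabolic cs Iᶜ) (v : MonoidAlgebra k W) :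
    v - single u 1 * v ∈ leftSymRelations k cs I := by
  induction hu using Subgroup.closure_induction generalizing v with
  | mem u hu =>
    obtain ⟨i, hi, rfl⟩ := hu
    exact Submodule.subset_span ⟨i, hi, v, rfl⟩
  | one => simp [← MonoidAlgebra.one_def]
  | mul u u' _ _ hu hu' =>
    have := add_mem (hu' v) (hu (single u' 1 * v))
    rwa [← mul_assoc, MonoidAlgebra.single_mul_single, mul_one, sub_add_sub_cancel] at this
  | inv u _ hu =>
    have := neg_mem (hu (single u⁻¹ 1 * v))
    rwa [← mul_assoc, MonoidAlgebra.single_mul_single, mul_one, mul_inv_cancel,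
      ← MonoidAlgebra.one_def, one_mul, neg_sub] at this

lemma sub_topOp_mem (I : Set B) (v : MonoidAlgebra k W) :
    v - topOp k cs Iᶜ v ∈ leftSymRelations k cs I := by
  have h : ∀ w : W, single w (1 : k) - single (top cs Iᶜ w) 1 ∈ leftSymRelations k cs I := by
    intro w
    obtain ⟨u, hu, h⟩ := exists_mem_top_eq_mul cs Iᶜ w
    have := sub_single_mul_mem (k := k) cs hu (single w 1)
    rwa [MonoidAlgebra.single_mul_single, mul_one, ← h] at this
  have e : v - topOp k cs Iᶜ v =
      ∑ w, v.coeff w • (single w (1 : k) - single (top cs Iᶜ w) 1) := by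
    simp_rw [smul_sub]
    rw [Finset.sum_sub_distrib, ← eq_sum_single, topOp, mapOp_apply]
  rw [e]
  exact sum_mem fun w _ => Submodule.smul_mem _ _ (h w)

/-- `topOp` kills the relations and differs from the identity by relations. -/
lemma mem_leftSymRelations_iff {I : Set B} {v : MonoidAlgebra k W} :
    v ∈ leftSymRelations k cs I ↔ topOp k cs Iᶜ v = 0 := by
  constructor
  · intro h
    induction h using Submodule.span_induction with
    | mem x hx =>
      obtain ⟨i, hi, v, rfl⟩ := hx
      rw [map_sub, topOp_simple_mul cs hi, sub_self]
    | zero => simp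
    | add x y _ _ hx hy => rw [map_add, hx, hy, add_zero]
    | smul a x _ hx => rw [map_smul, hx, smul_zero]
  · intro h
    simpa [h] using sub_topOp_mem cs I v

lemma symSum_mul_single {K : Set B} {u : W} (hu : u ∈ parabolic cs K) :
    symSum k cs K * single u 1 = symSum k cs K := by
  classical
  ext y
  rw [MonoidAlgebra.coeff_mul_single_apply, coeff_symSum, coeff_symSum, mul_one,
    Subgroup.mul_mem_cancel_right _ (inv_mem hu)]

lemma symSum_mul_topOp (K : Set B) (v : MonoidAlgebra k W) :
    symSum k cs K * topOp k cs K v = symSum k cs K * v := by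
  have : LinearMap.mulLeft k (symSum k cs K) ∘ₗ topOp k cs K =
      LinearMap.mulLeft k (symSum k cs K) :=
    linearMap_ext_single fun w => by
      obtain ⟨u, hu, h⟩ := exists_mem_top_eq_mul cs K w
      rw [LinearMap.comp_apply, topOp_single, h, LinearMap.mulLeft_apply, LinearMap.mulLeft_apply,
        show single (u * w) (1 : k) = single u 1 * single w 1 by
          rw [MonoidAlgebra.single_mul_single, mul_one], ← mul_assoc, symSum_mul_single cs hu]
  exact congrArg (fun f : Module.End k (MonoidAlgebra k W) => f v) this

/-- At longest coset elements `symSum * topOp v` and `topOp v` have equal coefficients, and `topOp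
v` is supported there. The common kernel links a map commuting with right multiplications to one
commuting with the `π_i`. -/
lemma symSum_mul_eq_zero_iff {K : Set B} {v : MonoidAlgebra k W} :
    symSum k cs K * v = 0 ↔ topOp k cs K v = 0 := by
  classical
  refine ⟨fun h => ?_, fun h => by rw [← symSum_mul_topOp, h, mul_zero]⟩
  have hc : ∀ w, top cs K w = w → (symSum k cs K * topOp k cs K v).coeff w =
      (topOp k cs K v).coeff w := by
    intro w hw
    rw [topOp, mapOp_apply, Finset.mul_sum]
    simp only [mul_smul_comm, MonoidAlgebra.coeff_sum,
        MonoidAlgebra.coeff_smul, Finsupp.coe_finsetSum, Finset.sum_apply, Finsupp.smul_apply,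
        smul_eq_mul, MonoidAlgebra.coeff_mul_single_apply, coeff_symSum, mul_one,
        MonoidAlgebra.coeff_single, Finsupp.single_apply]
    refine Finset.sum_congr rfl fun x _ => ?_
    congr 1
    rw [← top_eq_top_iff, hw, top_top]
    simp only [eq_comm]
  rw [symSum_mul_topOp, h] at hc
  ext w
  by_cases hw : top cs K w = w
  · rw [← hc w hw]
  · rw [topOp, coeff_mapOp]
    exact Finset.sum_eq_zero fun x _ => if_neg fun hx => hw (by rw [← hx, top_top])

end Field

end Vectors

/-! ### The Hecke group algebra as a triangular algebra -/

section Triangular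

open MonoidAlgebra (single)

variable {k : Type*} {B W : Type*} [Group W] {M : CoxeterMatrix B} (cs : CoxeterSystem M W)

/-- The complement of the left descent set. -/
def ascents (w : W) : Set B := {i | ¬ cs.IsLeftDescent w i}

/-! ### Operators attached to words and to group elements. -/

section Ring

variable (k) [CommRing k]

/-- The composite of the operators `π_i` along a word. -/
noncomputable def piWord (ω : List B) : Module.End k (MonoidAlgebra k W) :=
  mapOp k (upRs cs ω)

lemma piWord_mem (ω : List B) : piWord k cs ω ∈ zeroHeckeAlgebra k cs := by
  induction ω with
  | nil =>
    have : piWord k cs [] = 1 := linearMap_ext_single fun w => by simp [piWord]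
    rw [this]; exact one_mem _
  | cons i ω ih =>
    have : piWord k cs (i :: ω) = piWord k cs ω * piOp k cs i :=
      linearMap_ext_single fun w => by simp [piWord, piOp_eq_mapOp]
    rw [this]
    exact mul_mem ih (Algebra.subset_adjoin ⟨i, rfl⟩)

lemma mulRight_mem (w : W) :
    LinearMap.mulRight k (single w (1 : k)) ∈ groupOperators k cs := by
  induction w using cs.simple_induction_left with
  | one =>
    rw [← MonoidAlgebra.one_def, LinearMap.mulRight_one]
    exact one_mem _
  | mul_simple_left w i ih =>
    have : LinearMap.mulRight k (single (cs.simple i * w) (1 : k)) =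
        LinearMap.mulRight k (single w (1 : k)) * sOp k cs i := by
      rw [sOp, Module.End.mul_eq_comp, ← LinearMap.mulRight_mul, MonoidAlgebra.single_mul_single,
        mul_one]
    rw [this]
    exact mul_mem ih (Algebra.subset_adjoin ⟨i, rfl⟩)

end Ring

variable [Field k] [Fintype W]

variable (k) in
/-- The operators `x ↦ (x w) · π_{w'}` where no right descent of `w` is a left descent of `w'`. -/
noncomputable def productFamily
    (p : {p : W × W // ∀ i, cs.IsRightDescent p.1 i → ¬ cs.IsLeftDescent p.2 i}) :
    Module.End k (MonoidAlgebra k W) :=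
  piWord k cs (redWord cs p.1.2) * LinearMap.mulRight k (single p.1.1 1)

omit [Fintype W] in
lemma productFamily_mem (p) : productFamily k cs p ∈ heckeGroupAlgebra k cs :=
  mul_mem (zeroHeckeAlgebra_le k cs (piWord_mem k cs _))
    (groupOperators_le k cs (mulRight_mem k cs _))

omit [Fintype W] in
lemma productFamily_single (p) (x : W) : productFamily k cs p (single x 1) =
    single (upRs cs (redWord cs p.1.2) (x * p.1.1)) 1 := by
  simp [productFamily, piWord, MonoidAlgebra.single_mul_single]

/-- In a relation take a term `(w, w')` with `w'` shortest, evaluate at `w⁻¹` and read the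
coefficient of `w'`. Another term contributing there has the same second entry, and its first entry
agrees with `w` because the inverses are shortest in the same coset of the parabolic subgroup of the
left descents of `w'`. -/
lemma linearIndependent_productFamily : LinearIndependent k (productFamily k cs) := by
  classical
  rw [Fintype.linearIndependent_iff]
  intro c hc
  by_contra! h
  obtain ⟨p, hp, hmin⟩ := Set.exists_min_image {p | c p ≠ 0} (fun p => cs.length p.1.2)
    (Set.toFinite _) h
  have h1 := congrArg (fun f : Module.End k (MonoidAlgebra k W) =>
    (f (single p.1.1⁻¹ 1)).coeff p.1.2) hc
  simp only [LinearMap.sum_apply, LinearMap.smul_apply, productFamily_single,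
    MonoidAlgebra.coeff_sum, MonoidAlgebra.coeff_smul, Finsupp.coe_finsetSum, Finset.sum_apply,
    Finsupp.smul_apply, smul_eq_mul, MonoidAlgebra.coeff_single] at h1
  rw [Finset.sum_eq_single p] at h1
  · rw [inv_mul_cancel, upRs_redWord_one, Finsupp.single_eq_same, mul_one] at h1
    exact hp (by simpa using h1)
  · intro q _ hne
    by_contra h0
    obtain ⟨h2, h3⟩ := ne_zero_and_ne_zero_of_mul h0
    have h4 : upRs cs (redWord cs q.1.2) (p.1.1⁻¹ * q.1.1) = p.1.2 := by
      by_contra h4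
      exact h3 (Finsupp.single_eq_of_ne (Ne.symm h4))
    obtain ⟨h5, h6⟩ := upRs_redWord_eq_of_length_le cs (by rw [h4]; exact hmin q h2)
    rw [h4] at h5
    have h7 := eq_of_not_isLeftDescent cs (x := p.1.1⁻¹) (y := q.1.1⁻¹)
      (I := {i | cs.IsLeftDescent q.1.2 i})
      (fun i hi h8 => p.2 i (cs.isLeftDescent_inv_iff.1 h8) (h5 ▸ hi))
      (fun i hi h8 => q.2 i (cs.isLeftDescent_inv_iff.1 h8) hi) (by simpa using h6)
    exact hne (Subtype.ext (Prod.ext (inv_injective h7).symm h5.symm))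
  · simp

variable (k) in
/-- The matrix unit `v_w ↦ v_{w'}`. -/
noncomputable def matrixUnit (w' w : W) : Module.End k (MonoidAlgebra k W) :=
  ((antisymBasis k cs).coord w).smulRight (antisymBasis k cs w')

lemma matrixUnit_apply (w' w : W) (v : MonoidAlgebra k W) :
    matrixUnit k cs w' w v = (antisymBasis k cs).repr v w • antisymVector k cs w' := by
  simp [matrixUnit, antisymBasis_apply]

lemma repr_antisymVector (w : W) :
    (antisymBasis k cs).repr (antisymVector k cs w) = Finsupp.single w 1 := by
  rw [← antisymBasis_apply, Module.Basis.repr_self]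

/-- Since `v_w` lies in `P_{asc(w)}`, so does its image, whose expansion only involves `v_{w'}` with
`asc(w) ⊆ asc(w')`. -/
lemma mem_span_matrixUnit {f : Module.End k (MonoidAlgebra k W)}
    (hf : ∀ I v, IsLeftAntisymmetric k cs I v → IsLeftAntisymmetric k cs I (f v)) :
    f ∈ Submodule.span k (Set.range fun p : {p : W × W // ascents cs p.1 ⊆ ascents cs p.2} =>
      matrixUnit k cs p.1.2 p.1.1) := by
  classical
  have e : f = ∑ w, ∑ w', (antisymBasis k cs).repr (f (antisymVector k cs w)) w' •
      matrixUnit k cs w' w := by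
    refine (antisymBasis k cs).ext fun x => ?_
    simp only [LinearMap.sum_apply, LinearMap.smul_apply, matrixUnit_apply, antisymBasis_apply,
      repr_antisymVector]
    rw [Finset.sum_eq_single x]
    · simp only [Finsupp.single_eq_same, one_smul]
      exact (sum_repr_antisymBasis cs _).symm
    · intro w _ hne
      simp [Finsupp.single_eq_of_ne hne]
    · simp
  rw [e]
  refine sum_mem fun w _ => sum_mem fun w' _ => ?_
  by_cases hc : (antisymBasis k cs).repr (f (antisymVector k cs w)) w' = 0
  · rw [hc, zero_smul]; exact zero_mem _
  · exact Submodule.smul_mem _ _ (Submodule.subset_span ⟨⟨(w, w'),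
      (isLeftAntisymmetric_iff_repr cs).1 (hf _ _ (isLeftAntisymmetric_antisymVector cs w))
        w' hc⟩, rfl⟩)

/-- The right descents of `(w w₀)⁻¹`, with `w₀` the longest element, are the left ascents of `w`. -/
lemma card_le_card : Nat.card {p : W × W // ascents cs p.1 ⊆ ascents cs p.2} ≤
    Nat.card {p : W × W // ∀ i, cs.IsRightDescent p.1 i → ¬ cs.IsLeftDescent p.2 i} := by
  refine Nat.card_le_card_of_injective (fun p => ⟨((p.1.1 * longest cs)⁻¹, p.1.2), fun i hi => ?_⟩)
    fun p q h => ?_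
  · rw [cs.isRightDescent_inv_iff, isLeftDescent_mul_longest] at hi
    exact p.2 hi
  · have h1 := congrArg (fun r => r.1.1) h
    have h2 := congrArg (fun r => r.1.2) h
    exact Subtype.ext (Prod.ext (mul_right_cancel (inv_injective h1)) h2)

/-- The span of the product family lies in `HW`, and `HW` in the span of the matrix units. The
dimension of the last is at most that of the first, so all three coincide. -/
lemma matrixUnit_mem {w w' : W} (h : ascents cs w ⊆ ascents cs w') :
    matrixUnit k cs w' w ∈ heckeGroupAlgebra k cs := by
  classical
  have h1 : Submodule.span k (Set.range (productFamily k cs)) ≤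
      Subalgebra.toSubmodule (heckeGroupAlgebra k cs) := by
    rw [Submodule.span_le]
    rintro _ ⟨p, rfl⟩
    exact productFamily_mem cs p
  have h2 : Submodule.span k (Set.range (productFamily k cs)) =
      Submodule.span k (Set.range fun p : {p : W × W // ascents cs p.1 ⊆ ascents cs p.2} =>
        matrixUnit k cs p.1.2 p.1.1) := by
    refine Submodule.eq_of_le_of_finrank_le (h1.trans fun f hf =>
      mem_span_matrixUnit cs fun I v hv => IsLeftAntisymmetric.apply cs hf hv) ?_
    rw [finrank_span_eq_card (linearIndependent_productFamily cs)]
    refine (finrank_range_le_card _).trans ?_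
    have := card_le_card cs
    rwa [Nat.card_eq_fintype_card, Nat.card_eq_fintype_card] at this
  apply h1
  rw [h2]
  exact Submodule.subset_span ⟨⟨(w, w'), h⟩, rfl⟩

lemma mem_heckeGroupAlgebra_iff {f : Module.End k (MonoidAlgebra k W)} :
    f ∈ heckeGroupAlgebra k cs ↔
      ∀ I v, IsLeftAntisymmetric k cs I v → IsLeftAntisymmetric k cs I (f v) := by
  refine ⟨fun hf I v hv => IsLeftAntisymmetric.apply cs hf hv, fun hf => ?_⟩
  have h : Submodule.span k (Set.range fun p : {p : W × W // ascents cs p.1 ⊆ ascents cs p.2} =>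
      matrixUnit k cs p.1.2 p.1.1) ≤ Subalgebra.toSubmodule (heckeGroupAlgebra k cs) := by
    rw [Submodule.span_le]
    rintro _ ⟨p, rfl⟩
    exact matrixUnit_mem cs p.2
  exact h (mem_span_matrixUnit cs hf)

lemma repr_apply_ne_zero {f : Module.End k (MonoidAlgebra k W)}
    (hf : f ∈ heckeGroupAlgebra k cs) {v : MonoidAlgebra k W} {w : W}
    (h : (antisymBasis k cs).repr (f v) w ≠ 0) :
    ∃ w', (antisymBasis k cs).repr v w' ≠ 0 ∧ ascents cs w' ⊆ ascents cs w := by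
  rw [← sum_repr_antisymBasis cs v, map_sum] at h
  simp only [map_smul, map_sum, Finsupp.coe_finsetSum, Finset.sum_apply, Finsupp.smul_apply,
    smul_eq_mul] at h
  obtain ⟨w', -, hw'⟩ := Finset.exists_ne_zero_of_sum_ne_zero h
  obtain ⟨h1, h2⟩ := ne_zero_and_ne_zero_of_mul hw'
  exact ⟨w', h1, (isLeftAntisymmetric_iff_repr cs).1
    (IsLeftAntisymmetric.apply cs hf (isLeftAntisymmetric_antisymVector cs w')) w h2⟩

lemma mem_antisymModule_iff {I : Set B} {v : MonoidAlgebra k W} :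
    v ∈ antisymModule k cs I ↔ ∀ w, (antisymBasis k cs).repr v w ≠ 0 → I ⊆ ascents cs w :=
  isLeftAntisymmetric_iff_repr cs

lemma mem_iSup_antisymModule_iff {I : Set B} {v : MonoidAlgebra k W} :
    v ∈ ⨆ J ∈ {J : Set B | I ⊂ J}, antisymModule k cs J ↔
      ∀ w, (antisymBasis k cs).repr v w ≠ 0 → I ⊂ ascents cs w := by
  constructor
  -- The support condition defines a submodule because operators of `HW` can only enlarge ascent
  -- sets.
  · let N : Submodule (OpAlg (heckeGroupAlgebra k cs)) (MonoidAlgebra k W) :=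
      { carrier := {v | ∀ w, (antisymBasis k cs).repr v w ≠ 0 → I ⊂ ascents cs w}
        zero_mem' := by simp
        add_mem' := by
          intro a b ha hb w hw
          by_cases h : (antisymBasis k cs).repr a w = 0
          · exact hb w fun h' => hw (by simp [h, h'])
          · exact ha w h
        smul_mem' := by
          intro f v hv w hw
          obtain ⟨w', h1, h2⟩ := repr_apply_ne_zero cs f.2 hw
          exact (hv w' h1).trans_subset h2 }
    have hN : ⨆ J ∈ {J : Set B | I ⊂ J}, antisymModule k cs J ≤ N :=
      iSup₂_le fun J hJ v hv w hw =>
        Set.ssubset_of_ssubset_of_subset hJ ((mem_antisymModule_iff cs).1 hv w hw)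
    exact fun h => hN h
  · intro h
    rw [← sum_repr_antisymBasis cs v]
    refine sum_mem fun w _ => ?_
    by_cases hc : (antisymBasis k cs).repr v w = 0
    · rw [hc, zero_smul]; exact zero_mem _
    · have := Submodule.mem_iSup_of_mem (p := fun J => ⨆ (_ : J ∈ {J : Set B | I ⊂ J}),
        antisymModule k cs J) (ascents cs w) (Submodule.mem_iSup_of_mem (h w hc)
          (isLeftAntisymmetric_antisymVector cs w))
      exact Submodule.smul_of_tower_mem _ _ this

omit [Fintype W] in
lemma ascents_eq_iff {I : Set B} {w : W} :
    ascents cs w = I ↔ ∀ i, cs.IsLeftDescent w i ↔ i ∈ Iᶜ := by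
  rw [Set.ext_iff]
  refine forall_congr' fun i => ?_
  simp only [ascents, Set.mem_ofPred_eq, Set.mem_compl_iff]
  tauto

lemma ascents_top_one (I : Set B) : ascents cs (top cs Iᶜ 1) = I :=
  (ascents_eq_iff cs).2 fun _ => isLeftDescent_top_one_iff cs

/-- `w` is longest in its coset under its own left descents, so `topOp` fixes it; the other terms of
`v_w` are longer already and are not shortened. Unitriangularity survives symmetrisation. -/
lemma coeff_topOp_antisymVector {w y : W}
    (h : (topOp k cs (ascents cs w)ᶜ (antisymVector k cs w)).coeff y ≠ 0) :
    y = w ∨ cs.length w < cs.length y := by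
  classical
  rw [topOp, coeff_mapOp] at h
  obtain ⟨x, -, hx⟩ := Finset.exists_ne_zero_of_sum_ne_zero h
  rw [ite_ne_right_iff] at hx
  have hw : top cs (ascents cs w)ᶜ w = w :=
    top_eq_self cs fun i hi => by simpa [ascents] using hi
  rcases (coeff_antisymVector_of_ne_zero cs hx.2).2 with h1 | h1
  · left; rw [← hx.1, h1, hw]
  · right; rw [← hx.1]; exact h1.trans_le (length_le_length_top cs _ _)

lemma coeff_topOp_antisymVector_self (w : W) :
    (topOp k cs (ascents cs w)ᶜ (antisymVector k cs w)).coeff w = 1 := by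
  classical
  have hw : top cs (ascents cs w)ᶜ w = w :=
    top_eq_self cs fun i hi => by simpa [ascents] using hi
  rw [topOp, coeff_mapOp, Finset.sum_eq_single w]
  · rw [if_pos hw, coeff_antisymVector_self]
  · intro x _ hne
    by_contra h
    rw [← ne_eq, ite_ne_right_iff] at h
    rcases (coeff_antisymVector_of_ne_zero cs h.2).2 with h1 | h1
    · exact hne h1
    · have := length_le_length_top cs (ascents cs w)ᶜ x
      rw [h.1] at this
      omega
  · simp

/-- The terms at `w` and `s_i w` cancel in pairs; dividing by two would fail in characteristic two.
-/
lemma mapOp_eq_zero {f : W → W} {i : B} (hf : ∀ w, f (cs.simple i * w) = f w)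
    {v : MonoidAlgebra k W} (hv : ∀ w, v.coeff (cs.simple i * w) = -v.coeff w) :
    mapOp k f v = 0 := by
  rw [mapOp_apply]
  refine Finset.sum_involution (fun w _ => cs.simple i * w) ?_ ?_ ?_ ?_
  · intro w _
    rw [hf, hv, neg_smul, add_neg_cancel]
  · intro w _ _ h
    exact cs.length_simple_mul_ne w i (congrArg cs.length h)
  · simp
  · simp

lemma topOp_eq_zero {I : Set B} {i : B} (hi : i ∈ Iᶜ) {v : MonoidAlgebra k W}
    (hv : IsLeftAntisymmetric k cs {i} v) : topOp k cs Iᶜ v = 0 :=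
  mapOp_eq_zero cs (top_simple_mul cs hi) ((isLeftAntisymmetric_iff cs).1 hv i rfl)

lemma topOp_eq_zero_of_mem_iSup {I : Set B} {v : MonoidAlgebra k W}
    (h : v ∈ ⨆ J ∈ {J : Set B | I ⊂ J}, antisymModule k cs J) : topOp k cs Iᶜ v = 0 := by
  rw [mem_iSup_antisymModule_iff] at h
  rw [← sum_repr_antisymBasis cs v, map_sum]
  refine Finset.sum_eq_zero fun w _ => ?_
  by_cases hc : (antisymBasis k cs).repr v w = 0
  · rw [hc, zero_smul, map_zero]
  · obtain ⟨i, h1, h2⟩ := Set.exists_of_ssubset (h w hc)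
    rw [map_smul, topOp_eq_zero cs h2 ((isLeftAntisymmetric_antisymVector cs w).mono cs
      (Set.singleton_subset_iff.2 h1)), smul_zero]

/-- An element of `P_I` whose symmetrisation has no coefficient at the elements with ascent set `I`
lies in `∑_{J ⊋ I} P_J`. -/
lemma mem_iSup_of_coeff_topOp {I : Set B} {v : MonoidAlgebra k W}
    (hv : v ∈ antisymModule k cs I)
    (h : ∀ w, ascents cs w = I → (topOp k cs Iᶜ v).coeff w = 0) :
    v ∈ ⨆ J ∈ {J : Set B | I ⊂ J}, antisymModule k cs J := by
  rw [mem_iSup_antisymModule_iff]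
  rw [mem_antisymModule_iff] at hv
  by_contra! hne
  obtain ⟨w, ⟨hw, hwI⟩, hmin⟩ := exists_minimal_length cs hne
  have heq : ascents cs w = I := by
    by_contra h'
    exact hwI (ssubset_of_subset_of_ne (hv w hw) (Ne.symm h'))
  -- Terms with ascent set larger than `I` are killed by symmetrisation; those with ascent set `I`
  -- are no shorter than `w`, so only `v_w` contributes.
  have key : (topOp k cs Iᶜ v).coeff w = (antisymBasis k cs).repr v w := by
    conv_lhs => rw [← sum_repr_antisymBasis cs v, map_sum]
    simp only [map_smul, MonoidAlgebra.coeff_sum, MonoidAlgebra.coeff_smul, Finsupp.coe_finsetSum,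
      Finset.sum_apply, Finsupp.smul_apply, smul_eq_mul]
    rw [Finset.sum_eq_single w]
    · rw [← heq, coeff_topOp_antisymVector_self, mul_one]
    · intro w' _ hne'
      by_contra h0
      obtain ⟨h1, h2⟩ := ne_zero_and_ne_zero_of_mul h0
      by_cases hs : I ⊂ ascents cs w'
      · refine h2 ?_
        obtain ⟨i, hi1, hi2⟩ := Set.exists_of_ssubset hs
        rw [topOp_eq_zero cs hi2 ((isLeftAntisymmetric_antisymVector cs w').mono cs
          (Set.singleton_subset_iff.2 hi1))]
        rfl
      · have hle := hmin w' ⟨h1, hs⟩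
        have heq' : ascents cs w' = I := by
          by_contra h'
          exact hs (ssubset_of_subset_of_ne (hv w' h1) (Ne.symm h'))
        rw [← heq'] at h2
        rcases coeff_topOp_antisymVector cs h2 with h3 | h3
        · exact hne' h3.symm
        · omega
    · simp
  exact hw (by rw [← key, h w heq])

end Triangular

/-! ### Projective covers -/

section Projective

universe u

lemma isIndecomposable_of_local {R X : Type*} [Ring R] [AddCommGroup X] [Module R X]
    {N : Submodule R X} (hN : N ≠ ⊤) (h : ∀ L : Submodule R X, L ≠ ⊤ → L ≤ N) :
    IsIndecomposable R X := by
  refine ⟨?_, fun L L' hL => ?_⟩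
  · by_contra hX
    rw [not_nontrivial_iff_subsingleton] at hX
    exact hN (Subsingleton.elim _ _)
  · by_contra! hne
    have h1 : L ≠ ⊤ := fun h' => hne.2 (by simpa [h'] using hL.inf_eq_bot)
    have h2 : L' ≠ ⊤ := fun h' => hne.1 (by simpa [h'] using hL.inf_eq_bot)
    exact hN (top_le_iff.1 (hL.sup_eq_top ▸ sup_le (h L h1) (h L' h2)))

/-- A nonzero projective module over a Noetherian ring has a simple quotient. -/
lemma exists_simple_quotient_of_projective {R : Type u} [Ring R] [IsNoetherianRing R]
    (X : Type*) [AddCommGroup X] [Module R X] [Module.Projective R X] [Nontrivial X] :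
    ∃ (T : Type u) (_ : AddCommGroup T) (_ : Module R T) (p : X →ₗ[R] T),
      IsSimpleModule R T ∧ Function.Surjective p := by
  obtain ⟨s, hs⟩ := Module.projective_def.1 (inferInstance : Module.Projective R X)
  obtain ⟨x, hx⟩ := exists_ne (0 : X)
  have hsx : s x ≠ 0 := fun h => hx (by rw [← hs x, h, map_zero])
  obtain ⟨y, hy⟩ := Finsupp.ne_iff.1 hsx
  -- A nonzero coordinate of the embedding into a free module has as image a nonzero left ideal,
  -- which is finitely generated and so has a maximal submodule. The quotient lives in the universe
  -- of `R`, whatever that of `X`.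
  let g : X →ₗ[R] R := Finsupp.lapply y ∘ₗ s
  have : Nontrivial (LinearMap.range g) :=
    ⟨⟨⟨g x, x, rfl⟩, 0, fun h => hy (congrArg Subtype.val h)⟩⟩
  obtain h | ⟨L, hL, -⟩ := eq_top_or_exists_le_coatom (⊥ : Submodule R (LinearMap.range g))
  · exact absurd h bot_ne_top
  · exact ⟨LinearMap.range g ⧸ L, inferInstance, inferInstance, L.mkQ ∘ₗ g.rangeRestrict,
      isSimpleModule_iff_isCoatom.2 hL, L.mkQ_surjective.comp g.surjective_rangeRestrict⟩

/-- Projective modules with a largest proper submodule that map nontrivially to all the simple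
modules exhaust the indecomposable projectives. -/
theorem areTheIndecomposableProjectives_of_local {R : Type u} [Ring R] [IsNoetherianRing R]
    {ι : Type*} (P : ι → Type*) [∀ i, AddCommGroup (P i)] [∀ i, Module R (P i)]
    (hproj : ∀ i, Module.Projective R (P i)) (N : ∀ i, Submodule R (P i)) (hN : ∀ i, N i ≠ ⊤)
    (hloc : ∀ i (L : Submodule R (P i)), L ≠ ⊤ → L ≤ N i)
    (hiso : ∀ i j, Nonempty (P i ≃ₗ[R] P j) → i = j)
    (hsimple : ∀ (T : Type u) [AddCommGroup T] [Module R T], IsSimpleModule R T →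
      ∃ i, ∃ f : P i →ₗ[R] T, f ≠ 0) :
    AreTheIndecomposableProjectives.{v} R P := by
  refine ⟨fun i => ⟨hproj i, isIndecomposable_of_local (hN i) (hloc i)⟩, hiso,
    fun X _ _ hX hXi => ?_⟩
  have := hXi.1
  obtain ⟨T, _, _, p, hT, hp⟩ := exists_simple_quotient_of_projective (R := R) X
  obtain ⟨i, f, hf⟩ := hsimple T hT
  have hfs : Function.Surjective f := LinearMap.surjective_of_ne_zero hf
  have hker : LinearMap.ker f ≤ N i := hloc i _ fun h => hf (LinearMap.ker_eq_top.1 h)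
  obtain ⟨g, hg⟩ := Module.projective_lifting_property f p hfs
  -- `P i` is the sum of `ker f` and the range of `g`; the first lies in `N i`, so the second
  -- cannot.
  have hgs : LinearMap.range g = ⊤ := by
    by_contra h
    have h1 := hloc i _ h
    refine hN i (top_le_iff.1 fun x _ => ?_)
    obtain ⟨y, hy⟩ := hp (f x)
    have : x - g y ∈ N i := hker (by
      rw [LinearMap.mem_ker, map_sub, sub_eq_zero, ← hy, ← hg]; rfl)
    simpa using add_mem this (h1 ⟨y, rfl⟩)
  rw [LinearMap.range_eq_top] at hgs
  have := hproj i
  obtain ⟨s, hs⟩ := Module.projective_lifting_property g LinearMap.id hgs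
  have hsg : ∀ x, g (s x) = x := fun x => congrArg (fun f : P i →ₗ[R] P i => f x) hs
  -- `g` splits because `P i` is projective. Indecomposability of `X` leaves `ker g = 0`, the other
  -- option forcing `P i = 0`.
  have hc : IsCompl (LinearMap.ker g) (LinearMap.range s) := by
    constructor
    · rw [Submodule.disjoint_def]
      rintro _ h ⟨y, rfl⟩
      rw [LinearMap.mem_ker, hsg] at h
      rw [h, map_zero]
    · rw [codisjoint_iff, eq_top_iff]
      intro x _
      rw [← sub_add_cancel x (s (g x))]
      refine Submodule.add_mem_sup ?_ ⟨_, rfl⟩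
      rw [LinearMap.mem_ker, map_sub, hsg, sub_self]
  rcases hXi.2 _ _ hc with h | h
  · exact ⟨i, ⟨LinearEquiv.ofBijective g ⟨LinearMap.ker_eq_bot.1 h, hgs⟩⟩⟩
  · refine absurd (top_le_iff.1 fun x _ => ?_) (hN i)
    have : s x = 0 := by
      have : s x ∈ LinearMap.range s := ⟨x, rfl⟩
      rwa [h] at this
    rw [← hsg x, this, map_zero]
    exact zero_mem _

/-- Simple quotients of modules with a largest proper submodule. -/
theorem areTheSimpleModules_of_local {R : Type*} [Ring R]
    {ι : Type*} (P : ι → Type*) [∀ i, AddCommGroup (P i)] [∀ i, Module R (P i)]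
    (N : ∀ i, Submodule R (P i)) (hN : ∀ i, N i ≠ ⊤)
    (hloc : ∀ i (L : Submodule R (P i)), L ≠ ⊤ → L ≤ N i)
    (hiso : ∀ i j, Nonempty ((P i ⧸ N i) ≃ₗ[R] (P j ⧸ N j)) → i = j)
    (hsimple : ∀ (T : Type v) [AddCommGroup T] [Module R T], IsSimpleModule R T →
      ∃ i, ∃ f : P i →ₗ[R] T, f ≠ 0) :
    AreTheSimpleModules.{v} R (fun i => P i ⧸ N i) := by
  have hco : ∀ i, IsCoatom (N i) := fun i => ⟨hN i, fun L hL => by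
    by_contra h
    exact absurd (hloc i L h) (not_le_of_gt hL)⟩
  refine ⟨fun i => isSimpleModule_iff_isCoatom.2 (hco i), hiso, fun T _ _ hT => ?_⟩
  obtain ⟨i, f, hf⟩ := hsimple T hT
  have hfs : Function.Surjective f := LinearMap.surjective_of_ne_zero hf
  -- The kernel is maximal because `T` is simple, and it is contained in the proper submodule `N i`.
  have hker : LinearMap.ker f = N i := by
    have h1 : LinearMap.ker f ≠ ⊤ := fun h => hf (LinearMap.ker_eq_top.1 h)
    by_contra h2
    have h3 := isSimpleModule_iff_isCoatom.1
      (IsSimpleModule.congr (f.quotKerEquivOfSurjective hfs))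
    exact h2 (h3.le_iff_eq (hN i) |>.1 (hloc i _ h1)).symm
  exact ⟨i, ⟨((Submodule.quotEquivOfEq _ _ hker).symm.trans
    (f.quotKerEquivOfSurjective hfs)).symm⟩⟩

end Projective

/-! ### Modules over the Hecke group algebra -/

section HeckeModules

variable {k : Type*} {B W : Type*} [Group W] {M : CoxeterMatrix B} (cs : CoxeterSystem M W)
  [Field k] [Fintype W]

omit [Group W] [Fintype W] in
lemma OpAlg.smul_def {A : Subalgebra k (Module.End k (MonoidAlgebra k W))} (f : OpAlg A)
    (v : MonoidAlgebra k W) : f • v = f.toEnd v := rfl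

instance (A : Subalgebra k (Module.End k (MonoidAlgebra k W))) : Module.Finite k (OpAlg A) :=
  inferInstanceAs (Module.Finite k A)

instance (A : Subalgebra k (Module.End k (MonoidAlgebra k W))) : IsNoetherianRing (OpAlg A) :=
  isNoetherian_of_tower k inferInstance

instance (A : Subalgebra k (Module.End k (MonoidAlgebra k W))) :
    IsNoetherian (OpAlg A) (MonoidAlgebra k W) :=
  isNoetherian_of_tower k inferInstance

lemma rankOne_mem {w : W} {x : MonoidAlgebra k W} (hx : x ∈ antisymModule k cs (ascents cs w)) :
    ((antisymBasis k cs).coord w).smulRight x ∈ heckeGroupAlgebra k cs := by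
  rw [mem_heckeGroupAlgebra_iff]
  intro I v hv i hi
  rw [LinearMap.smulRight_apply, mul_smul_comm]
  by_cases hc : (antisymBasis k cs).repr v w = 0
  · rw [Module.Basis.coord_apply, hc, zero_smul, zero_smul, neg_zero]
  · rw [hx i ((isLeftAntisymmetric_iff_repr cs).1 hv w hc i hi), smul_neg]

/-- The operator `v_w ↦ x`, killing the other basis vectors, for `x` in `P_I`, where `I` is the
ascent set of `w`; this depends `HW`-linearly on `x`. -/
noncomputable def rankOne (w : W) : antisymModule k cs (ascents cs w)
    →ₗ[OpAlg (heckeGroupAlgebra k cs)] OpAlg (heckeGroupAlgebra k cs) where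
  toFun x := ⟨_, rankOne_mem cs x.2⟩
  map_add' x y := Subtype.ext (LinearMap.ext fun v => smul_add _ _ _)
  map_smul' f x := Subtype.ext (LinearMap.ext fun v => by
    exact (map_smul f.toEnd ((antisymBasis k cs).repr v w) x.1).symm)

lemma rankOne_smul (w : W) (x : antisymModule k cs (ascents cs w)) (v : MonoidAlgebra k W) :
    rankOne cs w x • v = (antisymBasis k cs).repr v w • (x : MonoidAlgebra k W) := rfl

variable (k) in
/-- `v_w`, as an element of `P_I`, where `I` is the ascent set of `w`. -/
noncomputable def antisymGen (w : W) : antisymModule k cs (ascents cs w) :=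
  ⟨antisymVector k cs w, isLeftAntisymmetric_antisymVector cs w⟩

lemma coe_antisymGen (w : W) :
    (antisymGen k cs w : MonoidAlgebra k W) = antisymVector k cs w := rfl

variable (k) in
/-- The diagonal matrix unit `e_{w,w}`. -/
noncomputable def diagUnit (w : W) : OpAlg (heckeGroupAlgebra k cs) :=
  rankOne cs w (antisymGen k cs w)

lemma diagUnit_smul (w : W) (v : MonoidAlgebra k W) :
    diagUnit k cs w • v = (antisymBasis k cs).repr v w • antisymVector k cs w := rfl

omit [Group W] [Fintype W] in
lemma OpAlg.ext {A : Subalgebra k (Module.End k (MonoidAlgebra k W))} {f g : OpAlg A}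
    (h : ∀ v : MonoidAlgebra k W, f • v = g • v) : f = g :=
  Subtype.ext (LinearMap.ext h)

lemma toEnd_diagUnit (w : W) : (diagUnit k cs w).toEnd =
    ((antisymBasis k cs).coord w).smulRight (antisymBasis k cs w) :=
  LinearMap.ext fun v => by
    rw [← OpAlg.smul_def, diagUnit_smul, LinearMap.smulRight_apply, antisymBasis_apply]; rfl

lemma completeOrthogonalIdempotents_diagUnit :
    CompleteOrthogonalIdempotents (diagUnit k cs) where
  idem w := OpAlg.ext fun v => by
    simp only [mul_smul, diagUnit_smul, map_smul, repr_antisymVector]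
    simp
  ortho w w' hne := OpAlg.ext fun v => by
    simp only [mul_smul, diagUnit_smul, map_smul, repr_antisymVector]
    simp [Finsupp.single_eq_of_ne hne]
  complete := OpAlg.ext fun v => by
    simp only [Finset.sum_smul, diagUnit_smul, one_smul, sum_repr_antisymBasis]

/-- If `e_{w,w} = f + g` orthogonally, then `f` and `g` lie in the corner at `e_{w,w}`, which
consists of its scalar multiples; two such multiples with product zero cannot both be nonzero. -/
lemma isPrimitiveIdempotent_diagUnit (w : W) : IsPrimitiveIdempotent (diagUnit k cs w) := by
  refine ⟨(completeOrthogonalIdempotents_diagUnit cs).idem w, fun h => ?_,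
    fun f g hf hg hfg hgf h => ?_⟩
  · have := congrArg (fun f => (antisymBasis k cs).repr
      (f • antisymVector k cs w : MonoidAlgebra k W) w) h
    simp [diagUnit_smul, repr_antisymVector] at this
  · have key : ∀ f' g' : OpAlg (heckeGroupAlgebra k cs), IsIdempotentElem f' → f' * g' = 0 →
        g' * f' = 0 → diagUnit k cs w = f' + g' →
        f' = (antisymBasis k cs).repr (f' • antisymVector k cs w) w • diagUnit k cs w := by
      intro f g hf hfg hgf h
      have h1 : diagUnit k cs w * f * diagUnit k cs w = f := by
        rw [h, add_mul, hf.eq, hgf, add_zero, mul_add, hf.eq, hfg, add_zero]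
      conv_lhs => rw [← h1]
      refine OpAlg.ext fun v => ?_
      rw [mul_smul, mul_smul, diagUnit_smul, smul_assoc, diagUnit_smul,
        smul_algebra_smul_comm, map_smul, Finsupp.smul_apply, smul_eq_mul,
        smul_smul, mul_comm]
    have e1 := key f g hf hfg hgf h
    have e2 := key g f hg hgf hfg (h.trans (add_comm _ _))
    set a := (antisymBasis k cs).repr (f • antisymVector k cs w) w
    set b := (antisymBasis k cs).repr (g • antisymVector k cs w) w
    have e3 : (a * b) • diagUnit k cs w = 0 := by
      rw [← hfg, e1, e2, smul_mul_smul_comm, ((completeOrthogonalIdempotents_diagUnit cs).idem w).eq]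
    rcases smul_eq_zero.1 e3 with h0 | h0
    · rcases mul_eq_zero.1 h0 with h0 | h0
      · left; rw [e1, h0, zero_smul]
      · right; rw [e2, h0, zero_smul]
    · left; rw [e1, h0, smul_zero]

/-- `rankOne` maps the module into the regular module, and evaluation at `v_w` is a retraction. -/
lemma projective_antisymModule (w : W) : Module.Projective (OpAlg (heckeGroupAlgebra k cs))
    (antisymModule k cs (ascents cs w)) := by
  refine Module.Projective.of_split (rankOne cs w)
    (LinearMap.toSpanSingleton _ _ (antisymGen k cs w)) (LinearMap.ext fun x => Subtype.ext ?_)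
  change rankOne cs w x • antisymVector k cs w = x
  rw [rankOne_smul, repr_antisymVector, Finsupp.single_eq_same, one_smul]

variable (k) in
/-- The largest proper submodule `∑_{J ⊋ I} P_J` of `P_I`. -/
noncomputable abbrev antisymRadical (I : Set B) :
    Submodule (OpAlg (heckeGroupAlgebra k cs)) (antisymModule k cs I) :=
  (⨆ J ∈ {J : Set B | I ⊂ J}, antisymModule k cs J).submoduleOf (antisymModule k cs I)

lemma mem_antisymRadical_iff {I : Set B} {x : antisymModule k cs I} :
    x ∈ antisymRadical k cs I ↔
      ∀ w, (antisymBasis k cs).repr (x : MonoidAlgebra k W) w ≠ 0 → I ⊂ ascents cs w :=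
  mem_iSup_antisymModule_iff cs

lemma antisymGen_notMem (w : W) : antisymGen k cs w ∉ antisymRadical k cs (ascents cs w) := by
  intro h
  rw [mem_antisymRadical_iff] at h
  exact (h w (by simp [coe_antisymGen, repr_antisymVector])).ne rfl

lemma antisymRadical_ne_top (w : W) : antisymRadical k cs (ascents cs w) ≠ ⊤ :=
  fun h => antisymGen_notMem (k := k) cs w (h ▸ Submodule.mem_top)

/-- An element of `P_I` outside `∑_{J ⊋ I} P_J` has a nonzero coordinate at some `v_w` with `asc(w)
= I`, and an operator `v_w ↦ y`, suitably scaled, carries it to any prescribed element of `P_I`. -/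
lemma le_antisymRadical {I : Set B}
    {L : Submodule (OpAlg (heckeGroupAlgebra k cs)) (antisymModule k cs I)} (hL : L ≠ ⊤) :
    L ≤ antisymRadical k cs I := by
  intro x hx
  rw [mem_antisymRadical_iff]
  by_contra! h
  obtain ⟨w, hw, hwI⟩ := h
  have hI : I = ascents cs w := by
    by_contra h'
    exact hwI (ssubset_of_subset_of_ne ((mem_antisymModule_iff cs).1 x.2 w hw) h')
  subst hI
  refine hL (top_le_iff.1 fun y _ => ?_)
  have : y = rankOne cs w (((antisymBasis k cs).repr x w)⁻¹ • y) • x := by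
    apply Subtype.ext
    rw [Submodule.coe_smul, rankOne_smul, Submodule.coe_smul_of_tower, smul_smul,
      mul_inv_cancel₀ hw, one_smul]
  rw [this]
  exact L.smul_mem _ hx

/-- The image of `v_w` is fixed by `e_{w,w}`, hence is a nonzero multiple of `v_w` lying in `P_J`.
-/
lemma subset_of_linearMap {w : W} {J : Set B}
    (h : antisymModule k cs (ascents cs w) →ₗ[OpAlg (heckeGroupAlgebra k cs)]
      antisymModule k cs J) (h0 : h (antisymGen k cs w) ≠ 0) : J ⊆ ascents cs w := by
  have e : diagUnit k cs w • antisymGen k cs w = antisymGen k cs w := Subtype.ext (by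
    rw [Submodule.coe_smul, diagUnit_smul, coe_antisymGen, repr_antisymVector,
      Finsupp.single_eq_same, one_smul])
  have e' := congrArg h e
  rw [map_smul] at e'
  refine (mem_antisymModule_iff cs).1 (h (antisymGen k cs w)).2 w fun hc => h0 ?_
  rw [← e']
  apply Subtype.ext
  rw [Submodule.coe_smul, diagUnit_smul, hc, zero_smul]
  rfl

/-- The image of the class of `v_w` is represented by a multiple of `v_w` in `P_J`, whose class
vanishes as soon as `J` is strictly smaller than `asc(w)`. -/
lemma eq_of_linearMap_simpleQuotient {w : W} {J : Set B}
    (h : simpleQuotient k cs (ascents cs w) →ₗ[OpAlg (heckeGroupAlgebra k cs)]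
      simpleQuotient k cs J)
    (h0 : h (Submodule.Quotient.mk (antisymGen k cs w)) ≠ 0) : J = ascents cs w := by
  have e : diagUnit k cs w • antisymGen k cs w = antisymGen k cs w := Subtype.ext (by
    rw [Submodule.coe_smul, diagUnit_smul, coe_antisymGen, repr_antisymVector,
      Finsupp.single_eq_same, one_smul])
  have e' := congrArg (fun x => h (Submodule.Quotient.mk x)) e
  simp only [Submodule.Quotient.mk_smul, map_smul] at e'
  obtain ⟨x, hx⟩ := Submodule.Quotient.mk_surjective _
    (h (Submodule.Quotient.mk (antisymGen k cs w)))
  rw [← hx] at h0 e'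
  rw [← Submodule.Quotient.mk_smul] at e'
  rw [← e', ne_eq, Submodule.Quotient.mk_eq_zero] at h0
  by_contra hJ
  refine h0 ((mem_antisymRadical_iff cs).2 fun w' hw' => ?_)
  rw [Submodule.coe_smul, diagUnit_smul, map_smul, repr_antisymVector, Finsupp.smul_apply,
    smul_eq_mul] at hw'
  obtain ⟨h1, h2⟩ := ne_zero_and_ne_zero_of_mul hw'
  have : w' = w := by
    by_contra hne
    exact h2 (Finsupp.single_eq_of_ne hne)
  rw [this]
  exact ssubset_of_subset_of_ne ((mem_antisymModule_iff cs).1 x.2 w h1) hJ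

/-- Some `e_{w,w}` does not kill a given nonzero `t`; applying the operators `v_w ↦ x` to `t` is
then a nonzero map from `P_{asc(w)}`. -/
lemma exists_linearMap_ne_zero (T : Type*) [AddCommGroup T]
    [Module (OpAlg (heckeGroupAlgebra k cs)) T]
    [IsSimpleModule (OpAlg (heckeGroupAlgebra k cs)) T] :
    ∃ I, ∃ f : antisymModule k cs I →ₗ[OpAlg (heckeGroupAlgebra k cs)] T, f ≠ 0 := by
  have := IsSimpleModule.nontrivial (OpAlg (heckeGroupAlgebra k cs)) T
  obtain ⟨t, ht⟩ := exists_ne (0 : T)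
  rw [← one_smul (OpAlg (heckeGroupAlgebra k cs)) t,
    ← (completeOrthogonalIdempotents_diagUnit cs).complete, Finset.sum_smul] at ht
  obtain ⟨w, -, hw⟩ := Finset.exists_ne_zero_of_sum_ne_zero ht
  refine ⟨_, LinearMap.toSpanSingleton _ _ t ∘ₗ rankOne cs w, fun h => hw ?_⟩
  exact congrArg (fun f => f (antisymGen k cs w)) h

variable (k) in
theorem areTheIndecomposableProjectives_antisymModule :
    AreTheIndecomposableProjectives.{v} (OpAlg (heckeGroupAlgebra k cs))
      (fun I : Set B => antisymModule k cs I) := by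
  have hw : ∀ I : Set B, ∃ w : W, ascents cs w = I := fun I => ⟨_, ascents_top_one cs I⟩
  refine areTheIndecomposableProjectives_of_local _ (fun I => ?_) (antisymRadical k cs)
    (fun I => ?_) (fun I L hL => le_antisymRadical cs hL) ?_
    (fun T _ _ _ => exists_linearMap_ne_zero cs T)
  · obtain ⟨w, rfl⟩ := hw I
    exact projective_antisymModule cs w
  · obtain ⟨w, rfl⟩ := hw I
    exact antisymRadical_ne_top cs w
  · have key : ∀ I J : Set B, Nonempty (antisymModule k cs I
        ≃ₗ[OpAlg (heckeGroupAlgebra k cs)] antisymModule k cs J) → J ⊆ I := by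
      rintro I J ⟨h⟩
      obtain ⟨w, rfl⟩ := hw I
      refine subset_of_linearMap cs h.toLinearMap fun h0 => antisymGen_notMem (k := k) cs w ?_
      rw [h.map_eq_zero_iff.1 h0]
      exact zero_mem _
    exact fun I J h => (key J I ⟨h.some.symm⟩).antisymm (key I J h)

variable (k) in
theorem areTheSimpleModules_simpleQuotient :
    AreTheSimpleModules.{v} (OpAlg (heckeGroupAlgebra k cs))
      (fun I : Set B => simpleQuotient k cs I) := by
  have hw : ∀ I : Set B, ∃ w : W, ascents cs w = I := fun I => ⟨_, ascents_top_one cs I⟩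
  refine areTheSimpleModules_of_local _ (antisymRadical k cs) (fun I => ?_)
    (fun I L hL => le_antisymRadical cs hL) ?_ (fun T _ _ _ => exists_linearMap_ne_zero cs T)
  · obtain ⟨w, rfl⟩ := hw I
    exact antisymRadical_ne_top cs w
  · rintro I J ⟨h⟩
    obtain ⟨w, rfl⟩ := hw I
    refine (eq_of_linearMap_simpleQuotient cs h.toLinearMap fun h0 =>
      antisymGen_notMem (k := k) cs w ?_).symm
    exact (Submodule.Quotient.mk_eq_zero _).1 (h.map_eq_zero_iff.1 h0)

end HeckeModules

/-! ### The simple modules as spaces of symmetrised antisymmetric vectors -/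

section Ribbon

open MonoidAlgebra (single)

variable {k : Type*} {B W : Type*} [Group W] {M : CoxeterMatrix B} (cs : CoxeterSystem M W)
  [Field k] [Fintype W]

lemma mem_iSup_iff_topOp_eq_zero {I : Set B} {v : MonoidAlgebra k W}
    (hv : v ∈ antisymModule k cs I) :
    v ∈ ⨆ J ∈ {J : Set B | I ⊂ J}, antisymModule k cs J ↔ topOp k cs Iᶜ v = 0 :=
  ⟨topOp_eq_zero_of_mem_iSup cs, fun h => mem_iSup_of_coeff_topOp cs hv fun w _ => by rw [h]; rfl⟩

omit [Fintype W] in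
/-- A linear map on `kW` that kills `∑_{J ⊋ I} P_J` induces a map on `S_I`. -/
noncomputable def simpleQuotientLift (I : Set B) {Y : Type*} [AddCommGroup Y] [Module k Y]
    (g : MonoidAlgebra k W →ₗ[k] Y)
    (h : ∀ v ∈ ⨆ J ∈ {J : Set B | I ⊂ J}, antisymModule k cs J, g v = 0) :
    simpleQuotient k cs I →ₗ[k] Y :=
  (Submodule.liftQ ((antisymRadical k cs I).restrictScalars k)
    (g ∘ₗ (antisymModule k cs I).subtype.restrictScalars k) fun x hx => h x hx) ∘ₗ
    (Submodule.Quotient.restrictScalarsEquiv k (antisymRadical k cs I)).symm.toLinearMap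

omit [Fintype W] in
lemma simpleQuotientLift_mk {I : Set B} {Y : Type*} [AddCommGroup Y] [Module k Y]
    (g : MonoidAlgebra k W →ₗ[k] Y)
    (h : ∀ v ∈ ⨆ J ∈ {J : Set B | I ⊂ J}, antisymModule k cs J, g v = 0)
    (x : antisymModule k cs I) :
    simpleQuotientLift cs I g h (Submodule.Quotient.mk x) = g x := rfl

omit [Fintype W] in
lemma simpleQuotientLift_injective {I : Set B} {Y : Type*} [AddCommGroup Y] [Module k Y]
    (g : MonoidAlgebra k W →ₗ[k] Y)
    (h : ∀ v ∈ ⨆ J ∈ {J : Set B | I ⊂ J}, antisymModule k cs J, g v = 0)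
    (h' : ∀ v ∈ antisymModule k cs I, g v = 0 →
      v ∈ ⨆ J ∈ {J : Set B | I ⊂ J}, antisymModule k cs J) :
    Function.Injective (simpleQuotientLift cs I g h) := by
  rw [injective_iff_map_eq_zero]
  intro x hx
  obtain ⟨x, rfl⟩ := Submodule.Quotient.mk_surjective _ x
  rw [simpleQuotientLift_mk] at hx
  exact (Submodule.Quotient.mk_eq_zero _).2 (h' x x.2 hx)

omit [Group W] [Fintype W] in
lemma OpAlg.toEnd_inclusion {A A' : Subalgebra k (Module.End k (MonoidAlgebra k W))}
    (h : A ≤ A') (f : OpAlg A) : (OpAlg.inclusion h f).toEnd = f.toEnd := rfl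

omit [Group W] [Fintype W] in
lemma OpAlg.inclusion_smul {A A' : Subalgebra k (Module.End k (MonoidAlgebra k W))}
    (h : A ≤ A') (f : OpAlg A) (v : MonoidAlgebra k W) : OpAlg.inclusion h f • v = f • v := by
  rw [OpAlg.smul_def, OpAlg.toEnd_inclusion, ← OpAlg.smul_def]

omit [Fintype W] in
/-- If `A` is a subalgebra of the Hecke group algebra, an `A`-equivariant map on `kW` that kills
`∑_{J ⊋ I} P_J` induces an `A`-linear map on the restriction of `S_I`. -/
noncomputable def restrictedQuotientLift (I : Set B)
    {A : Subalgebra k (Module.End k (MonoidAlgebra k W))} (hA : A ≤ heckeGroupAlgebra k cs)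
    {Y : Type*} [AddCommGroup Y] [Module k Y] [Module (OpAlg A) Y]
    (g : MonoidAlgebra k W →ₗ[k] Y) (hg : ∀ (f : OpAlg A) v, g (f • v) = f • g v)
    (h : ∀ v ∈ ⨆ J ∈ {J : Set B | I ⊂ J}, antisymModule k cs J, g v = 0) :
    (ModuleCat.restrictScalars (OpAlg.inclusion hA)).obj
      (ModuleCat.of (OpAlg (heckeGroupAlgebra k cs)) (simpleQuotient k cs I)) →ₗ[OpAlg A] Y where
  toFun := simpleQuotientLift cs I g h
  map_add' := (simpleQuotientLift cs I g h).map_add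
  map_smul' := fun f x => by
    obtain ⟨x, rfl⟩ := Submodule.Quotient.mk_surjective _ x
    change simpleQuotientLift cs I g h (Submodule.Quotient.mk (OpAlg.inclusion hA f • x)) =
      f • simpleQuotientLift cs I g h (Submodule.Quotient.mk x)
    rw [simpleQuotientLift_mk, simpleQuotientLift_mk, Submodule.coe_smul, OpAlg.inclusion_smul, hg]

variable (k) in
theorem exists_embedding (I : Set B) : ∃ f : simpleQuotient k cs I →ₗ[k]
    MonoidAlgebra k W ⧸ leftSymRelations k cs I,
    Function.Injective f ∧ ∀ x : antisymModule k cs I,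
      f (Submodule.Quotient.mk x) = Submodule.Quotient.mk (x : MonoidAlgebra k W) := by
  refine ⟨simpleQuotientLift cs I (leftSymRelations k cs I).mkQ fun v hv => ?_,
    simpleQuotientLift_injective cs _ _ fun v hv h => ?_, fun x => rfl⟩
  · rw [Submodule.mkQ_apply, Submodule.Quotient.mk_eq_zero, mem_leftSymRelations_iff]
    exact topOp_eq_zero_of_mem_iSup cs hv
  · rwa [Submodule.mkQ_apply, Submodule.Quotient.mk_eq_zero, mem_leftSymRelations_iff,
      ← mem_iSup_iff_topOp_eq_zero cs hv] at h

omit [Fintype W] in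
lemma groupOperators_mul {f : Module.End k (MonoidAlgebra k W)} (hf : f ∈ groupOperators k cs)
    (a v : MonoidAlgebra k W) : f (a * v) = a * f v := by
  unfold groupOperators at hf
  induction hf using Algebra.adjoin_induction generalizing v with
  | mem f hf =>
    obtain ⟨i, rfl⟩ := hf
    exact mul_assoc _ _ _
  | algebraMap r => simp [Module.algebraMap_end_apply]
  | add f g _ _ hf hg => rw [LinearMap.add_apply, hf, hg, LinearMap.add_apply, mul_add]
  | mul f g _ _ hf hg => rw [Module.End.mul_apply, hg, hf, Module.End.mul_apply]

lemma mulRight_mem' (x : MonoidAlgebra k W) : LinearMap.mulRight k x ∈ groupOperators k cs := by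
  have : LinearMap.mulRight k x =
      ∑ w, x.coeff w • LinearMap.mulRight k (single w (1 : k)) := by
    refine LinearMap.ext fun v => ?_
    conv_lhs => rw [eq_sum_single x]
    simp only [LinearMap.mulRight_apply, LinearMap.sum_apply, LinearMap.smul_apply,
      Finset.mul_sum, mul_smul_comm]
  rw [this]
  exact sum_mem fun w _ => Subalgebra.smul_mem _ (mulRight_mem k cs w) _

variable (k) in
theorem nonempty_resGroup_equiv_ribbon (I : Set B) :
    Nonempty (resGroup k cs I ≃ₗ[OpAlg (groupOperators k cs)] ribbon k cs I) := by
  have h0 : ∀ v ∈ ⨆ J ∈ {J : Set B | I ⊂ J}, antisymModule k cs J,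
      LinearMap.mulLeft k (symSum k cs Iᶜ) v = 0 := fun v hv =>
    (symSum_mul_eq_zero_iff cs).2 (topOp_eq_zero_of_mem_iSup cs hv)
  let ψ : resGroup k cs I →ₗ[OpAlg (groupOperators k cs)] MonoidAlgebra k W :=
    restrictedQuotientLift cs I (groupOperators_le k cs) (LinearMap.mulLeft k (symSum k cs Iᶜ))
      (fun f v => (groupOperators_mul cs f.2 _ _).symm) h0
  have hψ : Function.Injective ψ := simpleQuotientLift_injective cs _ h0 fun v hv h =>
    (mem_iSup_iff_topOp_eq_zero cs hv).2 ((symSum_mul_eq_zero_iff cs).1 h)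
  -- Since `P_I` is the right ideal generated by the alternating sum of `W_I`, its symmetrisation is
  -- the right ideal generated by the Young symmetrizer.
  have hr : LinearMap.range ψ = ribbon k cs I := by
    apply le_antisymm
    · rintro _ ⟨x, rfl⟩
      obtain ⟨x, rfl⟩ := Submodule.Quotient.mk_surjective _ x
      obtain ⟨y, hy⟩ := exists_altSum_mul_eq cs x.2
      have : ψ (Submodule.Quotient.mk x) =
          (⟨_, mulRight_mem' cs y⟩ : OpAlg (groupOperators k cs)) •
            (symSum k cs Iᶜ * altSum k cs I) := by
        change symSum k cs Iᶜ * (x : MonoidAlgebra k W) = symSum k cs Iᶜ * altSum k cs I * y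
        rw [hy, mul_assoc]
      rw [this]
      exact Submodule.smul_mem _ _ (Submodule.subset_span rfl)
    · rw [ribbon, Submodule.span_le, Set.singleton_subset_iff]
      exact ⟨Submodule.Quotient.mk ⟨altSum k cs I, isLeftAntisymmetric_altSum cs I⟩, rfl⟩
  exact ⟨(LinearEquiv.ofInjective ψ hψ).trans (LinearEquiv.ofEq _ _ hr)⟩

end Ribbon

/-! ### Restriction to the `0`-Hecke algebra -/

section ZeroHecke

open MonoidAlgebra (single)

variable {k : Type*} {B W : Type*} [Group W] {M : CoxeterMatrix B} (cs : CoxeterSystem M W)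
  [Field k]

lemma zeroHecke_comm {f : Module.End k (MonoidAlgebra k W)} (hf : f ∈ zeroHeckeAlgebra k cs)
    {g : W → W} (hg : ∀ j x, g (upR cs j x) = upR cs j (g x)) (v : MonoidAlgebra k W) :
    f (mapOp k g v) = mapOp k g (f v) := by
  unfold zeroHeckeAlgebra at hf
  induction hf using Algebra.adjoin_induction generalizing v with
  | mem f hf =>
    obtain ⟨i, rfl⟩ := hf
    have : piOp k cs i ∘ₗ mapOp k g = mapOp k g ∘ₗ piOp k cs i :=
      linearMap_ext_single fun w => by simp [piOp_eq_mapOp, hg]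
    exact congrArg (fun f : Module.End k (MonoidAlgebra k W) => f v) this
  | algebraMap r => simp [Module.algebraMap_end_apply]
  | add f g _ _ hf hg => rw [LinearMap.add_apply, hf, hg, LinearMap.add_apply, map_add]
  | mul f g _ _ hf hg => rw [Module.End.mul_apply, hg, hf, Module.End.mul_apply]

variable (k) in
/-- The composite of the operators `π_i` along a word, as an element of the `0`-Hecke algebra. -/
noncomputable def piElem (ω : List B) : OpAlg (zeroHeckeAlgebra k cs) := ⟨_, piWord_mem k cs ω⟩

lemma piElem_smul_single (ω : List B) (x : W) :
    piElem k cs ω • single x (1 : k) = single (upRs cs ω x) (1 : k) :=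
  mapOp_single k _ x

variable [Fintype W]

variable (k) in
-- An operator killing `1` kills every `w`, because `w` comes from `1` by left Demazure operators,
-- which commute with the algebra; and the operator of a reduced word of `w` sends `1` to `w`.
lemma bijective_toSpanSingleton_single : Function.Bijective
    (LinearMap.toSpanSingleton (OpAlg (zeroHeckeAlgebra k cs)) (MonoidAlgebra k W)
      (single 1 1)) := by
  set φ := LinearMap.toSpanSingleton (OpAlg (zeroHeckeAlgebra k cs)) (MonoidAlgebra k W)
    (single 1 1)
  have hφ : ∀ f, φ f = f • single (1 : W) (1 : k) := fun f => rfl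
  constructor
  · rw [injective_iff_map_eq_zero]
    intro f hf
    have hf' : f.toEnd (single 1 1) = 0 := hf
    refine Subtype.ext (linearMap_ext_single fun w => ?_)
    change f.toEnd (single w 1) = 0
    rw [← upLs_redWord_one cs w, ← mapOp_single, OpAlg.toEnd,
      zeroHecke_comm cs f.2 (upLs_upR_comm cs _)]
    change mapOp k _ (f.toEnd (single 1 1)) = 0
    rw [hf', map_zero]
  · intro v
    refine ⟨∑ w, v.coeff w • piElem k cs (redWord cs w), ?_⟩
    conv_rhs => rw [eq_sum_single v]
    simp_rw [hφ, Finset.sum_smul, smul_assoc, piElem_smul_single, upRs_redWord_one]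

variable (k) in
/-- The regular module of the `0`-Hecke algebra is `kW`. -/
noncomputable def zeroHeckeEquiv :
    OpAlg (zeroHeckeAlgebra k cs) ≃ₗ[OpAlg (zeroHeckeAlgebra k cs)] MonoidAlgebra k W :=
  LinearEquiv.ofBijective _ (bijective_toSpanSingleton_single k cs)

variable (k) in
lemma projective_zeroHecke : Module.Projective (OpAlg (zeroHeckeAlgebra k cs))
    (MonoidAlgebra k W) :=
  Module.Projective.of_equiv (zeroHeckeEquiv k cs)

lemma topOp_smul (K : Set B) (f : OpAlg (zeroHeckeAlgebra k cs)) (v : MonoidAlgebra k W) :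
    topOp k cs K (f • v) = f • topOp k cs K v :=
  (zeroHecke_comm cs f.2 (top_upR cs K) v).symm

lemma coeff_topOp_ne_zero {K : Set B} {v : MonoidAlgebra k W} {w : W}
    (h : (topOp k cs K v).coeff w ≠ 0) : ∀ i ∈ K, cs.IsLeftDescent w i := by
  classical
  rw [topOp, coeff_mapOp] at h
  obtain ⟨x, -, hx⟩ := Finset.exists_ne_zero_of_sum_ne_zero h
  rw [ite_ne_right_iff] at hx
  intro i hi
  rw [← hx.1]
  exact isLeftDescent_top cs hi x

/-- Symmetrised vectors are supported on elements whose left descents include `Iᶜ`, and a right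
Demazure step only adds left descents; a coefficient at descent set exactly `Iᶜ` can only come from
one of the same kind. -/
lemma coeff_topOp_apply_eq_zero {I : Set B} {f : Module.End k (MonoidAlgebra k W)}
    (hf : f ∈ zeroHeckeAlgebra k cs) {v : MonoidAlgebra k W}
    (hv : ∀ w, ascents cs w = I → (topOp k cs Iᶜ v).coeff w = 0) {w : W}
    (hw : ascents cs w = I) : (topOp k cs Iᶜ (f v)).coeff w = 0 := by
  classical
  unfold zeroHeckeAlgebra at hf
  induction hf using Algebra.adjoin_induction generalizing v w with
  | mem f hf =>
    obtain ⟨j, rfl⟩ := hf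
    have e : topOp k cs Iᶜ (piOp k cs j v) = piOp k cs j (topOp k cs Iᶜ v) :=
      (zeroHecke_comm cs (Algebra.subset_adjoin ⟨j, rfl⟩) (top_upR cs Iᶜ) v).symm
    rw [e, piOp_eq_mapOp, coeff_mapOp]
    refine Finset.sum_eq_zero fun x _ => ?_
    rw [ite_eq_right_iff]
    intro hx
    by_contra hc
    refine hc (hv x ?_)
    rw [ascents_eq_iff] at hw ⊢
    exact fun i => ⟨fun hi => (hw i).1 (hx ▸ isLeftDescent_upR cs hi), coeff_topOp_ne_zero cs hc i⟩
  | algebraMap r => simp [Module.algebraMap_end_apply, hv w hw]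
  | add f g _ _ hf hg => simp [hf hv hw, hg hv hw]
  | mul f g _ _ hf hg => exact hf (fun w hw => hg hv hw) hw

variable (k) in
/-- The vectors whose symmetrisation over `W_K` (`K` the complement of `I`) has no coefficient at
the elements with ascent set `I`. -/
noncomputable def descentKernel (I : Set B) :
    Submodule (OpAlg (zeroHeckeAlgebra k cs)) (MonoidAlgebra k W) where
  carrier := {v | ∀ w, ascents cs w = I → (topOp k cs Iᶜ v).coeff w = 0}
  zero_mem' := by simp
  add_mem' := fun {a b} ha hb w hw => by simp [ha w hw, hb w hw]
  smul_mem' := fun f _ hv _ hw => coeff_topOp_apply_eq_zero cs f.2 hv hw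

variable (k) in
/-- The descent module: the quotient of `kW` with basis the classes of the elements with ascent
set `I`. -/
abbrev descentModule (I : Set B) : Type _ := MonoidAlgebra k W ⧸ descentKernel k cs I

lemma sub_topOp_mem_descentKernel (I : Set B) (v : MonoidAlgebra k W) :
    topOp k cs Iᶜ v - v ∈ descentKernel k cs I := by
  have : topOp k cs Iᶜ (topOp k cs Iᶜ v) = topOp k cs Iᶜ v := by
    have : topOp k cs Iᶜ ∘ₗ topOp k cs Iᶜ = topOp k cs Iᶜ :=
      linearMap_ext_single fun w => by simp [topOp_single, top_top]
    exact congrArg (fun f : Module.End k (MonoidAlgebra k W) => f v) this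
  intro w _
  rw [map_sub, this, sub_self]
  rfl

lemma single_mem_descentKernel {I : Set B} {w : W} (h : ∀ i ∈ Iᶜ, cs.IsLeftDescent w i)
    (h' : ascents cs w ≠ I) : single w (1 : k) ∈ descentKernel k cs I := by
  intro x hx
  rw [topOp_single, top_eq_self cs h, MonoidAlgebra.coeff_single, Finsupp.single_eq_of_ne]
  rintro rfl
  exact h' hx

/-- Downward induction on length. If `w` is not longest in `W_{Iᶜ} w`, pass to the longest element.
If its left descents strictly contain `Iᶜ`, it is in the kernel. Otherwise `asc(w) = I`, and `w` is
`v_w` minus longer terms. -/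
lemma single_mem_sup (I : Set B) (w : W) : ∃ x ∈ antisymModule k cs I,
    single w (1 : k) - x ∈ descentKernel k cs I := by
  classical
  induction hn : cs.length (longest cs) - cs.length w using Nat.strong_induction_on generalizing w
    with
  | _ n ih =>
  have hle : ∀ y, cs.length y ≤ cs.length (longest cs) := fun y => by
    have := length_mul_longest cs y; omega
  by_cases ht : top cs Iᶜ w = w
  · have hd : ∀ i ∈ Iᶜ, cs.IsLeftDescent w i := fun i hi => ht ▸ isLeftDescent_top cs hi w
    by_cases hI : ascents cs w = I
    · subst hI
      let g : W → MonoidAlgebra k W := fun y =>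
        if h : cs.length w < cs.length y then
          (ih _ (by have := hle y; omega) y rfl).choose else 0
      have hg : ∀ y, g y ∈ antisymModule k cs (ascents cs w) := by
        intro y
        by_cases h : cs.length w < cs.length y
        · simp only [g, dif_pos h]
          exact (ih _ (by have := hle y; omega) y rfl).choose_spec.1
        · simp only [g, dif_neg h]; exact zero_mem _
      have hg' : ∀ y, cs.length w < cs.length y →
          single y (1 : k) - g y ∈ descentKernel k cs (ascents cs w) := by
        intro y h
        simp only [g, dif_pos h]
        exact (ih _ (by have := hle y; omega) y rfl).choose_spec.2
      let c : W → k := fun y => if y = w then 0 else (antisymVector k cs w).coeff y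
      refine ⟨antisymVector k cs w - ∑ y, c y • g y, ?_, ?_⟩
      · refine sub_mem (isLeftAntisymmetric_antisymVector cs w) (sum_mem fun y _ => ?_)
        exact Submodule.smul_of_tower_mem _ _ (hg y)
      · have e : single w (1 : k) - (antisymVector k cs w - ∑ y, c y • g y) =
            -∑ y, c y • (single y (1 : k) - g y) := by
          have e1 : antisymVector k cs w = single w 1 + ∑ y, c y • single y (1 : k) := by
            ext y
            simp only [MonoidAlgebra.coeff_add, MonoidAlgebra.coeff_sum, MonoidAlgebra.coeff_smul,
              Finsupp.coe_finsetSum, Finset.sum_apply, Finsupp.smul_apply, smul_eq_mul,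
              MonoidAlgebra.coeff_single, Finsupp.coe_add, Pi.add_apply]
            rw [Finset.sum_eq_single y]
            · by_cases hy : y = w
              · subst hy; simp [c, coeff_antisymVector_self]
              · simp [c, hy, Finsupp.single_eq_of_ne hy]
            · intro z _ hz
              rw [Finsupp.single_eq_of_ne hz.symm, mul_zero]
            · simp
          simp_rw [smul_sub]
          rw [Finset.sum_sub_distrib, e1]
          abel
        rw [e]
        refine neg_mem (sum_mem fun y _ => ?_)
        by_cases hc : c y = 0
        · rw [hc, zero_smul]; exact zero_mem _
        · refine Submodule.smul_of_tower_mem _ _ (hg' y ?_)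
          have hyw : y ≠ w := fun h => hc (if_pos h)
          simp only [c, if_neg hyw] at hc
          exact (coeff_antisymVector_of_ne_zero cs hc).2.resolve_left hyw
    · exact ⟨0, zero_mem _, by rw [sub_zero]; exact single_mem_descentKernel cs hd hI⟩
  · have hlt : cs.length w < cs.length (top cs Iᶜ w) := by
      by_contra h
      exact ht (top_eq_self_of_length_le cs (not_lt.1 h))
    obtain ⟨x, hx, hx'⟩ := ih _ (by have := hle (top cs Iᶜ w); omega) (top cs Iᶜ w) rfl
    refine ⟨x, hx, ?_⟩
    have := sub_mem hx' (sub_topOp_mem_descentKernel (k := k) cs I (single w 1))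
    rw [topOp_single] at this
    simpa using this

lemma exists_mem_antisymModule (I : Set B) (v : MonoidAlgebra k W) :
    ∃ x ∈ antisymModule k cs I, v - x ∈ descentKernel k cs I := by
  choose g hg hg' using single_mem_sup (k := k) cs I
  refine ⟨∑ w, v.coeff w • g w, sum_mem fun w _ => Submodule.smul_of_tower_mem _ _ (hg w), ?_⟩
  have e : v - ∑ w, v.coeff w • g w = ∑ w, v.coeff w • (single w (1 : k) - g w) := by
    simp_rw [smul_sub]
    rw [Finset.sum_sub_distrib, ← eq_sum_single]
  rw [e]
  exact sum_mem fun w _ => Submodule.smul_of_tower_mem _ _ (hg' w)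

lemma mkQ_eq_zero_of_mem_iSup {I : Set B} {v : MonoidAlgebra k W}
    (hv : v ∈ ⨆ J ∈ {J : Set B | I ⊂ J}, antisymModule k cs J) :
    (descentKernel k cs I).mkQ.restrictScalars k v = 0 := by
  refine (Submodule.Quotient.mk_eq_zero _).2 fun w _ => ?_
  rw [topOp_eq_zero_of_mem_iSup cs hv]; rfl

variable (k) in
/-- The map from the restriction of `S_I` to the descent module. -/
noncomputable def toDescentModule (I : Set B) :
    resZeroHecke k cs I →ₗ[OpAlg (zeroHeckeAlgebra k cs)] descentModule k cs I :=
  restrictedQuotientLift cs I (zeroHeckeAlgebra_le k cs)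
    ((descentKernel k cs I).mkQ.restrictScalars k)
    (fun f v => (descentKernel k cs I).mkQ.map_smul f v) fun _ hv => mkQ_eq_zero_of_mem_iSup cs hv

lemma toDescentModule_injective (I : Set B) : Function.Injective (toDescentModule k cs I) :=
  simpleQuotientLift_injective cs _ (fun _ hv => mkQ_eq_zero_of_mem_iSup cs hv) fun _ hv h =>
    mem_iSup_of_coeff_topOp cs hv ((Submodule.Quotient.mk_eq_zero _).1 h)

lemma toDescentModule_surjective (I : Set B) : Function.Surjective (toDescentModule k cs I) := by
  intro y
  obtain ⟨v, rfl⟩ := Submodule.Quotient.mk_surjective _ y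
  obtain ⟨x, hx, hx'⟩ := exists_mem_antisymModule cs I v
  exact ⟨(Submodule.Quotient.mk ⟨x, hx⟩ : simpleQuotient k cs I),
    ((Submodule.Quotient.eq _).2 hx').symm⟩

variable (k) in
/-- The restriction of `S_I` to the `0`-Hecke algebra is the descent module. -/
noncomputable def resZeroHeckeEquiv (I : Set B) :
    resZeroHecke k cs I ≃ₗ[OpAlg (zeroHeckeAlgebra k cs)] descentModule k cs I :=
  LinearEquiv.ofBijective (toDescentModule k cs I)
    ⟨toDescentModule_injective cs I, toDescentModule_surjective cs I⟩

variable (k) in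
/-- Symmetrisation as a map from the restriction of `S_I` to `kW`. -/
noncomputable def symmetrise (I : Set B) :
    resZeroHecke k cs I →ₗ[OpAlg (zeroHeckeAlgebra k cs)] MonoidAlgebra k W :=
  restrictedQuotientLift cs I (zeroHeckeAlgebra_le k cs) (topOp k cs Iᶜ) (topOp_smul cs Iᶜ)
    fun _ hv => topOp_eq_zero_of_mem_iSup cs hv

lemma mkQ_topOp (I : Set B) (x : MonoidAlgebra k W) :
    (descentKernel k cs I).mkQ (topOp k cs Iᶜ x) = (descentKernel k cs I).mkQ x := by
  rw [← sub_eq_zero, ← map_sub, Submodule.mkQ_apply, Submodule.Quotient.mk_eq_zero]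
  exact sub_topOp_mem_descentKernel cs I x

lemma symmetrise_mk (I : Set B) (x : antisymModule k cs I) :
    symmetrise k cs I (Submodule.Quotient.mk x : simpleQuotient k cs I) = topOp k cs Iᶜ x := rfl

lemma toDescentModule_mk (I : Set B) (x : antisymModule k cs I) :
    toDescentModule k cs I (Submodule.Quotient.mk x : simpleQuotient k cs I) =
      (descentKernel k cs I).mkQ x := rfl

lemma mkQ_symmetrise_mk (I : Set B) (x : antisymModule k cs I) :
    (descentKernel k cs I).mkQ
        (symmetrise k cs I (Submodule.Quotient.mk x : simpleQuotient k cs I)) =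
      toDescentModule k cs I (Submodule.Quotient.mk x : simpleQuotient k cs I) := by
  rw [symmetrise_mk]
  rw [toDescentModule_mk, mkQ_topOp]

lemma mkQ_symmetrise (I : Set B) (x : simpleQuotient k cs I) :
    (descentKernel k cs I).mkQ (symmetrise k cs I x) = toDescentModule k cs I x :=
  Submodule.Quotient.induction_on _ x fun x => mkQ_symmetrise_mk cs I x

/-- Symmetrisation does not change classes modulo the kernel, so, defined on `S_I`, it gives a
section of the projection from `kW`. -/
lemma projective_descentModule (I : Set B) :
    Module.Projective (OpAlg (zeroHeckeAlgebra k cs)) (descentModule k cs I) := by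
  have := projective_zeroHecke k cs
  refine Module.Projective.of_split
    (symmetrise k cs I ∘ₗ (resZeroHeckeEquiv k cs I).symm.toLinearMap) (descentKernel k cs I).mkQ
    (LinearMap.ext fun y => ?_)
  rw [LinearMap.comp_apply, LinearMap.comp_apply]
  exact (mkQ_symmetrise cs I _).trans ((resZeroHeckeEquiv k cs I).apply_symm_apply y)

end ZeroHecke

/-! ### The indecomposable projectives of the `0`-Hecke algebra -/

section ZeroHeckeLocal

open MonoidAlgebra (single)

variable {k : Type*} {B W : Type*} [Group W] {M : CoxeterMatrix B} (cs : CoxeterSystem M W)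
  [Field k]

/-- The `0`-Hecke algebra acts on `T` by the character sending `π_i` to `1` for `i ∈ J` and to `0`
otherwise. -/
def ActsByCharacter (T : Type*) [AddCommGroup T] [Module (OpAlg (zeroHeckeAlgebra k cs)) T]
    (J : Set B) : Prop :=
  ∀ (i : B) (t : T), (i ∈ J → piElem k cs [i] • t = t) ∧ (i ∉ J → piElem k cs [i] • t = 0)

variable {T : Type*} [AddCommGroup T] [Module (OpAlg (zeroHeckeAlgebra k cs)) T]

lemma smul_eq_algebraMap_smul {J : Set B} {t : T}
    (ht : ∀ i, (i ∈ J → piElem k cs [i] • t = t) ∧ (i ∉ J → piElem k cs [i] • t = 0))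
    (f : OpAlg (zeroHeckeAlgebra k cs)) :
    ∃ c : k, f • t = algebraMap k (OpAlg (zeroHeckeAlgebra k cs)) c • t := by
  -- Restated for bare operators, so that induction over the generators applies; a common
  -- eigenvector of the generators is an eigenvector of the algebra.
  suffices h : ∀ f, f ∈ zeroHeckeAlgebra k cs → ∃ g : OpAlg (zeroHeckeAlgebra k cs),
      g.toEnd = f ∧ ∃ c : k, g • t = algebraMap k (OpAlg (zeroHeckeAlgebra k cs)) c • t by
    obtain ⟨g, hg, h⟩ := h f.toEnd f.2
    rwa [show f = g from Subtype.ext hg.symm]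
  intro f hf
  unfold zeroHeckeAlgebra at hf
  induction hf using Algebra.adjoin_induction with
  | mem f hf =>
    obtain ⟨i, rfl⟩ := hf
    refine ⟨piElem k cs [i], (piOp_eq_mapOp cs i).symm, ?_⟩
    by_cases hi : i ∈ J
    · exact ⟨1, by rw [map_one, one_smul, (ht i).1 hi]⟩
    · exact ⟨0, by rw [map_zero, zero_smul, (ht i).2 hi]⟩
  | algebraMap r => exact ⟨algebraMap k _ r, rfl, r, rfl⟩
  | add f g hf hg ihf ihg =>
    obtain ⟨x, rfl, a, ha⟩ := ihf
    obtain ⟨y, rfl, b, hb⟩ := ihg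
    exact ⟨x + y, rfl, a + b, by rw [map_add, add_smul, add_smul, ha, hb]⟩
  | mul f g hf hg ihf ihg =>
    obtain ⟨x, rfl, a, ha⟩ := ihf
    obtain ⟨y, rfl, b, hb⟩ := ihg
    refine ⟨x * y, rfl, b * a, ?_⟩
    rw [map_mul, mul_smul, mul_smul, hb, ← ha, ← mul_smul, ← Algebra.commutes, mul_smul]

variable [Fintype W]

omit [Fintype W] in
lemma map_single_upRs {J : Set B} (hJ : ActsByCharacter (k := k) cs T J)
    (φ : MonoidAlgebra k W →ₗ[OpAlg (zeroHeckeAlgebra k cs)] T) (ω : List B) (x : W) :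
    ((∀ i ∈ ω, i ∈ J) → φ (single (upRs cs ω x) 1) = φ (single x 1)) ∧
      ((∃ i ∈ ω, i ∉ J) → φ (single (upRs cs ω x) 1) = 0) := by
  have hone : ∀ i x, piElem k cs [i] • φ (single x 1) = φ (single (upR cs i x) 1) := by
    intro i x
    rw [← map_smul, piElem_smul_single]
    rfl
  have hzero : ∀ (ω : List B) x, φ (single x 1) = 0 → φ (single (upRs cs ω x) 1) = 0 := by
    intro ω x hx
    rw [← piElem_smul_single, map_smul, hx, smul_zero]
  induction ω generalizing x with
  | nil => simp
  | cons i ω ih =>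
    rw [upRs_cons]
    constructor
    · intro h
      rw [(ih _).1 fun j hj => h j (by simp [hj]), ← hone, (hJ i _).1 (h i (by simp))]
    · intro h
      by_cases hi : i ∈ J
      · refine (ih _).2 ?_
        obtain ⟨j, hj, hj'⟩ := h
        rcases List.mem_cons.1 hj with rfl | hj
        · exact absurd hi hj'
        · exact ⟨j, hj, hj'⟩
      · exact hzero _ _ (by rw [← hone, (hJ i _).2 hi])

lemma map_single {J : Set B} (hJ : ActsByCharacter (k := k) cs T J)
    (φ : MonoidAlgebra k W →ₗ[OpAlg (zeroHeckeAlgebra k cs)] T) (x : W) :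
    (x ∈ parabolic cs J → φ (single x 1) = φ (single 1 1)) ∧
      (x ∉ parabolic cs J → φ (single x 1) = 0) := by
  constructor
  · intro hx
    obtain ⟨ω, h1, h2, h3⟩ := exists_word_of_mem_parabolic cs hx
    rw [← (map_single_upRs cs hJ φ ω 1).1 h1, upRs_one_of_isReduced cs h2, h3]
  · intro hx
    have := (map_single_upRs cs hJ φ (redWord cs x) 1).2 (by
      by_contra! h
      exact hx (wordProd_redWord cs x ▸ wordProd_mem_parabolic cs h))
    rwa [upRs_redWord_one] at this

open Classical in
lemma sub_sum_mem_ker {J : Set B} (hJ : ActsByCharacter (k := k) cs T J)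
    (φ : MonoidAlgebra k W →ₗ[OpAlg (zeroHeckeAlgebra k cs)] T) (v : MonoidAlgebra k W) :
    v - (∑ x : W with x ∈ parabolic cs J, v.coeff x) • single 1 1 ∈ LinearMap.ker φ := by
  have e : v - (∑ x : W with x ∈ parabolic cs J, v.coeff x) • single (1 : W) (1 : k) =
      ∑ x, v.coeff x • (single x (1 : k) - if x ∈ parabolic cs J then single 1 1 else 0) := by
    simp_rw [smul_sub]
    rw [Finset.sum_sub_distrib, ← eq_sum_single, Finset.sum_smul, Finset.sum_filter]
    simp_rw [smul_ite, smul_zero]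
  rw [e]
  refine sum_mem fun x _ => Submodule.smul_of_tower_mem _ _ ?_
  rw [LinearMap.mem_ker, map_sub]
  split_ifs with h
  · rw [(map_single cs hJ φ x).1 h, sub_self]
  · rw [(map_single cs hJ φ x).2 h, map_zero, sub_zero]

open Classical in
-- Such a map takes the value `φ(1)` on `W_J` and `0` on all other group elements. Its kernel thus
-- depends on `J` alone.
lemma map_eq_zero_iff_sum {J : Set B} (hJ : ActsByCharacter (k := k) cs T J)
    {φ : MonoidAlgebra k W →ₗ[OpAlg (zeroHeckeAlgebra k cs)] T} (hφ : φ ≠ 0)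
    (v : MonoidAlgebra k W) :
    φ v = 0 ↔ ∑ x : W with x ∈ parabolic cs J, v.coeff x = 0 := by
  have h := sub_sum_mem_ker cs hJ φ
  constructor
  · intro hv
    by_contra hc
    have h1 : single (1 : W) (1 : k) ∈ LinearMap.ker φ := by
      have h2 := sub_mem (LinearMap.mem_ker.2 hv) (h v)
      rw [sub_sub_cancel] at h2
      have := Submodule.smul_of_tower_mem _ (∑ x : W with x ∈ parabolic cs J, v.coeff x)⁻¹ h2
      rwa [smul_smul, inv_mul_cancel₀ hc, one_smul] at this
    refine hφ (LinearMap.ext fun u => ?_)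
    have h2 := add_mem (h u) (Submodule.smul_of_tower_mem _
      (∑ x : W with x ∈ parabolic cs J, u.coeff x) h1)
    rwa [sub_add_cancel] at h2
  · intro hv
    have := h v
    rwa [hv, zero_smul, sub_zero] at this

/-- For a longest `w` with `φ(w) ≠ 0`, each `π_i` either fixes `φ(w)` or moves `w` to a longer
element, where `φ` vanishes. So `φ(w)` is a common eigenvector, and it generates `T`. -/
lemma exists_actsByCharacter [IsSimpleModule (OpAlg (zeroHeckeAlgebra k cs)) T]
    {φ : MonoidAlgebra k W →ₗ[OpAlg (zeroHeckeAlgebra k cs)] T} (hφ : φ ≠ 0) :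
    ∃ J, ActsByCharacter (k := k) cs T J := by
  have hne : {w : W | φ (single w 1) ≠ 0}.Nonempty := by
    by_contra h
    rw [Set.not_nonempty_iff_eq_empty, Set.eq_empty_iff_forall_notMem] at h
    refine hφ (LinearMap.ext fun v => ?_)
    have : v ∈ LinearMap.ker φ := by
      rw [eq_sum_single v]
      exact sum_mem fun w _ => Submodule.smul_of_tower_mem _ _ (not_not.1 (h w))
    exact this
  obtain ⟨w, hw, hmax⟩ := Set.exists_max_image _ cs.length (Set.toFinite _) hne
  have hone : ∀ i, piElem k cs [i] • φ (single w 1) = φ (single (upR cs i w) 1) := by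
    intro i
    rw [← map_smul, piElem_smul_single]
    rfl
  have ht : ∀ i, (i ∈ {i | cs.IsRightDescent w i} → piElem k cs [i] • φ (single w 1) =
      φ (single w 1)) ∧ (i ∉ {i | cs.IsRightDescent w i} →
      piElem k cs [i] • φ (single w 1) = 0) := by
    intro i
    constructor
    · intro hi
      rw [hone, upR_of_descent cs hi]
    · intro hi
      rw [hone, upR_of_not_descent cs hi]
      by_contra h
      have := hmax _ h
      rw [cs.not_isRightDescent_iff.1 hi] at this
      omega
  refine ⟨{i | cs.IsRightDescent w i}, fun i t => ?_⟩
  have hs := IsSimpleModule.toSpanSingleton_surjective (OpAlg (zeroHeckeAlgebra k cs)) hw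
  obtain ⟨f, rfl⟩ := hs t
  obtain ⟨c, hc⟩ := smul_eq_algebraMap_smul cs ht f
  rw [LinearMap.toSpanSingleton_apply, hc, ← mul_smul, ← Algebra.commutes, mul_smul]
  exact ⟨fun hi => by rw [(ht i).1 hi], fun hi => by rw [(ht i).2 hi, smul_zero]⟩

/-- For `i ∉ I` the kernel contains `s_i - 1`, so `φ(s_i) = φ(1) ≠ 0` and `i ∈ J`. Were `J` strictly
larger than `Iᶜ`, the longest element of `W_J` would be in the kernel, although `φ` takes the value
`φ(1)` there. -/
lemma eq_compl_of_descentKernel_le {J I : Set B} (hJ : ActsByCharacter (k := k) cs T J)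
    {φ : MonoidAlgebra k W →ₗ[OpAlg (zeroHeckeAlgebra k cs)] T} (hφ : φ ≠ 0)
    (h : descentKernel k cs I ≤ LinearMap.ker φ) : J = Iᶜ := by
  have hone : φ (single 1 1) ≠ 0 := by
    intro h1
    classical
    refine hφ (LinearMap.ext fun v => ?_)
    have := add_mem (sub_sum_mem_ker cs hJ φ v)
      (Submodule.smul_of_tower_mem _ (∑ x : W with x ∈ parabolic cs J, v.coeff x)
        (LinearMap.mem_ker.2 h1))
    rwa [sub_add_cancel] at this
  have h1 : Iᶜ ⊆ J := by
    intro i hi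
    rw [← simple_mem_parabolic_iff cs]
    by_contra hn
    have h2 := (map_single cs hJ φ _).2 hn
    have h3 : single (cs.simple i) (1 : k) - single 1 1 ∈ descentKernel k cs I := by
      intro w _
      rw [map_sub, topOp_single, topOp_single, ← mul_one (cs.simple i), top_simple_mul cs hi,
        sub_self]
      rfl
    have h4 := h h3
    rw [LinearMap.mem_ker, map_sub, h2, zero_sub, neg_eq_zero] at h4
    exact hone h4
  by_contra hne
  have h2 : single (top cs J 1) (1 : k) ∈ descentKernel k cs I := by
    refine single_mem_descentKernel cs (fun i hi => isLeftDescent_top cs (h1 hi) 1) fun h3 => ?_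
    rw [← compl_compl J, ascents_top_one] at h3
    exact hne (by rw [← h3, compl_compl])
  have h3 := h h2
  rw [LinearMap.mem_ker, (map_single cs hJ φ _).1 (top_one_mem cs J)] at h3
  exact hone h3

/-- `φ` is unchanged by symmetrisation over `W_J`. Within `W_J`, a symmetrised vector can be
supported only at the longest element, where the coefficient vanishes by assumption. -/
lemma descentKernel_le_ker {J : Set B} (hJ : ActsByCharacter (k := k) cs T J)
    {φ : MonoidAlgebra k W →ₗ[OpAlg (zeroHeckeAlgebra k cs)] T} (hφ : φ ≠ 0) :
    descentKernel k cs Jᶜ ≤ LinearMap.ker φ := by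
  classical
  intro v hv
  have h1 : topOp k cs J v ∈ LinearMap.ker φ := by
    rw [LinearMap.mem_ker, map_eq_zero_iff_sum cs hJ hφ]
    refine Finset.sum_eq_zero fun x hx => ?_
    by_contra hc
    have hd := top_eq_self cs (coeff_topOp_ne_zero cs hc)
    have hx' : top cs J x = top cs J 1 := (top_eq_top_iff cs).2 (by simpa using hx)
    rw [hd] at hx'
    refine hc ?_
    have := hv x (by rw [hx']; conv_lhs => rw [← compl_compl J, ascents_top_one])
    rwa [compl_compl] at this
  have h2 : topOp k cs J v - v ∈ LinearMap.ker φ := by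
    have e : topOp k cs J v - v = ∑ x, v.coeff x • (single (top cs J x) (1 : k) - single x 1) := by
      simp_rw [smul_sub]
      rw [Finset.sum_sub_distrib, ← eq_sum_single, topOp, mapOp_apply]
    rw [e]
    refine sum_mem fun x _ => Submodule.smul_of_tower_mem _ _ ?_
    rw [LinearMap.mem_ker, map_sub]
    obtain ⟨u, hu, h⟩ := exists_mem_top_eq_mul cs J x
    by_cases hx : x ∈ parabolic cs J
    · rw [(map_single cs hJ φ x).1 hx, (map_single cs hJ φ _).1 (h ▸ mul_mem hu hx), sub_self]
    · rw [(map_single cs hJ φ x).2 hx, (map_single cs hJ φ _).2, sub_self]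
      rwa [h, Subgroup.mul_mem_cancel_left _ hu]
  have := sub_mem h1 h2
  rwa [sub_sub_cancel] at this

lemma descentKernel_ne_top (I : Set B) : descentKernel k cs I ≠ ⊤ := by
  intro h
  have h1 : single (top cs Iᶜ 1) (1 : k) ∈ descentKernel k cs I := h ▸ Submodule.mem_top
  have h2 := h1 _ (ascents_top_one cs I)
  rw [topOp_single, top_top, MonoidAlgebra.coeff_single, Finsupp.single_eq_same] at h2
  exact one_ne_zero h2

lemma ker_eq_ker {J : Set B} (hJ : ActsByCharacter (k := k) cs T J)
    {T' : Type*} [AddCommGroup T'] [Module (OpAlg (zeroHeckeAlgebra k cs)) T']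
    (hJ' : ActsByCharacter (k := k) cs T' J)
    {φ : MonoidAlgebra k W →ₗ[OpAlg (zeroHeckeAlgebra k cs)] T} (hφ : φ ≠ 0)
    {φ' : MonoidAlgebra k W →ₗ[OpAlg (zeroHeckeAlgebra k cs)] T'} (hφ' : φ' ≠ 0) :
    LinearMap.ker φ = LinearMap.ker φ' := by
  ext v
  rw [LinearMap.mem_ker, LinearMap.mem_ker, map_eq_zero_iff_sum cs hJ hφ,
    map_eq_zero_iff_sum cs hJ' hφ']

lemma actsByCharacter_of_map_descentModule {I : Set B}
    [IsSimpleModule (OpAlg (zeroHeckeAlgebra k cs)) T]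
    {ψ : descentModule k cs I →ₗ[OpAlg (zeroHeckeAlgebra k cs)] T} (hψ : ψ ≠ 0) :
    ψ ∘ₗ (descentKernel k cs I).mkQ ≠ 0 ∧ ActsByCharacter (k := k) cs T Iᶜ := by
  have h : ψ ∘ₗ (descentKernel k cs I).mkQ ≠ 0 := by
    intro h
    refine hψ (Submodule.linearMap_qext _ ?_)
    rw [h, LinearMap.zero_comp]
  obtain ⟨J, hJ⟩ := exists_actsByCharacter cs h
  refine ⟨h, ?_⟩
  rwa [← eq_compl_of_descentKernel_le cs hJ h fun v hv => ?_]
  rw [LinearMap.mem_ker, LinearMap.comp_apply, Submodule.mkQ_apply,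
    (Submodule.Quotient.mk_eq_zero _).2 hv, map_zero]

variable (k) in
theorem areTheIndecomposableProjectives_descentModule :
    AreTheIndecomposableProjectives.{v} (OpAlg (zeroHeckeAlgebra k cs))
      (fun I : Set B => descentModule k cs I) := by
  have hnt : ∀ I : Set B, Nontrivial (descentModule k cs I) := fun I =>
    Submodule.Quotient.nontrivial_iff.2 (descentKernel_ne_top cs I)
  have hco : ∀ I : Set B, ∃ N : Submodule (OpAlg (zeroHeckeAlgebra k cs)) (descentModule k cs I),
      IsCoatom N := fun I =>
    ((eq_top_or_exists_le_coatom ⊥).resolve_left bot_ne_top).imp fun _ h => h.1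
  choose N hN using hco
  have hmk : ∀ {X : Type _} [AddCommGroup X] [Module (OpAlg (zeroHeckeAlgebra k cs)) X]
      {L : Submodule (OpAlg (zeroHeckeAlgebra k cs)) X}, IsCoatom L → L.mkQ ≠ 0 := by
    intro X _ _ L hL h
    exact hL.1 (by rw [← L.ker_mkQ, h, LinearMap.ker_zero])
  refine areTheIndecomposableProjectives_of_local _ (projective_descentModule cs) N
    (fun I => (hN I).1) (fun I L hL => ?_) ?_ ?_
  -- Every simple quotient carries the character of `Iᶜ`, and the kernel is determined by the
  -- character, so there is only one maximal submodule.
  · obtain ⟨L', hL', hle⟩ := (eq_top_or_exists_le_coatom L).resolve_left hL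
    refine hle.trans (le_of_eq ?_)
    have := isSimpleModule_iff_isCoatom.2 hL'
    have := isSimpleModule_iff_isCoatom.2 (hN I)
    obtain ⟨h1, h2⟩ := actsByCharacter_of_map_descentModule cs (hmk hL')
    obtain ⟨h3, h4⟩ := actsByCharacter_of_map_descentModule cs (hmk (hN I))
    have h := ker_eq_ker cs h2 h4 h1 h3
    rw [LinearMap.ker_comp, LinearMap.ker_comp, Submodule.ker_mkQ, Submodule.ker_mkQ] at h
    exact Submodule.comap_injective_of_surjective (Submodule.mkQ_surjective _) h
  · rintro I J ⟨e⟩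
    have := isSimpleModule_iff_isCoatom.2 (hN J)
    have hne : (N J).mkQ ∘ₗ e.toLinearMap ≠ 0 := by
      intro h
      refine hmk (hN J) (LinearMap.ext fun x => ?_)
      simpa using congrArg (fun f => f (e.symm x)) h
    obtain ⟨h1, h2⟩ := actsByCharacter_of_map_descentModule cs hne
    obtain ⟨h3, -⟩ := actsByCharacter_of_map_descentModule cs (hmk (hN J))
    refine compl_injective (eq_compl_of_descentKernel_le cs h2 h3 fun v hv => ?_)
    rw [LinearMap.mem_ker, LinearMap.comp_apply, Submodule.mkQ_apply (descentKernel k cs J),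
      (Submodule.Quotient.mk_eq_zero _).2 hv, map_zero]
  · intro T _ _ hT
    have := hT.nontrivial
    obtain ⟨t, ht⟩ := exists_ne (0 : T)
    let φ := LinearMap.toSpanSingleton (OpAlg (zeroHeckeAlgebra k cs)) T t ∘ₗ
      (zeroHeckeEquiv k cs).symm.toLinearMap
    have hφ : φ ≠ 0 := by
      intro h
      have h1 : φ (zeroHeckeEquiv k cs 1) = 0 := by rw [h, LinearMap.zero_apply]
      simp [φ, ht] at h1
    obtain ⟨J, hJ⟩ := exists_actsByCharacter cs hφ
    refine ⟨Jᶜ, (descentKernel k cs Jᶜ).liftQ φ (descentKernel_le_ker cs hJ hφ), fun h => hφ ?_⟩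
    rw [← Submodule.liftQ_mkQ _ φ (descentKernel_le_ker cs hJ hφ), h, LinearMap.zero_comp]

end ZeroHeckeLocal

lemma AreTheIndecomposableProjectives.congr {R : Type*} [Ring R] {ι : Type*} {P Q : ι → Type*}
    [∀ i, AddCommGroup (P i)] [∀ i, Module R (P i)] [∀ i, AddCommGroup (Q i)]
    [∀ i, Module R (Q i)] (e : ∀ i, P i ≃ₗ[R] Q i)
    (h : AreTheIndecomposableProjectives.{v} R Q) : AreTheIndecomposableProjectives.{v} R P := by
  refine ⟨fun i => ⟨?_, ?_, fun L L' hL => ?_⟩, fun i j ⟨f⟩ => h.2.1 i j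
    ⟨(e i).symm.trans (f.trans (e j))⟩, fun X _ _ h1 h2 => ?_⟩
  · have := (h.1 i).1
    exact Module.Projective.of_equiv (e i).symm
  · have := (h.1 i).2.1
    exact (e i).toEquiv.nontrivial
  · have hc : IsCompl (L.map (e i).toLinearMap) (L'.map (e i).toLinearMap) :=
      (Submodule.orderIsoMapComap (e i)).isCompl hL
    exact ((h.1 i).2.2 _ _ hc).imp (fun h => by simpa using h) (fun h => by simpa using h)
  · obtain ⟨i, ⟨f⟩⟩ := h.2.2 X h1 h2
    exact ⟨i, ⟨f.trans (e i).symm⟩⟩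

theorem areTheIndecomposableProjectives_resZeroHecke (k : Type*) {B W : Type*} [Group W]
    {M : CoxeterMatrix B} (cs : CoxeterSystem M W) [Field k] [Fintype W] :
    AreTheIndecomposableProjectives.{v} (OpAlg (zeroHeckeAlgebra k cs))
      (fun I : Set B => resZeroHecke k cs I) :=
  (areTheIndecomposableProjectives_descentModule k cs).congr (resZeroHeckeEquiv k cs)

/-! ### Morita equivalence with a full corner -/

section Corner

open CategoryTheory

universe u u₁ u₂

variable {k : Type u} [CommRing k] {A : Type u₁} [Ring A] [Algebra k A] {C : Type u₂} [Ring C]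
  [Algebra k C] (φ : C →ₙₐ[k] A)

lemma map_one_mul (c : C) : φ 1 * φ c = φ c := by rw [← map_mul, one_mul]

lemma map_mul_one (c : C) : φ c * φ 1 = φ c := by rw [← map_mul, mul_one]

/-- The subgroup `eX`, where `e` is the image of `1`. -/
def corner (X : Type*) [AddCommGroup X] [Module A X] : AddSubgroup X where
  carrier := {x | φ 1 • x = x}
  zero_mem' := smul_zero _
  add_mem' := fun {x y} hx hy => by
    rw [Set.mem_ofPred_eq] at *
    rw [smul_add, hx, hy]
  neg_mem' := fun {x} hx => by
    rw [Set.mem_ofPred_eq] at *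
    rw [smul_neg, hx]

section Module

variable {X : Type*} [AddCommGroup X] [Module A X]

lemma mem_corner_iff {x : X} : x ∈ corner φ X ↔ φ 1 • x = x := Iff.rfl

lemma smul_mem_corner (c : C) (x : X) : φ c • x ∈ corner φ X := by
  rw [mem_corner_iff, ← mul_smul, map_one_mul]

instance cornerModule : Module C (corner φ X) where
  smul c x := ⟨φ c • (x : X), smul_mem_corner φ c (x : X)⟩
  one_smul x := Subtype.ext x.2
  mul_smul c d x := Subtype.ext ((congrArg (· • (x : X)) (map_mul φ c d)).trans (mul_smul _ _ _))
  smul_zero _ := Subtype.ext (smul_zero _)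
  smul_add _ _ _ := Subtype.ext (smul_add _ _ _)
  add_smul c d x := Subtype.ext ((congrArg (· • (x : X)) (map_add φ c d)).trans (add_smul _ _ _))
  zero_smul x := Subtype.ext ((congrArg (· • (x : X)) (map_zero φ)).trans (zero_smul _ _))

lemma coe_smul_corner (c : C) (x : corner φ X) : ((c • x : corner φ X) : X) = φ c • (x : X) := rfl

variable {Y : Type*} [AddCommGroup Y] [Module A Y]

/-- The map `eX → eY` induced by a linear map. -/
def cornerMap (f : X →ₗ[A] Y) : corner φ X →ₗ[C] corner φ Y where
  toFun x := ⟨f x, by rw [mem_corner_iff, ← map_smul, (mem_corner_iff φ).1 x.2]⟩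
  map_add' x y := Subtype.ext (map_add f _ _)
  map_smul' c x := Subtype.ext (map_smul f _ _)

lemma coe_cornerMap (f : X →ₗ[A] Y) (x : corner φ X) : (cornerMap φ f x : Y) = f x := rfl

end Module

/-- The functor `X ↦ eX`. -/
def cornerFunctor : ModuleCat.{max u₁ u₂} A ⥤ ModuleCat.{max u₁ u₂} C where
  obj X := ModuleCat.of C (corner φ X)
  map f := ModuleCat.ofHom (cornerMap φ f.hom)
  map_id _ := rfl
  map_comp _ _ := rfl

section Full

variable {ι : Type*} [Fintype ι] {a b : ι → A} (h : ∑ i, a i * φ 1 * b i = 1) (ψ : A →+ C)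
  (hφψ : ∀ x, φ (ψ x) = φ 1 * x * φ 1)

include h

lemma eq_sum_smul {X : Type*} [AddCommGroup X] [Module A X] (x : X) :
    x = ∑ i, a i • φ 1 • b i • x := by
  conv_lhs => rw [← one_smul A x, ← h, Finset.sum_smul]
  simp_rw [mul_smul]

include hφψ

lemma exists_cornerMap_eq {X Y : Type*} [AddCommGroup X] [Module A X] [AddCommGroup Y] [Module A Y]
    (g : corner φ X →ₗ[C] corner φ Y) : ∃ f : X →ₗ[A] Y, cornerMap φ f = g := by
  let p : X → corner φ X := fun x => ⟨φ 1 • x, smul_mem_corner φ 1 x⟩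
  have key : ∀ c x, p (c • x) = ∑ j, ψ (c * a j) • p (b j • x) := by
    intro c x
    refine Subtype.ext ?_
    simp only [AddSubgroup.val_finsetSum, coe_smul_corner, hφψ, p]
    conv_lhs => rw [eq_sum_smul φ h x, Finset.smul_sum, Finset.smul_sum]
    refine Finset.sum_congr rfl fun j _ => ?_
    rw [← mul_smul (φ 1 * (c * a j) * φ 1), mul_assoc _ (φ 1), map_one_mul]
    simp_rw [mul_smul]
  -- Linearity forces this formula, since `x = ∑ a_i e b_i x` with `e = φ 1`.
  let f : X →ₗ[A] Y :=
    { toFun := fun x => ∑ i, a i • (g (p (b i • x)) : Y)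
      map_add' := fun x y => by
        rw [← Finset.sum_add_distrib]
        refine Finset.sum_congr rfl fun i _ => ?_
        have : p (b i • (x + y)) = p (b i • x) + p (b i • y) :=
          Subtype.ext (by simp [p, smul_add])
        rw [this, map_add, AddSubgroup.coe_add, smul_add]
      map_smul' := fun c x => by
        have h1 : ∀ y : corner φ Y, ∀ c, ∑ i, a i • φ (ψ (b i * c)) • (y : Y) = c • (y : Y) := by
          intro y c
          conv_rhs => rw [eq_sum_smul φ h (c • (y : Y))]
          refine Finset.sum_congr rfl fun i _ => ?_
          rw [hφψ, mul_smul, (mem_corner_iff φ).1 y.2, mul_smul, mul_smul]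
        have h2 : ∀ i, (g (p (b i • c • x)) : Y) =
            ∑ j, φ (ψ (b i * (c * a j))) • (g (p (b j • x)) : Y) := by
          intro i
          rw [← mul_smul, key, map_sum, AddSubgroup.val_finsetSum]
          simp_rw [map_smul, coe_smul_corner, mul_assoc]
        simp_rw [h2, Finset.smul_sum]
        rw [Finset.sum_comm]
        simp_rw [h1, RingHom.id_apply, mul_smul] }
  refine ⟨f, LinearMap.ext fun x => Subtype.ext ?_⟩
  rw [coe_cornerMap]
  change ∑ i, a i • (g (p (b i • (x : X))) : Y) = _
  have h2 : ∀ i, p (b i • (x : X)) = ψ (b i) • x := by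
    intro i
    refine Subtype.ext ?_
    rw [coe_smul_corner, hφψ, mul_smul, (mem_corner_iff φ).1 x.2, mul_smul]
  simp_rw [h2, map_smul, coe_smul_corner, hφψ]
  conv_rhs => rw [eq_sum_smul φ h (g x : Y)]
  simp_rw [mul_smul, (mem_corner_iff φ).1 (g x).2]

end Full

/-- The module coinduced from a module over the corner ring. -/
def coinduced (Y : Type*) [AddCommGroup Y] [Module C Y] : AddSubgroup (A →+ Y) where
  -- Taking `c = 1` gives `f (e x) = f x`, so these are the `C`-linear maps from `eA` to `Y`.
  carrier := {f | ∀ c x, f (φ c * x) = c • f x}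
  zero_mem' := fun c x => by simp
  add_mem' := fun {f g} hf hg c x => by simp [hf c x, hg c x]
  neg_mem' := fun {f} hf c x => by simp [hf c x]

section Coinduced

variable {Y : Type*} [AddCommGroup Y] [Module C Y]

instance coinducedModule : Module A (coinduced φ Y) where
  smul c f := ⟨(f : A →+ Y).comp (AddMonoidHom.mulRight c), fun d x => by
    simp only [AddMonoidHom.comp_apply, AddMonoidHom.mulRight_apply]
    rw [mul_assoc, f.2]⟩
  one_smul f := Subtype.ext (AddMonoidHom.ext fun x => congrArg (f : A →+ Y) (mul_one x))
  mul_smul c d f := Subtype.ext (AddMonoidHom.ext fun x =>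
    congrArg (f : A →+ Y) (mul_assoc x c d).symm)
  smul_zero c := rfl
  smul_add c f g := rfl
  add_smul c d f := Subtype.ext (AddMonoidHom.ext fun x =>
    (congrArg (f : A →+ Y) (mul_add x c d)).trans (map_add _ _ _))
  zero_smul f := Subtype.ext (AddMonoidHom.ext fun x =>
    (congrArg (f : A →+ Y) (mul_zero x)).trans (map_zero _))

lemma coe_smul_coinduced (c : A) (f : coinduced φ Y) (x : A) :
    (c • f : coinduced φ Y).1 x = f.1 (x * c) := rfl

variable {ψ : A →+ C} (hψφ : ∀ c, ψ (φ c) = c) (hφψ : ∀ x, φ (ψ x) = φ 1 * x * φ 1)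

/-- The corner of the coinduced module is the original module. -/
def cornerCoinducedEquiv : corner φ (coinduced φ Y) ≃ₗ[C] Y where
  toFun f := f.1.1 1
  map_add' f g := rfl
  map_smul' c f := by
    rw [coe_smul_corner, coe_smul_coinduced, one_mul, ← mul_one (φ c), f.1.2]
    rfl
  invFun y := ⟨⟨(AddMonoidHom.flip (smulAddHom C Y) y).comp ψ, fun c x => by
      have : ψ (φ c * x) = c * ψ x := by
        rw [← hψφ (c * ψ x), map_mul φ, hφψ, ← hψφ (ψ (φ c * x)), hφψ, ← mul_assoc, ← mul_assoc,
          map_one_mul, ← mul_assoc, map_mul_one]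
      simp [this, mul_smul]⟩, by
    rw [mem_corner_iff]
    refine Subtype.ext (AddMonoidHom.ext fun x => ?_)
    have : ψ (x * φ 1) = ψ x := by
      rw [← hψφ (ψ x), hφψ, ← hψφ (ψ (x * φ 1)), hφψ, mul_assoc, mul_assoc, map_one_mul, mul_assoc]
    rw [coe_smul_coinduced]
    simp [this]⟩
  left_inv f := by
    refine Subtype.ext (Subtype.ext (AddMonoidHom.ext fun x => ?_))
    have h1 : ∀ x, f.1.1 (x * φ 1) = f.1.1 x := fun x => by
      rw [← coe_smul_coinduced, (mem_corner_iff φ).1 f.2]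
    have h2 : ψ x • f.1.1 1 = f.1.1 x := by
      rw [← f.1.2, hφψ, mul_one, h1, f.1.2, one_smul]
    simpa using h2
  right_inv y := by
    have : ψ 1 = 1 := by rw [← hψφ (ψ 1), hφψ, mul_one, map_one_mul, hψφ]
    simp [this]

end Coinduced

open scoped ModuleCat.Algebra in
-- The hypothesis `h` says that `e = φ 1` is full, `AeA = A`; the maps `φ` and `ψ` identify `C` with
-- `eAe`. Fullness makes `X ↦ eX` fully faithful, and coinduction makes it essentially surjective.
theorem isMoritaEquivalent_corner {ι : Type*} [Fintype ι] {a b : ι → A}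
    (h : ∑ i, a i * φ 1 * b i = 1) (ψ : A →+ C) (hψφ : ∀ c, ψ (φ c) = c)
    (hφψ : ∀ x, φ (ψ x) = φ 1 * x * φ 1) : IsMoritaEquivalent k A C := by
  have h1 : (cornerFunctor φ).Faithful := ⟨fun {X Y f g} hfg => by
    ext x
    have h2 : ∀ y : X, f.hom (φ 1 • y) = g.hom (φ 1 • y) := fun y => by
      have := congrArg (fun F => (show corner φ Y from F.hom (⟨φ 1 • y, smul_mem_corner φ 1 y⟩ :
        corner φ X)).1) hfg
      exact this
    rw [eq_sum_smul φ h x, map_sum, map_sum]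
    simp_rw [map_smul f.hom (a _), map_smul g.hom (a _), h2]⟩
  have h2 : (cornerFunctor φ).Full := ⟨fun {X Y} g => by
    obtain ⟨f, hf⟩ := exists_cornerMap_eq φ h ψ hφψ (X := X) (Y := Y) g.hom
    exact ⟨ModuleCat.ofHom f, ModuleCat.hom_ext hf⟩⟩
  have h3 : (cornerFunctor φ).EssSurj := ⟨fun Y => ⟨ModuleCat.of A (coinduced φ Y),
    ⟨(cornerCoinducedEquiv φ hψφ hφψ).toModuleIso⟩⟩⟩
  have h4 : (cornerFunctor φ).IsEquivalence := ⟨h1, h2, h3⟩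
  have h5 : (cornerFunctor φ).Linear k := ⟨fun {X Y} f r => by
    refine ModuleCat.hom_ext (LinearMap.ext fun x => Subtype.ext ?_)
    change algebraMap k A r • f.hom x.1 = φ (algebraMap k C r) • f.hom x.1
    have hx : φ 1 • f.hom x.1 = f.hom x.1 :=
      (map_smul f.hom _ _).symm.trans (congrArg f.hom ((mem_corner_iff φ).1 x.2))
    have hr : φ (algebraMap k C r) = algebraMap k A r * φ 1 := by
      rw [Algebra.algebraMap_eq_smul_one, map_smul, Algebra.smul_def]
    rw [hr, mul_smul, hx]⟩
  exact ⟨⟨{ eqv := (cornerFunctor φ).asEquivalence, linear := h5 }⟩⟩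

end Corner

/-! ### Morita equivalence with the algebra of the Boolean lattice -/

section Boolean

variable {k : Type*} {B W : Type*} [Group W] {M : CoxeterMatrix B} (cs : CoxeterSystem M W)
  [Field k] [Fintype W]

lemma ascents_top_coe (a : Finset B) : ascents cs (top cs a 1) = (↑a)ᶜ := by
  rw [← ascents_top_one cs (↑a)ᶜ, compl_compl]

lemma top_coe_injective : Function.Injective fun a : Finset B => top cs (a : Set B) 1 := by
  intro a b h
  have := congrArg (ascents cs) h
  simp only [ascents_top_coe] at this
  exact Finset.coe_injective (compl_injective this)

lemma matrixUnit_mul (w x y z : W) [Decidable (x = y)] : matrixUnit k cs w x * matrixUnit k cs y z =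
    if x = y then matrixUnit k cs w z else 0 := by
  refine LinearMap.ext fun v => ?_
  rw [Module.End.mul_apply, matrixUnit_apply cs y, map_smul, matrixUnit_apply, repr_antisymVector]
  split_ifs with h
  · rw [h, Finsupp.single_eq_same, one_smul, matrixUnit_apply]
  · rw [Finsupp.single_eq_of_ne h, zero_smul, smul_zero, LinearMap.zero_apply]

variable (k) in
/-- The matrix unit `v_w ↦ v_{w'}`, as an element of the Hecke group algebra. -/
noncomputable def heckeUnit {w' w : W} (h : ascents cs w ⊆ ascents cs w') :
    OpAlg (heckeGroupAlgebra k cs) := ⟨matrixUnit k cs w' w, matrixUnit_mem cs h⟩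

variable [Fintype B] [DecidableEq B]

/-- The subset `a` is represented by an element with ascent set `aᶜ`; complementation reverses
inclusions, so `a ≤ b` is the condition for the matrix unit from `b` to `a`. -/
lemma sum_matrixUnit_mem (f : IncidenceAlgebra k (Finset B)) :
    ∑ a, ∑ b, f a b • matrixUnit k cs (top cs (a : Set B) 1) (top cs (b : Set B) 1) ∈
      heckeGroupAlgebra k cs := by
  refine sum_mem fun a _ => sum_mem fun b _ => ?_
  by_cases h : a ≤ b
  · refine Subalgebra.smul_mem _ (matrixUnit_mem cs ?_) _
    rw [ascents_top_coe, ascents_top_coe, Set.compl_subset_compl]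
    exact h
  · rw [f.apply_eq_zero_of_not_le h, zero_smul]
    exact zero_mem _

lemma sum_matrixUnit_mul (f g : IncidenceAlgebra k (Finset B)) :
    ∑ a, ∑ b, (f * g) a b • matrixUnit k cs (top cs (a : Set B) 1) (top cs (b : Set B) 1) =
      (∑ a, ∑ b, f a b • matrixUnit k cs (top cs (a : Set B) 1) (top cs (b : Set B) 1)) *
        ∑ a, ∑ b, g a b • matrixUnit k cs (top cs (a : Set B) 1) (top cs (b : Set B) 1) := by
  classical
  have h : ∀ a b, (f * g) a b = ∑ x, f a x * g x b := by
    intro a b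
    rw [IncidenceAlgebra.mul_apply]
    refine Finset.sum_subset (Finset.subset_univ _) fun x _ hx => ?_
    by_contra hne
    obtain ⟨h1, h2⟩ := ne_zero_and_ne_zero_of_mul hne
    exact hx (Finset.mem_Icc.2
      ⟨IncidenceAlgebra.le_of_ne_zero h1, IncidenceAlgebra.le_of_ne_zero h2⟩)
  simp_rw [Finset.sum_mul, Finset.mul_sum, smul_mul_smul_comm, matrixUnit_mul,
    (top_coe_injective cs).eq_iff, smul_ite, smul_zero]
  refine Finset.sum_congr rfl fun a _ => ?_
  simp_rw [h, Finset.sum_smul]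
  rw [Finset.sum_comm]
  refine Finset.sum_congr rfl fun b _ => ?_
  rw [Finset.sum_comm]
  refine Finset.sum_congr rfl fun c _ => ?_
  rw [Finset.sum_ite_eq, if_pos (Finset.mem_univ b)]

variable (k) in
/-- The incidence algebra of the Boolean lattice, as a corner of the Hecke group algebra. -/
noncomputable def incidenceCorner :
    IncidenceAlgebra k (Finset B) →ₙₐ[k] OpAlg (heckeGroupAlgebra k cs) where
  toFun f := ⟨_, sum_matrixUnit_mem cs f⟩
  map_zero' := Subtype.ext (by simp; rfl)
  map_add' f g := Subtype.ext (by
    change _ = (∑ a, ∑ b, _ : Module.End k (MonoidAlgebra k W)) + ∑ a, ∑ b, _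
    simp_rw [IncidenceAlgebra.add_apply, add_smul, Finset.sum_add_distrib])
  map_smul' c f := Subtype.ext (by
    change _ = c • (∑ a, ∑ b, _ : Module.End k (MonoidAlgebra k W))
    simp_rw [IncidenceAlgebra.constSMul_apply, smul_assoc, Finset.smul_sum])
  map_mul' f g := Subtype.ext (sum_matrixUnit_mul cs f g)

lemma incidenceCorner_smul (f : IncidenceAlgebra k (Finset B)) (v : MonoidAlgebra k W) :
    incidenceCorner k cs f • v = ∑ a, ∑ b,
      (f a b * (antisymBasis k cs).repr v (top cs (b : Set B) 1)) •
        antisymVector k cs (top cs (a : Set B) 1) := by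
  change (∑ a, ∑ b, f a b • matrixUnit k cs (top cs (a : Set B) 1) (top cs (b : Set B) 1) :
    Module.End k (MonoidAlgebra k W)) v = _
  simp only [LinearMap.sum_apply, LinearMap.smul_apply, matrixUnit_apply, mul_smul]

lemma incidenceCorner_one_smul (v : MonoidAlgebra k W) :
    incidenceCorner k cs (1 : IncidenceAlgebra k (Finset B)) • v = ∑ a : Finset B,
      (antisymBasis k cs).repr v (top cs (a : Set B) 1) •
        antisymVector k cs (top cs (a : Set B) 1) := by
  simp [incidenceCorner_smul, ite_mul, ite_smul]

lemma repr_incidenceCorner_smul (f : IncidenceAlgebra k (Finset B)) (v : MonoidAlgebra k W)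
    (a : Finset B) : (antisymBasis k cs).repr (incidenceCorner k cs f • v) (top cs (a : Set B) 1) =
      ∑ b, f a b * (antisymBasis k cs).repr v (top cs (b : Set B) 1) := by
  classical
  rw [incidenceCorner_smul]
  simp only [map_sum, map_smul, repr_antisymVector, Finsupp.coe_finsetSum, Finset.sum_apply,
    Finsupp.smul_apply, Finsupp.single_apply, (top_coe_injective cs).eq_iff, smul_eq_mul, mul_ite,
    mul_one, mul_zero]
  rw [Finset.sum_eq_single a]
  · simp
  · intro c _ hc
    simp [hc]
  · simp

variable (k) in
/-- The entries of an element of the Hecke group algebra in the corner. -/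
noncomputable def cornerEntries :
    OpAlg (heckeGroupAlgebra k cs) →+ IncidenceAlgebra k (Finset B) where
  toFun x :=
    { toFun := fun a b => (antisymBasis k cs).repr (x • antisymVector k cs (top cs (b : Set B) 1))
        (top cs (a : Set B) 1)
      eq_zero_of_not_le' := fun a b h => by
        by_contra hne
        obtain ⟨w, h1, h2⟩ := repr_apply_ne_zero cs x.2 hne
        rw [repr_antisymVector] at h1
        obtain rfl : w = top cs (b : Set B) 1 := by
          by_contra hw
          exact h1 (Finsupp.single_eq_of_ne hw)
        rw [ascents_top_coe, ascents_top_coe, Set.compl_subset_compl] at h2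
        exact h h2 }
  map_zero' := by ext a b; simp [IncidenceAlgebra.zero_apply]
  map_add' x y := by ext a b; simp [IncidenceAlgebra.add_apply, add_smul]

omit [Fintype B] [DecidableEq B] in
lemma cornerEntries_apply (x : OpAlg (heckeGroupAlgebra k cs)) (a b : Finset B) :
    cornerEntries k cs x a b = (antisymBasis k cs).repr
      (x • antisymVector k cs (top cs (b : Set B) 1)) (top cs (a : Set B) 1) := rfl

lemma cornerEntries_incidenceCorner (f : IncidenceAlgebra k (Finset B)) :
    cornerEntries k cs (incidenceCorner k cs f) = f := by
  classical
  ext a b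
  rw [cornerEntries_apply, repr_incidenceCorner_smul, repr_antisymVector]
  simp [Finsupp.single_apply, (top_coe_injective cs).eq_iff]

lemma incidenceCorner_cornerEntries (x : OpAlg (heckeGroupAlgebra k cs)) :
    incidenceCorner k cs (cornerEntries k cs x) =
      incidenceCorner k cs 1 * x * incidenceCorner k cs 1 := by
  refine OpAlg.ext fun v => ?_
  rw [mul_smul, mul_smul, incidenceCorner_one_smul, incidenceCorner_smul,
    incidenceCorner_one_smul cs v, Finset.smul_sum]
  refine Finset.sum_congr rfl fun a _ => ?_
  rw [← Finset.sum_smul, map_sum, Finsupp.coe_finsetSum, Finset.sum_apply]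
  congr 1
  refine Finset.sum_congr rfl fun b _ => ?_
  rw [smul_algebra_smul_comm, map_smul, Finsupp.smul_apply, smul_eq_mul, mul_comm,
    cornerEntries_apply]

/-- The corner is full: each `e_{w,w}` factors through the representative with the same ascent set
as `w`, and the `e_{w,w}` sum to `1`. -/
lemma isMoritaEquivalent_incidenceAlgebra : IsMoritaEquivalent k (OpAlg (heckeGroupAlgebra k cs))
    (IncidenceAlgebra k (Finset B)) := by
  classical
  let t : W → Finset B := fun w => (ascents cs w)ᶜ.toFinset
  have ht : ∀ w, ascents cs (top cs (t w : Set B) 1) = ascents cs w := fun w => by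
    rw [ascents_top_coe, Set.coe_toFinset, compl_compl]
  refine isMoritaEquivalent_corner (incidenceCorner k cs)
    (a := fun w => heckeUnit k cs (ht w).le) (b := fun w => heckeUnit k cs (ht w).ge) ?_
    (cornerEntries k cs) (cornerEntries_incidenceCorner cs) (incidenceCorner_cornerEntries cs)
  have hu : ∀ {w' w : W} (h : ascents cs w ⊆ ascents cs w') (v : MonoidAlgebra k W),
      heckeUnit k cs h • v = (antisymBasis k cs).repr v w • antisymVector k cs w' :=
    fun _ v => matrixUnit_apply cs _ _ v
  refine OpAlg.ext fun v => ?_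
  rw [one_smul, Finset.sum_smul]
  conv_rhs => rw [← sum_repr_antisymBasis cs v]
  refine Finset.sum_congr rfl fun w _ => ?_
  rw [mul_smul, mul_smul, hu, hu, smul_algebra_smul_comm, map_smul, Finsupp.smul_apply,
    repr_incidenceCorner_smul, repr_antisymVector]
  simp [Finsupp.single_apply, (top_coe_injective cs).eq_iff]

end Boolean

end HeckeGroup

/-- Representation theory of the Hecke group algebra of a finite Coxeter group. -/
theorem mainTheorem3 {k : Type*} [Field k] {B : Type*} [Finite B] [DecidableEq B]
    {W : Type*} [Group W] [Fintype W] {M : CoxeterMatrix B} (cs : CoxeterSystem M W) :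
    -- (i) the diagonal matrix units of the basis `v_w`
    (∃ b : Module.Basis W k (MonoidAlgebra k W),
      (∀ w, b w = antisymVector k cs w) ∧
      ∃ e : W → OpAlg (heckeGroupAlgebra k cs),
        (∀ w, (e w).toEnd = (b.coord w).smulRight (b w)) ∧
        CompleteOrthogonalIdempotents e ∧
        ∀ w, IsPrimitiveIdempotent (e w)) ∧
    -- (ii) Morita equivalence with the algebra of the Boolean lattice
    IsMoritaEquivalent k (OpAlg (heckeGroupAlgebra k cs)) (IncidenceAlgebra k (Finset B)) ∧
    -- (iii) indecomposable projective modules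
    AreTheIndecomposableProjectives.{v} (OpAlg (heckeGroupAlgebra k cs))
      (fun I : Set B => antisymModule k cs I) ∧
    -- (iv) simple modules
    AreTheSimpleModules.{v} (OpAlg (heckeGroupAlgebra k cs))
      (fun I : Set B => simpleQuotient k cs I) ∧
    -- their elements are left antisymmetric for `i ∈ I` and left symmetric for `i ∉ I`:
    -- `S_I` embeds, by `[x] ↦ [x]` for `x ∈ P_I`, in the quotient of `kW` by all `s_i v = v`, `i ∉ I`
    (∀ I : Set B, ∃ f : simpleQuotient k cs I →ₗ[k]
        MonoidAlgebra k W ⧸ leftSymRelations k cs I,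
      Function.Injective f ∧ ∀ x : antisymModule k cs I,
        f (Submodule.Quotient.mk x) = Submodule.Quotient.mk (x : MonoidAlgebra k W)) ∧
    -- restriction to `W`: the ribbon Young representations
    (∀ I : Set B, Nonempty (resGroup k cs I ≃ₗ[OpAlg (groupOperators k cs)]
      ribbon k cs I)) ∧
    -- restriction to the `0`-Hecke algebra: the indecomposable projective modules
    AreTheIndecomposableProjectives.{v} (OpAlg (zeroHeckeAlgebra k cs))
      (fun I : Set B => resZeroHecke k cs I) := by
  have := Fintype.ofFinite B
  refine ⟨⟨antisymBasis k cs, antisymBasis_apply k cs, diagUnit k cs, toEnd_diagUnit cs,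
    completeOrthogonalIdempotents_diagUnit cs, isPrimitiveIdempotent_diagUnit cs⟩,
    isMoritaEquivalent_incidenceAlgebra cs, areTheIndecomposableProjectives_antisymModule k cs,
    areTheSimpleModules_simpleQuotient k cs, exists_embedding k cs,
    nonempty_resGroup_equiv_ribbon k cs, areTheIndecomposableProjectives_resZeroHecke k cs⟩
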